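/- **Setting.** Let $g(x,\theta)\in\mathbb R^p$, $\theta\in\mathbb R^p$, be measurable in $x$, let $c:\mathbb R^p\to\mathbb R^q$, and write $G_x(\theta)=\partial g(x,\theta)/\partial\theta^T$, $C(\theta)=\partial c(\theta)/\partial\theta^T$. Let $F_0$ be a probability law and $\theta_0\in\mathbb R^p$ with $E_{F_0}[g(X,\theta_0)]=0$ and $c(\theta_0)=0$. Put $$S_{11}=E_{F_0}[g(X,\theta_0)g(X,\theta_0)^T],\quad S_{12}=E_{F_0}[G_X(\theta_0)],\quad V=(S_{12}^TS_{11}^{-1}S_{12})^{-1},\quad Q(\theta_0)=\big(C(\theta_0)VC(\theta_0)^T\big)^{-1}.$$ Assume: (i) $S_{11}$ is positive definite and $\operatorname{rank}S_{12}=p$; (ii) $\|g(x,\theta)\|^3$ is bounded, for $\theta$ in a neighbourhood of $\theta_0$, by an $F_0$-integrable function of $x$; (iii) in a neighbourhood of $\theta_0$, $G_x$ exists, is continuous in $\theta$, and $\|G_x(\theta)\|$ is bounded by an $F_0$-integrable function of $x$; (iv) the same as (iii) holds for $\partial G_x(\theta)/\partial\theta$; (v) in a neighbourhood of $\theta_0$,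 $C$ exists and is differentiable with bounded derivative, and $\operatorname{rank}C(\theta_0)=q$. **Statistic.** For a sample $x_1,\dots,x_n$, a multiplier $t(\theta)\in\mathbb R^p$ satisfies $1+t(\theta)^Tg(x_i,\theta)>0$ for all $i$ and $\sum_i g(x_i,\theta)/(1+t(\theta)^Tg(x_i,\theta))=0$. A restricted maximum empirical likelihood estimator over $\Theta\subseteq\mathbb R^p$ is a maximizer $\widetilde\theta_n$ of $-\sum_i\log(1+t(\theta)^Tg(x_i,\theta))$ over those $\theta\in\Theta$ that have a multiplier and satisfy $c(\theta)=0$. Let $\phi$ be convex on $(0,\infty)$, differentiable near $1$ and twice differentiable at $1$, with $\phi(1)=\phi'(1)=0<\phi''(1)$, and put $$T_n^\phi(\widetilde\theta_n)=\frac{2}{\phi''(1)}\sum_{i=1}^n\frac{\phi\big(1+t(\widetilde\theta_n)^Tg(x_i,\widetilde\theta_n)\big)}{1+t(\widetilde\theta_n)^Tg(x_i,\widetilde\theta_n)} .$$ **Contiguous alternatives.** Let $\bar f\in\mathbb R^q$. The $n$-th sample $X_1,\dots,X_n$ is i.i.d. with law $F_n$, where, for some $\theta_n\to\theta_0$ and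 all large $n$, $$c(\theta_n)=n^{-1/2}\bar f,\qquad E_{F_n}[g(X,\theta_n)]=0,$$ the moments $E_{F_n}\|g(X,\theta_n)\|^3$ are bounded in $n$, and the product laws $F_n^{\otimes n}$ are contiguous to $F_0^{\otimes n}$. **Theorem.** There is a neighbourhood $U$ of $\theta_0$, depending only on $F_0,g,c,\theta_0$, such that for all such alternatives and every neighbourhood $\Theta$ of $\theta_0$ the following hold. (a) If $\Theta\subseteq U$, then a restricted maximum empirical likelihood estimator over $\Theta$ exists with probability tending to one. (b) If, with probability tending to one, $\widetilde\theta_n$ is a restricted maximum empirical likelihood estimator over $\Theta$ that lies in $U$ (for instance a consistent one), then for every $\phi$ as above $$T_n^\phi(\widetilde\theta_n)\xrightarrow{\ \mathcal L\ }\chi^2_q\big(\bar f^{\,T}Q(\theta_0)\bar f\big),$$ the noncentral chi-squared law with $q$ degrees of freedom and noncentrality $\bar f^{\,T}Q(\theta_0)\bar f$. -/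

import Mathlib

open MeasureTheory ProbabilityTheory Filter Topology
open scoped NNReal ENNReal Matrix

noncomputable section

namespace EmpLik

/-- Euclidean space of dimension `d`. -/
abbrev E (d : ℕ) := EuclideanSpace ℝ (Fin d)

/-- The Jacobian matrix `∂f/∂θᵀ` of `f` at `θ`. -/
def jacobian {p r : ℕ} (f : E p → E r) (θ : E p) : Matrix (Fin r) (Fin p) ℝ :=
  Matrix.of fun j l => fderiv ℝ f θ (EuclideanSpace.single l 1) j

/-- `S₁₁(θ) = E_F[g(X,θ) g(X,θ)ᵀ]`. -/
def S11 {𝒳 : Type*} [MeasurableSpace 𝒳] {p r : ℕ} (F : Measure 𝒳) (g : 𝒳 → E p → E r)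
    (θ : E p) : Matrix (Fin r) (Fin r) ℝ :=
  Matrix.of fun j l => ∫ x, g x θ j * g x θ l ∂F

/-- `S₁₂(θ) = E_F[G_X(θ)]`, where `G_x(θ) = ∂g(x,θ)/∂θᵀ`. -/
def S12 {𝒳 : Type*} [MeasurableSpace 𝒳] {p r : ℕ} (F : Measure 𝒳) (g : 𝒳 → E p → E r)
    (θ : E p) : Matrix (Fin r) (Fin p) ℝ :=
  Matrix.of fun j l => ∫ x, jacobian (g x) θ j l ∂F

/-- `V(θ) = (S₁₂ᵀ S₁₁⁻¹ S₁₂)⁻¹`. -/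
def V {𝒳 : Type*} [MeasurableSpace 𝒳] {p r : ℕ} (F : Measure 𝒳) (g : 𝒳 → E p → E r)
    (θ : E p) : Matrix (Fin p) (Fin p) ℝ :=
  ((S12 F g θ)ᵀ * (S11 F g θ)⁻¹ * S12 F g θ)⁻¹

/-- `Q(θ) = (C V Cᵀ)⁻¹`, where `C(θ) = ∂c/∂θᵀ`. -/
def Q {𝒳 : Type*} [MeasurableSpace 𝒳] {p r q : ℕ} (F : Measure 𝒳) (g : 𝒳 → E p → E r)
    (c : E p → E q) (θ : E p) : Matrix (Fin q) (Fin q) ℝ :=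
  (jacobian c θ * V F g θ * (jacobian c θ)ᵀ)⁻¹

/-- The regularity conditions on the estimating function `g` at `θ₀` under the law `F`. -/
structure Regular {𝒳 : Type*} [MeasurableSpace 𝒳] {p r : ℕ} (F : Measure 𝒳)
    (g : 𝒳 → E p → E r) (θ₀ : E p) : Prop where
  posDef : (S11 F g θ₀).PosDef
  rank : (S12 F g θ₀).rank = p
  bound_cube : ∃ N ∈ 𝓝 θ₀, ∃ K : 𝒳 → ℝ, Integrable K F ∧ ∀ x, ∀ θ ∈ N, ‖g x θ‖ ^ 3 ≤ K x
  bound_deriv : ∃ N ∈ 𝓝 θ₀, ∃ K : 𝒳 → ℝ, Integrable K F ∧ ∀ x,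
    (∀ θ ∈ N, DifferentiableAt ℝ (g x) θ) ∧
    ContinuousOn (fderiv ℝ (g x)) N ∧
    ∀ θ ∈ N, ‖fderiv ℝ (g x) θ‖ ≤ K x
  bound_deriv2 : ∃ N ∈ 𝓝 θ₀, ∃ K : 𝒳 → ℝ, Integrable K F ∧ ∀ x,
    (∀ θ ∈ N, DifferentiableAt ℝ (fderiv ℝ (g x)) θ) ∧
    ContinuousOn (fderiv ℝ (fderiv ℝ (g x))) N ∧
    ∀ θ ∈ N, ‖fderiv ℝ (fderiv ℝ (g x)) θ‖ ≤ K x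

/-- The conditions on the constraint function `c` at `θ₀`: near `θ₀` the Jacobian `C` exists
and has a bounded derivative (so that `C` is continuous there), and `C(θ₀)` has full
rank `q`. -/
structure RegularConstraint {p q : ℕ} (c : E p → E q) (θ₀ : E p) : Prop where
  bound_deriv : ∃ N ∈ 𝓝 θ₀, ∃ B : ℝ, ∀ θ ∈ N,
    DifferentiableAt ℝ c θ ∧ DifferentiableAt ℝ (fderiv ℝ c) θ ∧
    ‖fderiv ℝ (fderiv ℝ c) θ‖ ≤ B
  rank : (jacobian c θ₀).rank = q

/-- The class `Φ`: convex functions on `(0,∞)`, twice differentiable at `1`, with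
`φ(1) = φ'(1) = 0 < φ''(1)`. Values of `φ` outside `(0,∞)` play no role. -/
structure PhiClass (φ : ℝ → ℝ) : Prop where
  convex : ConvexOn ℝ (Set.Ioi 0) φ
  map_one : φ 1 = 0
  differentiable : ∀ᶠ u in 𝓝 (1 : ℝ), DifferentiableAt ℝ φ u
  differentiable2 : DifferentiableAt ℝ (deriv φ) 1
  deriv_one : deriv φ 1 = 0
  deriv2_pos : 0 < deriv (deriv φ) 1

/-- The `φ`-divergence `∑ᵢ bᵢ φ(aᵢ / bᵢ)` of two positive probability vectors. -/
def phiDivergence {n : ℕ} (φ : ℝ → ℝ) (a b : Fin n → ℝ) : ℝ :=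
  ∑ i, b i * φ (a i / b i)

/-- The denominator `1 + tᵀ g(xᵢ,θ)`. -/
def tilt {𝒳 : Type*} {p r n : ℕ} (g : 𝒳 → E p → E r) (x : Fin n → 𝒳) (θ : E p) (t : E r)
    (i : Fin n) : ℝ :=
  1 + inner ℝ t (g (x i) θ)

/-- The weight `pᵢ(θ) = n⁻¹ (1 + tᵀ g(xᵢ,θ))⁻¹`. -/
def weight {𝒳 : Type*} {p r n : ℕ} (g : 𝒳 → E p → E r) (x : Fin n → 𝒳) (θ : E p) (t : E r)
    (i : Fin n) : ℝ :=
  (n : ℝ)⁻¹ * (tilt g x θ t i)⁻¹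

/-- `t` is a Lagrange multiplier `t(θ)` for the sample `x`: the weights `pᵢ(θ)` are positive and
`∑ᵢ pᵢ(θ) g(xᵢ,θ) = 0`. For `n ≥ 1` these weights then sum to one. -/
def IsMultiplier {𝒳 : Type*} {p r n : ℕ} (g : 𝒳 → E p → E r) (x : Fin n → 𝒳) (θ : E p)
    (t : E r) : Prop :=
  (∀ i, 0 < tilt g x θ t i) ∧ ∑ i, weight g x θ t i • g (x i) θ = 0

/-- The kernel `-∑ᵢ log(1 + tᵀ g(xᵢ,θ))` of the empirical log-likelihood, at `t = t(θ)`. -/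
def logEL {𝒳 : Type*} {p r n : ℕ} (g : 𝒳 → E p → E r) (x : Fin n → 𝒳) (θ : E p)
    (t : E r) : ℝ :=
  -∑ i, Real.log (tilt g x θ t i)

/-- `θ`, with multiplier `t = t(θ)`, maximizes the empirical log-likelihood of the sample `x`
over the points of `Θ` that satisfy the constraint `c = 0`. Points without a multiplier have
empirical log-likelihood `-∞` and do not compete. -/
def IsRestrictedMELE {𝒳 : Type*} {p r q n : ℕ} (g : 𝒳 → E p → E r) (c : E p → E q)
    (Θ : Set (E p)) (x : Fin n → 𝒳) (θ : E p) (t : E r) : Prop :=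
  θ ∈ Θ ∧ c θ = 0 ∧ IsMultiplier g x θ t ∧
    ∀ θ' ∈ Θ, c θ' = 0 → ∀ t', IsMultiplier g x θ' t' → logEL g x θ' t' ≤ logEL g x θ t

/-- The empirical `φ`-divergence statistic `(2n/φ''(1)) D_φ(F_n, F_{n,θ})` at `θ` with multiplier
`t = t(θ)`; the empirical distribution `F_n` has the uniform weights `1/n`. -/
def statistic {𝒳 : Type*} {p r n : ℕ} (φ : ℝ → ℝ) (g : 𝒳 → E p → E r) (x : Fin n → 𝒳)
    (θ : E p) (t : E r) : ℝ :=
  2 * n / deriv (deriv φ) 1 * phiDivergence φ (fun _ => (n : ℝ)⁻¹) (weight g x θ t)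

/-- Contiguity (Le Cam) of the sequence `P` with respect to the sequence `R`. -/
def Contiguous {Ω : ℕ → Type*} [∀ n, MeasurableSpace (Ω n)] (P R : ∀ n, Measure (Ω n)) : Prop :=
  ∀ A : ∀ n, Set (Ω n), (∀ n, MeasurableSet (A n)) →
    Tendsto (fun n => R n (A n)) atTop (𝓝 0) → Tendsto (fun n => P n (A n)) atTop (𝓝 0)

/-- The law of an i.i.d. sample of size `n` from `F`. -/
abbrev sampleLaw {𝒳 : Type*} [MeasurableSpace 𝒳] (F : Measure 𝒳) [SigmaFinite F] (n : ℕ) :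
    Measure (Fin n → 𝒳) :=
  Measure.pi fun _ => F

/-- The contiguous alternatives `c(θₙ) = n^{-1/2} f`: the observations of the `n`-th sample have
law `F n`, under which `g(·, θₙ)` has mean zero and a bounded third moment, `θₙ → θ₀`, and the
laws of the samples are contiguous to those of samples from `F₀`. -/
structure IsContiguousAlternative {𝒳 : Type*} [MeasurableSpace 𝒳] {p r q : ℕ}
    (F₀ : Measure 𝒳) [IsProbabilityMeasure F₀]
    (F : ℕ → Measure 𝒳) [∀ n, IsProbabilityMeasure (F n)]
    (g : 𝒳 → E p → E r) (c : E p → E q) (θ₀ : E p) (θ : ℕ → E p) (f : E q) : Prop where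
  tendsto : Tendsto θ atTop (𝓝 θ₀)
  constraint : ∀ᶠ n : ℕ in atTop, c (θ n) = (Real.sqrt n)⁻¹ • f
  unbiased : ∀ᶠ n in atTop, ∫ x, g x (θ n) ∂(F n) = 0
  third_moment : ∃ K : ℝ≥0, ∀ᶠ n in atTop, ∫⁻ x, ‖g x (θ n)‖ₑ ^ 3 ∂(F n) ≤ K
  contiguous : Contiguous (fun n => sampleLaw (F n) n) (fun n => sampleLaw F₀ n)

/-- The noncentral chi-squared law `χ²_q(δ)`, `δ ≥ 0`: the law of `∑ᵢ Zᵢ²` for independent normal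
`Z₁, …, Z_q` with unit variances and means `(√δ, 0, …, 0)`. -/
def noncentralChiSquared (q : ℕ) (δ : ℝ) : Measure ℝ :=
  (Measure.pi fun i : Fin q => gaussianReal (if i.val = 0 then Real.sqrt δ else 0) 1).map
    fun z => ∑ i, z i ^ 2

instance (q : ℕ) (δ : ℝ) : IsProbabilityMeasure (noncentralChiSquared q δ) :=
  Measure.isProbabilityMeasure_map
    (Finset.measurable_sum _ fun i _ => (measurable_pi_apply i).pow_const 2).aemeasurable

end EmpLik

end

/-! Write `W = √n · gbar(θn)`, `S = S₁₁`, `G = S₁₂` (square and invertible), `C = C(θ₀)`. At a point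
`θ = θn + v/√n` with `v` bounded, the scaled mean is `W + G v + o(1)`. Expanding the multiplier
equation gives `S τ = W + G v + o(1)` for `τ = √n t(θ)`. Twice the log-likelihood ratio `logSum` and
every `φ`-statistic then equal the same quadratic form `τᵀ S τ` up to `o(1)`, so `φ` does not matter
in the limit (`tendsto_two_mul_logSum`, `tendsto_phi`).

The constraint becomes `C v = -f + o(1)`, so the estimator minimises this form on an affine
subspace. Factor `Q = MᵀM` and put `D = M C G⁻¹`, `L = M`. Then `D S Dᵀ = 1` and `D G = L C`
(`exists_limits`). On the constraint `D S τ = b + o(1)` with `b = D W - L f`, and `‖D S τ‖² ≤ τᵀ S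
τ` (`Limits.norm_sq_le`), so no feasible point does better than `‖b‖²`. A candidate with `S τ ≈ S Dᵀ
b` attains it (`exists_candidate_logSum`). The maximizer is squeezed between the two: the statistic
is `‖b‖² + o(1)` (`tendsto_statistic_sub`).

No consistency has to be assumed. A multiplier maximises the concave dual function, and testing it
in the direction of the mean shows that `logSum` grows at least like `√n ‖gbar(θ)‖`. Since `gbar` is
bounded below in the Lipschitz sense on `U`, a bounded `logSum` forces `θ - θn = O(n^{-1/2})`
(`localize`).

These arguments are deterministic along a filter. Probability enters through the filter `whp`:
contiguity is an inequality of filters, which carries laws of large numbers from `F₀` to `F n`, and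
tightness of `W` allows restriction to `‖W‖ ≤ M`. A central limit theorem gives `W → N(0, S)`, hence
`b → N(-L f, 1)`, and `‖b‖²` is asymptotically noncentral chi-squared with noncentrality `‖L f‖² =
fᵀ Q f`. -/

namespace EmpLik

/-! ### Lagrange multipliers of a finite family of vectors: duality, size, existence. -/

section Multipliers

variable {H : Type*} [NormedAddCommGroup H] [InnerProductSpace ℝ H] {n : ℕ}

theorem abs_log_one_add_sub_le {u : ℝ} (hu : |u| ≤ 1 / 2) :
    |Real.log (1 + u) - (u - u ^ 2 / 2)| ≤ 2 * |u| ^ 3 := by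
  have h1 : |-u| < 1 := by rw [abs_neg]; linarith
  have h := Real.abs_log_sub_add_sum_range_le h1 2
  have h2 : |u| ^ 3 / (1 - |u|) ≤ 2 * |u| ^ 3 := by
    rw [div_le_iff₀ (by linarith)]
    nlinarith [pow_nonneg (abs_nonneg u) 3]
  have h3 : (∑ i ∈ Finset.range 2, (-u) ^ (i + 1) / ((i : ℝ) + 1)) + Real.log (1 - -u) =
      Real.log (1 + u) - (u - u ^ 2 / 2) := by
    simp [Finset.sum_range_succ]; ring
  rw [h3, abs_neg] at h
  exact h.trans h2

theorem sub_two_mul_sq_le_log {u : ℝ} (hu : |u| ≤ 1 / 2) : u - 2 * u ^ 2 ≤ Real.log (1 + u) := by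
  have h := (abs_le.1 (abs_log_one_add_sub_le hu)).1
  have : |u| ^ 3 ≤ u ^ 2 * (1 / 2) := by
    rw [pow_succ, sq_abs]; gcongr
  nlinarith [sq_nonneg u]

theorem log_le_sub_sq {u : ℝ} (hu : |u| ≤ 1 / 8) : Real.log (1 + u) ≤ u - u ^ 2 / 4 := by
  have h := (abs_le.1 (abs_log_one_add_sub_le (hu.trans (by norm_num)))).2
  have : |u| ^ 3 ≤ u ^ 2 * (1 / 8) := by
    rw [pow_succ, sq_abs]; gcongr
  nlinarith [sq_nonneg u]

/-- `t` is a Lagrange multiplier for the vectors `v₁, …, vₙ`. -/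
def IsMult (v : Fin n → H) (t : H) : Prop :=
  (∀ i, 0 < 1 + inner ℝ t (v i)) ∧ ∑ i, (1 + inner ℝ t (v i))⁻¹ • v i = 0

theorem isMultiplier_iff {𝒳 : Type*} {p r : ℕ} {g : 𝒳 → E p → E r} {x : Fin n → 𝒳} {θ : E p}
    {t : E r} : IsMultiplier g x θ t ↔ IsMult (fun i => g (x i) θ) t := by
  refine and_congr Iff.rfl ?_
  rcases Nat.eq_zero_or_pos n with rfl | hn
  · simp
  · have : ∑ i, weight g x θ t i • g (x i) θ =
        (n : ℝ)⁻¹ • ∑ i, (1 + inner ℝ t (g (x i) θ))⁻¹ • g (x i) θ := by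
      simp only [Finset.smul_sum, weight, tilt, mul_smul]
    rw [this, smul_eq_zero]
    have : (n : ℝ)⁻¹ ≠ 0 := by positivity
    simp [this]

/-- The empirical log-likelihood ratio `∑ᵢ log(1 + tᵀvᵢ)`. -/
noncomputable def logSum (v : Fin n → H) (t : H) : ℝ := ∑ i, Real.log (1 + inner ℝ t (v i))

/-- The multiplier equation says that the gradient of the concave function `logSum v` vanishes at
`t`, so a multiplier is a global maximizer. Concavity enters as `log (a / b) ≤ a / b - 1`. -/
theorem logSum_le_of_isMult {v : Fin n → H} {s t : H} (ht : IsMult v t)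
    (hs : ∀ i, 0 < 1 + inner ℝ s (v i)) : logSum v s ≤ logSum v t := by
  have key : ∀ i, Real.log (1 + inner ℝ s (v i)) - Real.log (1 + inner ℝ t (v i)) ≤
      inner ℝ (s - t) ((1 + inner ℝ t (v i))⁻¹ • v i) := by
    intro i
    have hp := ht.1 i
    rw [← Real.log_div (hs i).ne' hp.ne']
    refine (Real.log_le_sub_one_of_pos (div_pos (hs i) hp)).trans_eq ?_
    rw [inner_smul_right, inner_sub_left]
    field_simp
    ring
  have := Finset.sum_le_sum fun i (_ : i ∈ Finset.univ) => key i
  rw [← inner_sum, ht.2, inner_zero_right, Finset.sum_sub_distrib] at this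
  exact sub_nonpos.1 this

/-- The mean of the vectors `v₁, …, vₙ`. -/
noncomputable def vmean (v : Fin n → H) : H := (n : ℝ)⁻¹ • ∑ i, v i

theorem sum_eq_smul_vmean (hn : 0 < n) (v : Fin n → H) : ∑ i, v i = (n : ℝ) • vmean v := by
  rw [vmean, smul_smul, mul_inv_cancel₀ (by positivity), one_smul]

theorem sum_inner_eq (hn : 0 < n) (v : Fin n → H) (s : H) :
    ∑ i, inner ℝ s (v i) = n * inner ℝ s (vmean v) := by
  rw [← inner_sum, sum_eq_smul_vmean hn, inner_smul_right]

/-- Maximality of `t` is tested against a vector of length `n^{-1/2}` along the mean: the linear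
term is `√n ‖vmean v‖` and the quadratic loss is at most `2 * B`. No smallness of the mean is
needed, which is what makes localisation possible. -/
theorem sqrt_mul_norm_vmean_le {v : Fin n → H} {t : H} (hn : 0 < n) (ht : IsMult v t) {B : ℝ}
    (hmax : ∀ i, ‖v i‖ ≤ √n / 2) (hsq : ∑ i, ‖v i‖ ^ 2 ≤ B * n) :
    √n * ‖vmean v‖ ≤ logSum v t + 2 * B := by
  have hn' : (0 : ℝ) < n := by exact_mod_cast hn
  have hsn : 0 < √(n : ℝ) := Real.sqrt_pos.2 hn'
  -- If the mean is zero, the inverse is zero and `s = 0`; hence only `‖s‖ ≤ (√n)⁻¹` is claimed.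
  set s : H := (√n * ‖vmean v‖)⁻¹ • vmean v with hs
  have hsnorm : ‖s‖ ≤ (√n)⁻¹ := by
    rw [hs, norm_smul, norm_inv, norm_mul, norm_norm, mul_inv, Real.norm_of_nonneg hsn.le, mul_assoc]
    exact mul_le_of_le_one_right (by positivity) inv_mul_le_one
  have habs : ∀ i, |inner ℝ s (v i)| ≤ 1 / 2 := fun i => by
    refine (abs_real_inner_le_norm _ _).trans ?_
    calc ‖s‖ * ‖v i‖ ≤ (√n)⁻¹ * (√n / 2) := by gcongr; exact hmax i
      _ = 1 / 2 := by field_simp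
  have hpos : ∀ i, 0 < 1 + inner ℝ s (v i) := fun i => by
    have := (abs_le.1 (habs i)).1; linarith
  have h1 := logSum_le_of_isMult ht hpos
  have h2 : ∑ i, (inner ℝ s (v i) - 2 * inner ℝ s (v i) ^ 2) ≤ logSum v s :=
    Finset.sum_le_sum fun i _ => sub_two_mul_sq_le_log (habs i)
  rw [Finset.sum_sub_distrib, sum_inner_eq hn, ← Finset.mul_sum] at h2
  have h3 : ∑ i, inner ℝ s (v i) ^ 2 ≤ B := by
    calc ∑ i, inner ℝ s (v i) ^ 2 ≤ ∑ i, (√n)⁻¹ ^ 2 * ‖v i‖ ^ 2 := by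
          refine Finset.sum_le_sum fun i _ => ?_
          rw [← sq_abs, ← mul_pow]
          gcongr
          exact (abs_real_inner_le_norm _ _).trans (by gcongr)
      _ = (n : ℝ)⁻¹ * ∑ i, ‖v i‖ ^ 2 := by
          rw [← Finset.mul_sum, inv_pow, Real.sq_sqrt hn'.le]
      _ ≤ (n : ℝ)⁻¹ * (B * n) := by gcongr
      _ = B := by field_simp
  have h4 : (n : ℝ) * inner ℝ s (vmean v) = √n * ‖vmean v‖ := by
    rw [hs, real_inner_smul_left, real_inner_self_eq_norm_sq]
    rcases eq_or_ne ‖vmean v‖ 0 with h0 | h0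
    · simp [h0]
    · field_simp
      rw [Real.sq_sqrt hn'.le]
  linarith

/-- Pairing the multiplier equation with `t` gives `n ⟪t, v̄⟫ = ∑ ⟪t, vᵢ⟫² / (1 + ⟪t, vᵢ⟫)`, and the
denominators are at most `1 + ‖t‖ Z`. Thus `κ ‖t‖ ≤ ‖v̄‖ (1 + ‖t‖ Z)`, and `hsmall` lets half of the
left side absorb the term in `Z`. -/
theorem norm_mult_le {v : Fin n → H} {t : H} (hn : 0 < n) (ht : IsMult v t) {κ Z : ℝ} (hκ : 0 < κ)
    (hZ : ∀ i, ‖v i‖ ≤ Z) (hquad : κ * ‖t‖ ^ 2 * n ≤ ∑ i, inner ℝ t (v i) ^ 2)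
    (hsmall : Z * ‖vmean v‖ ≤ κ / 2) : ‖t‖ ≤ 2 / κ * ‖vmean v‖ := by
  have hn' : (0 : ℝ) < n := by exact_mod_cast hn
  have hZ0 : 0 ≤ Z := (norm_nonneg _).trans (hZ ⟨0, hn⟩)
  have h0 : ∑ i, (inner ℝ t (v i) - inner ℝ t (v i) ^ 2 * (1 + inner ℝ t (v i))⁻¹) = 0 := by
    have := congrArg (fun w => inner ℝ t w) ht.2
    simp only [inner_sum, inner_zero_right, inner_smul_right] at this
    rw [← this]
    refine Finset.sum_congr rfl fun i _ => ?_
    have := (ht.1 i).ne'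
    field_simp
    ring
  rw [Finset.sum_sub_distrib, sum_inner_eq hn, sub_eq_zero] at h0
  have h1 : ∑ i, inner ℝ t (v i) ^ 2 * (1 + ‖t‖ * Z)⁻¹ ≤ n * inner ℝ t (vmean v) := by
    rw [h0]
    refine Finset.sum_le_sum fun i _ => ?_
    have := ht.1 i
    gcongr
    exact (real_inner_le_norm _ _).trans (by gcongr; exact hZ i)
  have h2 : ∑ i, inner ℝ t (v i) ^ 2 ≤ n * (‖t‖ * ‖vmean v‖) * (1 + ‖t‖ * Z) := by
    rw [← Finset.sum_mul, ← div_eq_mul_inv, div_le_iff₀ (by positivity)] at h1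
    refine h1.trans ?_
    gcongr
    exact real_inner_le_norm _ _
  have h3 : κ * ‖t‖ ^ 2 ≤ ‖t‖ * ‖vmean v‖ * (1 + ‖t‖ * Z) := by
    have := hquad.trans h2
    nlinarith
  rcases (norm_nonneg t).eq_or_lt with h | h
  · rw [← h]; positivity
  · have h4 : κ * ‖t‖ ≤ ‖vmean v‖ * (1 + ‖t‖ * Z) := by nlinarith
    rw [div_mul_eq_mul_div, le_div_iff₀ hκ]
    nlinarith

/-- Maximise `logSum v` over the ball of radius `ρ`. On the sphere its value is at most `n (ρ ‖v̄‖ -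
κ ρ² / 4) < 0 = logSum v 0`, so the maximizer is interior and its gradient vanishes. -/
theorem exists_isMult [FiniteDimensional ℝ H] {v : Fin n → H} (hn : 0 < n) {κ ρ : ℝ} (hρ : 0 < ρ)
    (hmax : ∀ i, ρ * ‖v i‖ ≤ 1 / 8) (hquad : ∀ s, κ * ‖s‖ ^ 2 * n ≤ ∑ i, inner ℝ s (v i) ^ 2)
    (hsmall : ‖vmean v‖ < κ * ρ / 4) : ∃ t, ‖t‖ ≤ ρ ∧ IsMult v t := by
  have hn' : (0 : ℝ) < n := by exact_mod_cast hn
  have habs : ∀ s, ‖s‖ ≤ ρ → ∀ i, |inner ℝ s (v i)| ≤ 1 / 8 := fun s hs i =>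
    (abs_real_inner_le_norm _ _).trans <|
      (mul_le_mul_of_nonneg_right hs (norm_nonneg _)).trans (hmax i)
  have hpos : ∀ s, ‖s‖ ≤ ρ → ∀ i, 0 < 1 + inner ℝ s (v i) := fun s hs i => by
    have := (abs_le.1 (habs s hs i)).1; linarith
  have hderiv : ∀ s, ‖s‖ ≤ ρ → HasFDerivAt (logSum v)
      (∑ i, (1 + inner ℝ s (v i))⁻¹ • innerSL ℝ (v i)) s := by
    intro s hs
    have : logSum v = fun s => ∑ i, Real.log (1 + innerSL ℝ (v i) s) := by
      ext s; simp [logSum, real_inner_comm]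
    rw [this]
    refine HasFDerivAt.fun_sum fun i _ => ?_
    have h1 := ((innerSL ℝ (v i)).hasFDerivAt (x := s)).const_add 1
    have h2 := h1.log (by
      rw [innerSL_apply_apply, real_inner_comm]
      exact (hpos s hs i).ne')
    simpa [real_inner_comm] using h2
  have hcont : ContinuousOn (logSum v) (Metric.closedBall 0 ρ) := fun s hs =>
    (hderiv s (by simpa using hs)).continuousAt.continuousWithinAt
  obtain ⟨t, ht, hmaxt⟩ := (isCompact_closedBall (0 : H) ρ).exists_isMaxOn
    ⟨0, by simp [hρ.le]⟩ hcont
  have htρ : ‖t‖ ≤ ρ := by simpa using ht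
  have h0 : 0 ≤ logSum v t := by
    have := hmaxt (show (0 : H) ∈ Metric.closedBall 0 ρ by simp [hρ.le])
    simpa [logSum] using this
  have hlt : ‖t‖ < ρ := by
    refine lt_of_le_of_ne htρ fun heq => ?_
    have h1 : logSum v t ≤ ∑ i, (inner ℝ t (v i) - inner ℝ t (v i) ^ 2 / 4) :=
      Finset.sum_le_sum fun i _ => log_le_sub_sq (habs t htρ i)
    rw [Finset.sum_sub_distrib, sum_inner_eq hn, ← Finset.sum_div] at h1
    have h2 := hquad t
    have h3 : inner ℝ t (vmean v) ≤ ρ * ‖vmean v‖ := heq ▸ real_inner_le_norm _ _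
    rw [heq] at h2
    have h4 : (n : ℝ) * inner ℝ t (vmean v) < n * (ρ * (κ * ρ / 4)) :=
      mul_lt_mul_of_pos_left (h3.trans_lt (by gcongr)) hn'
    nlinarith
  refine ⟨t, htρ, hpos t htρ, ?_⟩
  have hloc : IsLocalMax (logSum v) t := by
    refine hmaxt.isLocalMax ?_
    exact mem_of_superset (Metric.isOpen_ball.mem_nhds (by simpa using hlt))
      Metric.ball_subset_closedBall
  have hz := hloc.hasFDerivAt_eq_zero (hderiv t htρ)
  refine ext_inner_right ℝ fun w => ?_
  have := congrArg (fun T => T w) hz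
  simpa [sum_inner, real_inner_smul_left] using this

end Multipliers

/-! ### Quadratic expansions at the multiplier. -/

section Expansion

variable {H : Type*} [NormedAddCommGroup H] [InnerProductSpace ℝ H] {ι : Type*} {l : Filter ι}

/-- The rank-one operator `v vᵀ`. -/
noncomputable def outer (v : H) : H →L[ℝ] H := (innerSL ℝ v).smulRight v

@[simp] theorem outer_apply (v w : H) : outer v w = inner ℝ v w • v := by simp [outer]

theorem norm_outer (v : H) : ‖outer v‖ = ‖v‖ ^ 2 := by
  rw [outer, ContinuousLinearMap.norm_smulRight_apply, innerSL_apply_norm, sq]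

theorem norm_outer_sub_le (v w : H) : ‖outer v - outer w‖ ≤ (‖v‖ + ‖w‖) * ‖v - w‖ := by
  have : outer v - outer w =
      (innerSL ℝ v).smulRight (v - w) + (innerSL ℝ (v - w)).smulRight w := by
    ext u
    simp [sub_smul, smul_sub]
  rw [this]
  refine (norm_add_le _ _).trans_eq ?_
  rw [ContinuousLinearMap.norm_smulRight_apply, ContinuousLinearMap.norm_smulRight_apply,
    innerSL_apply_norm, innerSL_apply_norm]
  ring

theorem continuous_outer : Continuous (outer : H → H →L[ℝ] H) := by
  rw [continuous_iff_continuousAt]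
  intro v
  rw [ContinuousAt, tendsto_iff_norm_sub_tendsto_zero]
  refine squeeze_zero (fun _ => norm_nonneg _) (fun w => norm_outer_sub_le w v) ?_
  have : Continuous fun w : H => (‖w‖ + ‖v‖) * ‖w - v‖ := by fun_prop
  simpa using this.tendsto v

theorem inner_sum_outer {n : ℕ} (v : Fin n → H) (t : H) :
    inner ℝ (((n : ℝ)⁻¹ • ∑ j, outer (v j)) t) t = (n : ℝ)⁻¹ * ∑ j, inner ℝ t (v j) ^ 2 := by
  simp only [smul_apply, sum_apply, outer_apply,
    real_inner_smul_left, sum_inner]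
  congr 1
  refine Finset.sum_congr rfl fun j _ => ?_
  rw [real_inner_comm (v j) t, sq]

/-- A family of samples of vectors whose sizes tend to infinity, with bounded third moments,
convergent second moments, and means of the order of the inverse root of the sample size. -/
structure Expandable (l : Filter ι) (N : ι → ℕ) (v : ∀ i, Fin (N i) → H) (S : H →L[ℝ] H) :
    Prop where
  size : Tendsto N l atTop
  cube : ∃ B, 1 ≤ B ∧ ∀ᶠ i in l, ∑ j, ‖v i j‖ ^ 3 ≤ B * N i
  second : Tendsto (fun i => (N i : ℝ)⁻¹ • ∑ j, outer (v i j)) l (𝓝 S)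
  coercive : ∃ κ > 0, ∀ u, κ * ‖u‖ ^ 2 ≤ inner ℝ (S u) u
  mean : ∃ R, ∀ᶠ i in l, √(N i) * ‖vmean (v i)‖ ≤ R

/-- The bound is `(B n)^{1/3}`, written so that its order `o(√n)` is visible. -/
theorem norm_le_of_sum_cube_le {G : Type*} [NormedAddCommGroup G] {n : ℕ} {v : Fin n → G} {B : ℝ} (hB : 0 ≤ B)
    (h : ∑ j, ‖v j‖ ^ 3 ≤ B * n) (j : Fin n) : ‖v j‖ ≤ √n * (B / √n) ^ (1 / 3 : ℝ) := by
  have hn : 0 < n := (Nat.zero_le _).trans_lt j.2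
  have hn' : 0 < √(n : ℝ) := Real.sqrt_pos.2 (by exact_mod_cast hn)
  refine le_of_pow_le_pow_left₀ (n := 3) (by norm_num) (by positivity) ?_
  have h1 : ‖v j‖ ^ 3 ≤ B * n :=
    (Finset.single_le_sum (f := fun j => ‖v j‖ ^ 3) (fun _ _ => by positivity)
      (Finset.mem_univ j)).trans h
  refine h1.trans_eq ?_
  rw [mul_pow, ← Real.rpow_natCast ((B / √n) ^ (1 / 3 : ℝ)), ← Real.rpow_mul (by positivity)]
  norm_num
  have := Real.sq_sqrt (Nat.cast_nonneg (α := ℝ) n)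
  field_simp
  rw [this]

theorem tendsto_sqrt_size {N : ι → ℕ} (hN : Tendsto N l atTop) :
    Tendsto (fun i => √(N i : ℝ)) l atTop :=
  Real.tendsto_sqrt_atTop.comp (tendsto_natCast_atTop_atTop.comp hN)

theorem tendsto_rpow_div_sqrt {N : ι → ℕ} (hN : Tendsto N l atTop) (B : ℝ) :
    Tendsto (fun i => (B / √(N i)) ^ (1 / 3 : ℝ)) l (𝓝 0) := by
  have h := (tendsto_sqrt_size hN).const_div_atTop B
  have := h.rpow_const (p := (1 / 3 : ℝ)) (Or.inr (by norm_num))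
  simpa [Real.zero_rpow] using this

/-- The quantifier over `v` stands inside the eventuality, so that the bound later holds for all
parameters at once. -/
theorem eventually_norm_le_mul_sqrt {G : Type*} [NormedAddCommGroup G] {N : ι → ℕ} (hN : Tendsto N l atTop) {B ε : ℝ} (hB : 0 ≤ B)
    (hε : 0 < ε) : ∀ᶠ i in l, ∀ v : Fin (N i) → G, ∑ j, ‖v j‖ ^ 3 ≤ B * N i →
      ∀ j, ‖v j‖ ≤ ε * √(N i) := by
  filter_upwards [(tendsto_rpow_div_sqrt hN B).eventually_le_const hε] with i hi v hv j
  refine (norm_le_of_sum_cube_le hB hv j).trans ?_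
  rw [mul_comm]
  gcongr

namespace Expandable

variable {N : ι → ℕ} {v : ∀ i, Fin (N i) → H} {S : H →L[ℝ] H}

theorem eventually_pos (h : Expandable l N v S) : ∀ᶠ i in l, 0 < N i :=
  h.size.eventually_gt_atTop 0

theorem eventually_small (h : Expandable l N v S) {ε : ℝ} (hε : 0 < ε) :
    ∀ᶠ i in l, ∀ j, ‖v i j‖ ≤ ε * √(N i) := by
  obtain ⟨B, hB, hc⟩ := h.cube
  filter_upwards [hc, eventually_norm_le_mul_sqrt (G := H) h.size (zero_le_one.trans hB) hε]
    with i h1 h2 using h2 _ h1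

theorem quad_lower (h : Expandable l N v S) : ∃ κ > 0, ∀ᶠ i in l, ∀ s : H,
    κ * ‖s‖ ^ 2 * N i ≤ ∑ j, inner ℝ s (v i j) ^ 2 := by
  obtain ⟨κ, hκ, hS⟩ := h.coercive
  refine ⟨κ / 2, by positivity, ?_⟩
  have := (Metric.tendsto_nhds.1 h.second) (κ / 2) (by positivity)
  filter_upwards [this, h.eventually_pos] with i hi hn s
  have hn' : (0 : ℝ) < N i := by exact_mod_cast hn
  rw [dist_eq_norm] at hi
  have h1 := inner_sum_outer (v i) s
  set T := (N i : ℝ)⁻¹ • ∑ j, outer (v i j)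
  have h2 : inner ℝ (T s) s - inner ℝ (S s) s = inner ℝ ((T - S) s) s := by
    simp [inner_sub_left]
  have h3 : |inner ℝ ((T - S) s) s| ≤ κ / 2 * ‖s‖ * ‖s‖ :=
    (abs_real_inner_le_norm _ _).trans (by gcongr; exact (T - S).le_of_opNorm_le hi.le s)
  have h4 := hS s
  have h5 := (abs_le.1 h3).1
  have h6 : κ / 2 * ‖s‖ ^ 2 ≤ (N i : ℝ)⁻¹ * ∑ j, inner ℝ s (v i j) ^ 2 := by nlinarith
  rw [inv_mul_eq_div, le_div_iff₀ hn'] at h6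
  exact h6

theorem eventually_isMult_norm_le (h : Expandable l N v S) :
    ∃ R, ∀ᶠ i in l, ∀ t, IsMult (v i) t → √(N i) * ‖t‖ ≤ R := by
  obtain ⟨κ, hκ, hq⟩ := h.quad_lower
  obtain ⟨R, hR⟩ := h.mean
  refine ⟨2 / κ * R, ?_⟩
  -- With this `ε` the product of `max ‖vⱼ‖ ≤ ε √n` and `‖vmean‖ ≤ R / √n` is at most `κ / 2`.
  have hε : 0 < κ / (2 * (|R| + 1)) := by positivity
  filter_upwards [hq, hR, h.eventually_pos, h.eventually_small hε] with i h1 h2 hn h3 t ht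
  have := norm_mult_le hn ht hκ h3 (h1 t) (by
    calc κ / (2 * (|R| + 1)) * √(N i) * ‖vmean (v i)‖ =
          κ / (2 * (|R| + 1)) * (√(N i) * ‖vmean (v i)‖) := by ring
      _ ≤ κ / (2 * (|R| + 1)) * (|R| + 1) := by
          gcongr
          linarith [le_abs_self R]
      _ = κ / 2 := by field_simp)
  calc √(N i) * ‖t‖ ≤ √(N i) * (2 / κ * ‖vmean (v i)‖) := by gcongr
    _ = 2 / κ * (√(N i) * ‖vmean (v i)‖) := by ring
    _ ≤ 2 / κ * R := by gcongr

theorem eventually_exists_isMult [FiniteDimensional ℝ H] (h : Expandable l N v S) :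
    ∀ᶠ i in l, ∃ t, IsMult (v i) t := by
  obtain ⟨κ, hκ, hq⟩ := h.quad_lower
  obtain ⟨R, hR⟩ := h.mean
  -- The multiplier is sought in the ball of radius `L / √n`; `L` makes `κ ρ / 4 = (|R| + 1) / √n`,
  -- which exceeds the norm of the mean.
  set L := 4 * (|R| + 1) / κ with hL
  have hL0 : 0 < L := by positivity
  have hε : 0 < 1 / (8 * L) := by positivity
  filter_upwards [hq, hR, h.eventually_pos, h.eventually_small hε] with i h1 h2 hn h3
  have hs : 0 < √(N i : ℝ) := Real.sqrt_pos.2 (by exact_mod_cast hn)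
  obtain ⟨t, -, ht⟩ := exists_isMult hn (κ := κ) (ρ := L / √(N i)) (by positivity) (fun j => by
    calc L / √(N i) * ‖v i j‖ ≤ L / √(N i) * (1 / (8 * L) * √(N i)) := by gcongr; exact h3 j
      _ = 1 / 8 := by field_simp) h1 (by
    have : κ * (L / √(N i)) / 4 = (|R| + 1) / √(N i) := by rw [hL]; field_simp
    rw [this, lt_div_iff₀ hs, mul_comm]
    linarith [le_abs_self R])
  exact ⟨t, ht⟩

variable {t : ι → H}

/-- Of order `‖t‖³ n = O(n^{-1/2})`. This controls the remainder of the logarithm and makes all `⟪t,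
vⱼ⟫` uniformly small. -/
theorem tendsto_sum_abs_cube (h : Expandable l N v S) (ht : ∀ᶠ i in l, IsMult (v i) (t i)) :
    Tendsto (fun i => ∑ j, |inner ℝ (t i) (v i j)| ^ 3) l (𝓝 0) := by
  obtain ⟨R, hR⟩ := h.eventually_isMult_norm_le
  obtain ⟨B, hB, hc⟩ := h.cube
  have hlim : Tendsto (fun i => R ^ 3 * B / √(N i)) l (𝓝 0) :=
    (tendsto_sqrt_size h.size).const_div_atTop _
  refine squeeze_zero' (Eventually.of_forall fun i => by positivity) ?_ hlim
  filter_upwards [ht, hR, hc, h.eventually_pos] with i h1 h2 h3 hn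
  have hn' : (0 : ℝ) < N i := by exact_mod_cast hn
  have hs : 0 < √(N i : ℝ) := Real.sqrt_pos.2 hn'
  have hR' := h2 _ h1
  calc ∑ j, |inner ℝ (t i) (v i j)| ^ 3 ≤ ∑ j, ‖t i‖ ^ 3 * ‖v i j‖ ^ 3 := by
        refine Finset.sum_le_sum fun j _ => ?_
        rw [← mul_pow]
        gcongr
        exact abs_real_inner_le_norm _ _
    _ ≤ ‖t i‖ ^ 3 * (B * N i) := by rw [← Finset.mul_sum]; gcongr
    _ = (√(N i) * ‖t i‖) ^ 3 * B / √(N i) := by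
        rw [mul_pow, eq_div_iff hs.ne']
        have := Real.sq_sqrt hn'.le
        nth_rewrite 1 [← this]
        ring
    _ ≤ R ^ 3 * B / √(N i) := by gcongr

theorem eventually_abs_inner_le (h : Expandable l N v S) (ht : ∀ᶠ i in l, IsMult (v i) (t i))
    {ε : ℝ} (hε : 0 < ε) : ∀ᶠ i in l, ∀ j, |inner ℝ (t i) (v i j)| ≤ ε := by
  filter_upwards [(h.tendsto_sum_abs_cube ht).eventually_le_const (pow_pos hε 3)] with i hi j
  refine le_of_pow_le_pow_left₀ (n := 3) (by norm_num) hε.le (le_trans ?_ hi)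
  exact Finset.single_le_sum (f := fun j => |inner ℝ (t i) (v i j)| ^ 3)
    (fun _ _ => by positivity) (Finset.mem_univ j)

/-- Insert `1 / (1 + u) = 1 - u + u² / (1 + u)` in the multiplier equation: the first two terms give
the mean and the sample second moment applied to `t`, and the last is of third order. -/
theorem tendsto_score (h : Expandable l N v S) (ht : ∀ᶠ i in l, IsMult (v i) (t i)) :
    Tendsto (fun i => √(N i) • vmean (v i) - S (√(N i) • t i)) l (𝓝 0) := by
  obtain ⟨R, hR⟩ := h.eventually_isMult_norm_le
  obtain ⟨B, hB, hc⟩ := h.cube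
  have hlim : Tendsto (fun i => ‖(N i : ℝ)⁻¹ • ∑ j, outer (v i j) - S‖ * |R| +
      2 * R ^ 2 * B / √(N i)) l (𝓝 0) := by
    have h1 := (tendsto_iff_norm_sub_tendsto_zero.1 h.second).mul_const |R|
    have h2 := (tendsto_sqrt_size h.size).const_div_atTop (2 * R ^ 2 * B)
    simpa using h1.add h2
  refine squeeze_zero_norm' ?_ hlim
  filter_upwards [ht, hR, hc, h.eventually_pos,
    h.eventually_abs_inner_le ht (show (0 : ℝ) < 1 / 2 by norm_num)] with i h1 h2 h3 hn h4
  have hn' : (0 : ℝ) < N i := by exact_mod_cast hn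
  have hs : 0 < √(N i : ℝ) := Real.sqrt_pos.2 hn'
  have hsq := Real.sq_sqrt hn'.le
  have hR' := h2 _ h1
  set T := (N i : ℝ)⁻¹ • ∑ j, outer (v i j) with hT
  set r : H := ∑ j, (inner ℝ (t i) (v i j) ^ 2 * (1 + inner ℝ (t i) (v i j))⁻¹) • v i j with hr
  have hid : ∑ j, v i j - ∑ j, outer (v i j) (t i) = -r := by
    rw [← add_eq_zero_iff_eq_neg, hr, ← Finset.sum_sub_distrib, ← Finset.sum_add_distrib, ← h1.2]
    refine Finset.sum_congr rfl fun j _ => ?_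
    have := (h1.1 j).ne'
    rw [outer_apply, real_inner_comm]
    conv_lhs => rw [← one_smul ℝ (v i j)]
    rw [smul_smul, mul_one, ← sub_smul, one_smul, ← add_smul]
    congr 1
    field_simp
    ring
  have hid2 : √(N i) • vmean (v i) - S (√(N i) • t i) =
      (T - S) (√(N i) • t i) - (√(N i))⁻¹ • r := by
    have e1 : √(N i : ℝ) * (N i : ℝ)⁻¹ = (√(N i))⁻¹ := by
      field_simp; exact hsq
    have e2 : √(N i) • vmean (v i) - T (√(N i) • t i) = -((√(N i))⁻¹ • r) := by
      rw [map_smul, hT, vmean, smul_apply, sum_apply,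
        smul_smul, smul_smul, ← smul_sub, hid, e1, smul_neg]
    rw [sub_apply, sub_eq_add_neg _ ((√(N i))⁻¹ • r), ← e2]
    abel
  have hrn : ‖r‖ ≤ 2 * ‖t i‖ ^ 2 * (B * N i) := by
    refine (norm_sum_le _ _).trans ?_
    calc ∑ j, ‖(inner ℝ (t i) (v i j) ^ 2 * (1 + inner ℝ (t i) (v i j))⁻¹) • v i j‖
        ≤ ∑ j, 2 * ‖t i‖ ^ 2 * ‖v i j‖ ^ 3 := by
          refine Finset.sum_le_sum fun j _ => ?_
          have hp := (abs_le.1 (h4 j)).1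
          have hinv : (1 + inner ℝ (t i) (v i j))⁻¹ ≤ 2 := by
            rw [inv_le_comm₀ (h1.1 j) (by norm_num)]; linarith
          rw [norm_smul, Real.norm_of_nonneg (mul_nonneg (sq_nonneg _) (inv_nonneg.2 (h1.1 j).le))]
          have hsq : inner ℝ (t i) (v i j) ^ 2 ≤ (‖t i‖ * ‖v i j‖) ^ 2 := by
            rw [← sq_abs]; gcongr; exact abs_real_inner_le_norm _ _
          calc _ ≤ (‖t i‖ * ‖v i j‖) ^ 2 * 2 * ‖v i j‖ := by
                have := inv_nonneg.2 (h1.1 j).le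
                gcongr
            _ = _ := by ring
      _ ≤ 2 * ‖t i‖ ^ 2 * (B * N i) := by rw [← Finset.mul_sum]; gcongr
  rw [hid2]
  refine (norm_sub_le _ _).trans (add_le_add ?_ ?_)
  · refine (ContinuousLinearMap.le_opNorm _ _).trans ?_
    gcongr
    rw [norm_smul, Real.norm_of_nonneg hs.le]
    exact hR'.trans (le_abs_self R)
  · rw [norm_smul, norm_inv, Real.norm_of_nonneg hs.le, inv_mul_eq_div]
    gcongr
    calc ‖r‖ ≤ 2 * ‖t i‖ ^ 2 * (B * N i) := hrn
      _ = 2 * (√(N i) * ‖t i‖) ^ 2 * B := by rw [mul_pow, hsq]; ring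
      _ ≤ 2 * R ^ 2 * B := by gcongr

theorem eventually_norm_scaled_le (h : Expandable l N v S) (ht : ∀ᶠ i in l, IsMult (v i) (t i)) :
    ∃ R, ∀ᶠ i in l, ‖√(N i) • t i‖ ≤ R := by
  obtain ⟨R, hR⟩ := h.eventually_isMult_norm_le
  refine ⟨R, ?_⟩
  filter_upwards [hR, ht] with i h1 h2
  rw [norm_smul, Real.norm_of_nonneg (Real.sqrt_nonneg _)]
  exact h1 _ h2

theorem tendsto_sum_sq (h : Expandable l N v S) (ht : ∀ᶠ i in l, IsMult (v i) (t i)) :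
    Tendsto (fun i => ∑ j, inner ℝ (t i) (v i j) ^ 2 -
      inner ℝ (S (√(N i) • t i)) (√(N i) • t i)) l (𝓝 0) := by
  obtain ⟨R, hR⟩ := h.eventually_norm_scaled_le ht
  have hlim : Tendsto (fun i => ‖(N i : ℝ)⁻¹ • ∑ j, outer (v i j) - S‖ * |R| * |R|) l (𝓝 0) := by
    simpa using ((tendsto_iff_norm_sub_tendsto_zero.1 h.second).mul_const |R|).mul_const |R|
  refine squeeze_zero_norm' ?_ hlim
  filter_upwards [hR, h.eventually_pos] with i h1 hn
  have hn' : (0 : ℝ) < N i := by exact_mod_cast hn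
  have hsq := Real.mul_self_sqrt hn'.le
  have hid : ∑ j, inner ℝ (t i) (v i j) ^ 2 =
      inner ℝ (((N i : ℝ)⁻¹ • ∑ j, outer (v i j)) (√(N i) • t i)) (√(N i) • t i) := by
    rw [map_smul, real_inner_smul_left, inner_smul_right, inner_sum_outer, ← mul_assoc, ← mul_assoc,
      hsq, mul_inv_cancel₀ hn'.ne', one_mul]
  rw [hid, ← inner_sub_left, ← sub_apply]
  refine (norm_inner_le_norm _ _).trans ?_
  have h1' := h1.trans (le_abs_self R)
  gcongr
  exact (ContinuousLinearMap.le_opNorm _ _).trans (by gcongr)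

theorem tendsto_inner_score (h : Expandable l N v S) (ht : ∀ᶠ i in l, IsMult (v i) (t i)) :
    Tendsto (fun i => ∑ j, inner ℝ (t i) (v i j) -
      inner ℝ (S (√(N i) • t i)) (√(N i) • t i)) l (𝓝 0) := by
  obtain ⟨R, hR⟩ := h.eventually_norm_scaled_le ht
  have hlim := (tendsto_zero_iff_norm_tendsto_zero.1 (h.tendsto_score ht)).mul_const |R|
  rw [zero_mul] at hlim
  refine squeeze_zero_norm' ?_ hlim
  filter_upwards [hR, h.eventually_pos] with i h1 hn
  have hn' : (0 : ℝ) < N i := by exact_mod_cast hn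
  have hsq := Real.mul_self_sqrt hn'.le
  have hid : ∑ j, inner ℝ (t i) (v i j) =
      inner ℝ (√(N i) • vmean (v i)) (√(N i) • t i) := by
    rw [sum_inner_eq hn, real_inner_smul_left, inner_smul_right, ← mul_assoc, hsq, real_inner_comm]
  rw [hid, ← inner_sub_left]
  refine (norm_inner_le_norm _ _).trans ?_
  gcongr
  exact h1.trans (le_abs_self R)

/-- In `log (1 + u) ≈ u - u² / 2` the sums of `u` and of `u²` have the same quadratic form as limit,
so twice the difference leaves one copy. -/
theorem tendsto_two_mul_logSum (h : Expandable l N v S) (ht : ∀ᶠ i in l, IsMult (v i) (t i)) :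
    Tendsto (fun i => 2 * logSum (v i) (t i) -
      inner ℝ (S (√(N i) • t i)) (√(N i) • t i)) l (𝓝 0) := by
  have hrem : Tendsto (fun i => 2 * (logSum (v i) (t i) - (∑ j, inner ℝ (t i) (v i j) -
      (∑ j, inner ℝ (t i) (v i j) ^ 2) / 2))) l (𝓝 0) := by
    have hlim := (h.tendsto_sum_abs_cube ht).const_mul 4
    rw [mul_zero] at hlim
    refine squeeze_zero_norm' ?_ hlim
    filter_upwards [h.eventually_abs_inner_le ht (show (0 : ℝ) < 1 / 2 by norm_num)] with i hi
    rw [logSum, Finset.sum_div, ← Finset.sum_sub_distrib, ← Finset.sum_sub_distrib, norm_mul,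
      Real.norm_eq_abs, Real.norm_eq_abs, abs_two]
    have : |∑ j, (Real.log (1 + inner ℝ (t i) (v i j)) -
        (inner ℝ (t i) (v i j) - inner ℝ (t i) (v i j) ^ 2 / 2))| ≤
        ∑ j, 2 * |inner ℝ (t i) (v i j)| ^ 3 :=
      (Finset.abs_sum_le_sum_abs _ _).trans
        (Finset.sum_le_sum fun j _ => abs_log_one_add_sub_le (hi j))
    rw [← Finset.mul_sum] at this
    linarith
  have := (hrem.add ((h.tendsto_inner_score ht).const_mul 2)).sub (h.tendsto_sum_sq ht)
  simp only [mul_zero, add_zero, sub_zero] at this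
  refine this.congr fun i => ?_
  ring

/-- A second derivative is available only at `1`. The mean value inequality is applied to `φ` minus
its quadratic part, whose derivative is `o(|w - 1|)` by differentiability of `deriv φ` at `1`. -/
theorem _root_.EmpLik.PhiClass.isLittleO {φ : ℝ → ℝ} (hφ : PhiClass φ) {ε : ℝ} (hε : 0 < ε) :
    ∀ᶠ u in 𝓝 (0 : ℝ), |φ (1 + u) - deriv (deriv φ) 1 / 2 * u ^ 2| ≤ ε * u ^ 2 := by
  have hd : ∀ᶠ w in 𝓝 (1 : ℝ), |deriv φ w - deriv (deriv φ) 1 * (w - 1)| ≤ ε * |w - 1| := by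
    have := hφ.differentiable2.hasDerivAt.isLittleO.def hε
    filter_upwards [this] with w hw
    simpa [hφ.deriv_one, mul_comm] using hw
  obtain ⟨δ, hδ, hball⟩ := Metric.eventually_nhds_iff_ball.1 (hd.and hφ.differentiable)
  refine Metric.eventually_nhds_iff_ball.2 ⟨δ, hδ, fun u hu => ?_⟩
  rw [mem_ball_zero_iff] at hu
  set ψ : ℝ → ℝ := fun w => φ w - deriv (deriv φ) 1 / 2 * (w - 1) ^ 2 with hψ
  have hseg : ∀ w ∈ Metric.closedBall (1 : ℝ) |u|, w ∈ Metric.ball (1 : ℝ) δ := fun w hw =>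
    Metric.closedBall_subset_ball hu hw
  have hder : ∀ w ∈ Metric.closedBall (1 : ℝ) |u|,
      HasDerivWithinAt ψ (deriv φ w - deriv (deriv φ) 1 * (w - 1))
        (Metric.closedBall (1 : ℝ) |u|) w := by
    intro w hw
    have h1 := (hball w (hseg w hw)).2.hasDerivAt
    have h2 := (((hasDerivAt_id w).sub_const 1).pow 2).const_mul (deriv (deriv φ) 1 / 2)
    refine ((h1.sub h2).congr_deriv ?_).hasDerivWithinAt
    simp
    ring
  have hbd : ∀ w ∈ Metric.closedBall (1 : ℝ) |u|,
      ‖deriv φ w - deriv (deriv φ) 1 * (w - 1)‖ ≤ ε * |u| := fun w hw => by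
    refine ((hball w (hseg w hw)).1).trans ?_
    exact mul_le_mul_of_nonneg_left (Metric.mem_closedBall.1 hw) hε.le
  have := (convex_closedBall (1 : ℝ) |u|).norm_image_sub_le_of_norm_hasDerivWithin_le hder hbd
    (show (1 : ℝ) ∈ _ by simp) (show 1 + u ∈ _ by simp)
  simp only [hψ, hφ.map_one, Real.norm_eq_abs] at this
  have e : ε * u ^ 2 = ε * |u| * |1 + u - 1| := by rw [add_sub_cancel_left, mul_assoc, ← sq, sq_abs]
  rw [e]
  simpa using this

/-- Each summand is `u² + o(u²)` uniformly in the index, and `∑ u²` stays bounded, so the statistic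
has the limit form of `∑ u²`. -/
theorem tendsto_phi (h : Expandable l N v S) (ht : ∀ᶠ i in l, IsMult (v i) (t i))
    {φ : ℝ → ℝ} (hφ : PhiClass φ) :
    Tendsto (fun i => 2 / deriv (deriv φ) 1 *
      ∑ j, φ (1 + inner ℝ (t i) (v i j)) / (1 + inner ℝ (t i) (v i j)) -
      inner ℝ (S (√(N i) • t i)) (√(N i) • t i)) l (𝓝 0) := by
  set b := deriv (deriv φ) 1 with hb
  have hb0 : 0 < b := hφ.deriv2_pos
  obtain ⟨R, hR⟩ := h.eventually_norm_scaled_le ht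
  have hbdd : ∃ R', 0 < R' ∧ ∀ᶠ i in l, ∑ j, inner ℝ (t i) (v i j) ^ 2 ≤ R' := by
    refine ⟨1 + ‖S‖ * |R| * |R|, by positivity, ?_⟩
    filter_upwards [hR, (h.tendsto_sum_sq ht).eventually_le_const zero_lt_one] with i h1 h2
    have h1' := h1.trans (le_abs_self R)
    have : inner ℝ (S (√(N i) • t i)) (√(N i) • t i) ≤ ‖S‖ * |R| * |R| :=
      (real_inner_le_norm _ _).trans (by
        gcongr
        exact (ContinuousLinearMap.le_opNorm _ _).trans (by gcongr))
    linarith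
  obtain ⟨R', hR'0, hR'⟩ := hbdd
  have hrem : Tendsto (fun i => 2 / b *
      ∑ j, φ (1 + inner ℝ (t i) (v i j)) / (1 + inner ℝ (t i) (v i j)) -
      ∑ j, inner ℝ (t i) (v i j) ^ 2) l (𝓝 0) := by
    rw [Metric.tendsto_nhds]
    intro ε hε
    set η := ε / (2 * R') with hη
    have hη0 : 0 < η := by positivity
    have hloc : ∀ᶠ u in 𝓝 (0 : ℝ), |2 / b * (φ (1 + u) / (1 + u)) - u ^ 2| ≤ η * u ^ 2 := by
      -- The factor `2 / b` turns `b * η / 8` into `η / 4`; the condition `|u| < η / 4` gives the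
      -- same for the term `u * u ^ 2`; division by `1 + u ≥ 1 / 2` at most doubles the total `η /
      -- 2`.
      have h1 := hφ.isLittleO (ε := b * η / 8) (by positivity)
      have hm : 0 < min (1 / 2 : ℝ) (η / 4) := by positivity
      filter_upwards [h1, Metric.ball_mem_nhds 0 hm] with u hu hu'
      rw [mem_ball_zero_iff, lt_min_iff, Real.norm_eq_abs] at hu'
      have hpos : 1 / 2 ≤ 1 + u := by linarith [(abs_lt.1 hu'.1).1]
      have hpos' : 0 < 1 + u := by linarith
      have e : 2 / b * (φ (1 + u) / (1 + u)) - u ^ 2 =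
          (2 / b * (φ (1 + u) - b / 2 * u ^ 2) - u * u ^ 2) / (1 + u) := by
        field_simp
        ring
      rw [e, abs_div, abs_of_pos hpos', div_le_iff₀ hpos']
      have h2 : |2 / b * (φ (1 + u) - b / 2 * u ^ 2)| ≤ η / 4 * u ^ 2 := by
        rw [abs_mul, abs_of_pos (by positivity)]
        calc 2 / b * |φ (1 + u) - b / 2 * u ^ 2| ≤ 2 / b * (b * η / 8 * u ^ 2) := by gcongr
          _ = η / 4 * u ^ 2 := by field_simp; ring
      have h3 : |u * u ^ 2| ≤ η / 4 * u ^ 2 := by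
        rw [abs_mul, abs_of_nonneg (sq_nonneg u)]
        gcongr
        exact hu'.2.le
      calc |2 / b * (φ (1 + u) - b / 2 * u ^ 2) - u * u ^ 2| ≤ η / 4 * u ^ 2 + η / 4 * u ^ 2 :=
            (abs_sub _ _).trans (add_le_add h2 h3)
        _ = η * u ^ 2 * (1 / 2) := by ring
        _ ≤ η * u ^ 2 * (1 + u) := by gcongr
    obtain ⟨δ, hδ, hball⟩ := Metric.eventually_nhds_iff_ball.1 hloc
    filter_upwards [h.eventually_abs_inner_le ht (half_pos hδ), hR'] with i h1 h2
    rw [dist_zero_right, Finset.mul_sum, ← Finset.sum_sub_distrib]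
    have : ‖∑ j, (2 / b * (φ (1 + inner ℝ (t i) (v i j)) / (1 + inner ℝ (t i) (v i j))) -
        inner ℝ (t i) (v i j) ^ 2)‖ ≤ ∑ j, η * inner ℝ (t i) (v i j) ^ 2 := by
      refine (norm_sum_le _ _).trans (Finset.sum_le_sum fun j _ => hball _ ?_)
      rw [mem_ball_zero_iff]
      exact (h1 j).trans_lt (half_lt_self hδ)
    rw [← Finset.mul_sum] at this
    calc _ ≤ η * R' := this.trans (by gcongr)
      _ = ε / 2 := by rw [hη]; field_simp
      _ < ε := half_lt_self hε
  simpa using hrem.add (h.tendsto_sum_sq ht)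

end Expandable

end Expansion

/-! ### Bounded families along a filter. -/

section Bounded

variable {ι : Type*} {l : Filter ι} {H : Type*} [NormedAddCommGroup H]

/-- The family `f` is bounded in norm along the filter `l`. -/
def Bdd (l : Filter ι) (f : ι → H) : Prop := ∃ R, ∀ᶠ i in l, ‖f i‖ ≤ R

theorem Bdd.add {f f' : ι → H} (h : Bdd l f) (h' : Bdd l f') : Bdd l fun i => f i + f' i := by
  obtain ⟨R, hR⟩ := h
  obtain ⟨R', hR'⟩ := h'
  exact ⟨R + R', by filter_upwards [hR, hR'] with i h1 h2 using norm_add_le_of_le h1 h2⟩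

theorem Bdd.sub {f f' : ι → H} (h : Bdd l f) (h' : Bdd l f') : Bdd l fun i => f i - f' i := by
  obtain ⟨R, hR⟩ := h
  obtain ⟨R', hR'⟩ := h'
  exact ⟨R + R', by filter_upwards [hR, hR'] with i h1 h2 using norm_sub_le_of_le h1 h2⟩

theorem Bdd.clm [NormedSpace ℝ H] {K : Type*} [NormedAddCommGroup K] [NormedSpace ℝ K]
    {f : ι → H} (h : Bdd l f) (T : H →L[ℝ] K) : Bdd l fun i => T (f i) := by
  obtain ⟨R, hR⟩ := h
  refine ⟨‖T‖ * R, ?_⟩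
  filter_upwards [hR] with i h1
  exact T.le_opNorm_of_le h1

theorem Bdd.const (y : H) : Bdd l fun _ => y := ⟨‖y‖, Eventually.of_forall fun _ => le_rfl⟩

theorem Bdd.of_tendsto {f : ι → H} {y : H} (h : Tendsto f l (𝓝 y)) : Bdd l f :=
  ⟨‖y‖ + 1, h.norm.eventually_le_const (lt_add_one _)⟩

theorem Bdd.of_sub {f f' : ι → H} (h : Bdd l f) (h' : Tendsto (fun i => f' i - f i) l (𝓝 0)) :
    Bdd l f' := by
  simpa using (Bdd.of_tendsto h').add h

theorem Bdd.tendsto_smul [NormedSpace ℝ H] {f : ι → H} (h : Bdd l f) {s : ι → ℝ} (hs : Tendsto s l (𝓝 0)) :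
    Tendsto (fun i => s i • f i) l (𝓝 0) := by
  obtain ⟨R, hR⟩ := h
  have hlim : Tendsto (fun i => |s i| * |R|) l (𝓝 0) := by
    simpa using hs.abs.mul_const |R|
  refine squeeze_zero_norm' ?_ hlim
  filter_upwards [hR] with i hi
  rw [norm_smul, Real.norm_eq_abs]
  gcongr
  exact hi.trans (le_abs_self R)

theorem tendsto_inner_sub_inner [InnerProductSpace ℝ H] {x x' y y' : ι → H}
    (hx : Tendsto (fun i => x i - x' i) l (𝓝 0))
    (hy : Tendsto (fun i => y i - y' i) l (𝓝 0)) (hbx : Bdd l x) (hby : Bdd l y') :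
    Tendsto (fun i => inner ℝ (x i) (y i) - inner ℝ (x' i) (y' i)) l (𝓝 0) := by
  obtain ⟨R, hR⟩ := hbx
  obtain ⟨R', hR'⟩ := hby
  have hlim : Tendsto (fun i => |R| * ‖y i - y' i‖ + ‖x i - x' i‖ * |R'|) l (𝓝 0) := by
    simpa using (hy.norm.const_mul |R|).add (hx.norm.mul_const |R'|)
  refine squeeze_zero_norm' ?_ hlim
  filter_upwards [hR, hR'] with i h1 h2
  have : inner ℝ (x i) (y i) - inner ℝ (x' i) (y' i) =
      inner ℝ (x i) (y i - y' i) + inner ℝ (x i - x' i) (y' i) := by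
    rw [inner_sub_right, inner_sub_left]; ring
  rw [this]
  refine (norm_add_le _ _).trans (add_le_add ?_ ?_)
  · exact (norm_inner_le_norm _ _).trans (by gcongr; exact h1.trans (le_abs_self R))
  · exact (norm_inner_le_norm _ _).trans (by gcongr; exact h2.trans (le_abs_self R'))

/-- Select a counterexample wherever one exists and `y₀ i` elsewhere. This makes asymptotics proved
along single families uniform in the parameter and its multiplier. -/
theorem eventually_forall_of_seq {Y : Type*} {A P : ι → Y → Prop} (y₀ : ι → Y)
    (h₀ : ∀ᶠ i in l, A i (y₀ i))
    (h : ∀ y : ι → Y, (∀ᶠ i in l, A i (y i)) → ∀ᶠ i in l, P i (y i)) :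
    ∀ᶠ i in l, ∀ y, A i y → P i y := by
  classical
  set y : ι → Y := fun i => if hi : ∃ y, A i y ∧ ¬ P i y then hi.choose else y₀ i with hy
  have hA : ∀ᶠ i in l, A i (y i) := by
    filter_upwards [h₀] with i hi
    by_cases hex : ∃ y, A i y ∧ ¬ P i y
    · simp only [hy, dif_pos hex]; exact hex.choose_spec.1
    · simpa only [hy, dif_neg hex] using hi
  filter_upwards [h y hA] with i hi
  by_contra! hcon
  have hex : ∃ y, A i y ∧ ¬ P i y := hcon
  simp only [hy, dif_pos hex] at hi
  exact hex.choose_spec.2 hi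

end Bounded

/-! ### Local bounds on the estimating function and its sample means. -/

section Local

variable {𝒳 : Type*} {p : ℕ}

/-- On the closed ball of radius `δ` about `θ₀`, the function `g x` is bounded by `a x ≥ 1`, and
its first two derivatives exist and are bounded by `(a x)³`. -/
structure Envelope (g : 𝒳 → E p → E p) (θ₀ : E p) (a : 𝒳 → ℝ) (δ : ℝ) : Prop where
  pos : 0 < δ
  one_le : ∀ x, 1 ≤ a x
  bound : ∀ x, ∀ θ ∈ Metric.closedBall θ₀ δ, ‖g x θ‖ ≤ a x
  diff : ∀ x, ∀ θ ∈ Metric.closedBall θ₀ δ, DifferentiableAt ℝ (g x) θ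
  diff2 : ∀ x, ∀ θ ∈ Metric.closedBall θ₀ δ, DifferentiableAt ℝ (fderiv ℝ (g x)) θ
  deriv_le : ∀ x, ∀ θ ∈ Metric.closedBall θ₀ δ, ‖fderiv ℝ (g x) θ‖ ≤ a x ^ 3
  deriv2_le : ∀ x, ∀ θ ∈ Metric.closedBall θ₀ δ, ‖fderiv ℝ (fderiv ℝ (g x)) θ‖ ≤ a x ^ 3

namespace Envelope

variable {g : 𝒳 → E p → E p} {θ₀ : E p} {a : 𝒳 → ℝ} {δ : ℝ}

theorem mono (h : Envelope g θ₀ a δ) {δ' : ℝ} (h0 : 0 < δ') (hle : δ' ≤ δ) :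
    Envelope g θ₀ a δ' where
  pos := h0
  one_le := h.one_le
  bound x θ hθ := h.bound x θ (Metric.closedBall_subset_closedBall hle hθ)
  diff x θ hθ := h.diff x θ (Metric.closedBall_subset_closedBall hle hθ)
  diff2 x θ hθ := h.diff2 x θ (Metric.closedBall_subset_closedBall hle hθ)
  deriv_le x θ hθ := h.deriv_le x θ (Metric.closedBall_subset_closedBall hle hθ)
  deriv2_le x θ hθ := h.deriv2_le x θ (Metric.closedBall_subset_closedBall hle hθ)

theorem center_mem (h : Envelope g θ₀ a δ) : θ₀ ∈ Metric.closedBall θ₀ δ :=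
  Metric.mem_closedBall_self h.pos.le

theorem norm_sub_le (h : Envelope g θ₀ a δ) (x : 𝒳) {θ θ' : E p}
    (hθ : θ ∈ Metric.closedBall θ₀ δ) (hθ' : θ' ∈ Metric.closedBall θ₀ δ) :
    ‖g x θ - g x θ'‖ ≤ a x ^ 3 * ‖θ - θ'‖ :=
  (convex_closedBall θ₀ δ).norm_image_sub_le_of_norm_fderiv_le (h.diff x) (h.deriv_le x) hθ' hθ

theorem norm_fderiv_sub_le (h : Envelope g θ₀ a δ) (x : 𝒳) {θ : E p}
    (hθ : θ ∈ Metric.closedBall θ₀ δ) :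
    ‖fderiv ℝ (g x) θ - fderiv ℝ (g x) θ₀‖ ≤ a x ^ 3 * ‖θ - θ₀‖ :=
  (convex_closedBall θ₀ δ).norm_image_sub_le_of_norm_fderiv_le (h.diff2 x) (h.deriv2_le x)
    h.center_mem hθ

theorem norm_linear_sub_le (h : Envelope g θ₀ a δ) (x : 𝒳) {θ θ' : E p} {η : ℝ} (hη : η ≤ δ)
    (hθ : θ ∈ Metric.closedBall θ₀ η) (hθ' : θ' ∈ Metric.closedBall θ₀ η) :
    ‖g x θ - g x θ' - fderiv ℝ (g x) θ₀ (θ - θ')‖ ≤ a x ^ 3 * η * ‖θ - θ'‖ := by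
  have hsub := Metric.closedBall_subset_closedBall (x := θ₀) hη
  refine (convex_closedBall θ₀ η).norm_image_sub_le_of_norm_fderiv_le'
    (fun w hw => h.diff x w (hsub hw)) (fun w hw => ?_) hθ' hθ
  refine (h.norm_fderiv_sub_le x (hsub hw)).trans ?_
  have := pow_nonneg (zero_le_one.trans (h.one_le x)) 3
  gcongr
  exact mem_closedBall_iff_norm.1 hw

/-- The Lipschitz bound alone would need a fourth moment of `a`. Interpolating it with `‖g x θ - g x
θ₀‖ ≤ 2 a x` costs a square root of `‖θ - θ₀‖` but leaves the integrable power `a³`. -/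
theorem norm_outer_sub_le (h : Envelope g θ₀ a δ) (x : 𝒳) {θ : E p}
    (hθ : θ ∈ Metric.closedBall θ₀ δ) :
    ‖outer (g x θ) - outer (g x θ₀)‖ ≤ 4 * a x ^ 3 * √‖θ - θ₀‖ := by
  have ha := h.one_le x
  have ha0 : 0 ≤ a x := zero_le_one.trans ha
  have hb := h.bound x θ hθ
  have hb0 := h.bound x θ₀ h.center_mem
  refine (EmpLik.norm_outer_sub_le _ _).trans ?_
  set d := ‖g x θ - g x θ₀‖ with hd
  have h1 : d ≤ 2 * a x := (_root_.norm_sub_le _ _).trans (by linarith)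
  have h2 : d ≤ a x ^ 3 * ‖θ - θ₀‖ := h.norm_sub_le x hθ h.center_mem
  have h3 : d ≤ 2 * a x ^ 2 * √‖θ - θ₀‖ := by
    refine le_of_sq_le_sq ?_ (by positivity)
    rw [mul_pow, Real.sq_sqrt (norm_nonneg _)]
    calc d ^ 2 = d * d := sq d
      _ ≤ 2 * a x * (a x ^ 3 * ‖θ - θ₀‖) := by gcongr
      _ ≤ (2 * a x ^ 2) ^ 2 * ‖θ - θ₀‖ := by
        have : 0 ≤ a x ^ 4 * ‖θ - θ₀‖ := by positivity
        nlinarith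
  calc (‖g x θ‖ + ‖g x θ₀‖) * d ≤ (a x + a x) * (2 * a x ^ 2 * √‖θ - θ₀‖) := by gcongr
    _ = 4 * a x ^ 3 * √‖θ - θ₀‖ := by ring

end Envelope

theorem norm_avg_le {n : ℕ} {F : Type*} [NormedAddCommGroup F] [NormedSpace ℝ F] {w : Fin n → F}
    {b : Fin n → ℝ} {B r : ℝ} (hB : 0 ≤ B) (hr : 0 ≤ r) (hw : ∀ j, ‖w j‖ ≤ b j * r)
    (hb : ∑ j, b j ≤ B * n) : ‖(n : ℝ)⁻¹ • ∑ j, w j‖ ≤ B * r := by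
  rcases Nat.eq_zero_or_pos n with rfl | hn
  · simp; positivity
  have hn' : (0 : ℝ) < n := by exact_mod_cast hn
  rw [norm_smul, norm_inv, Real.norm_of_nonneg hn'.le, inv_mul_le_iff₀ hn']
  calc ‖∑ j, w j‖ ≤ ∑ j, b j * r := (norm_sum_le _ _).trans (Finset.sum_le_sum fun j _ => hw j)
    _ ≤ B * n * r := by rw [← Finset.sum_mul]; gcongr
    _ = n * (B * r) := by ring

/-- The sample mean of `g(·, θ)`. -/
noncomputable def gbar {n : ℕ} (g : 𝒳 → E p → E p) (x : Fin n → 𝒳) (θ : E p) : E p :=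
  vmean fun j => g (x j) θ

/-- The sample mean of the derivatives at `θ`. -/
noncomputable def Gbar {n : ℕ} (g : 𝒳 → E p → E p) (x : Fin n → 𝒳) (θ : E p) : E p →L[ℝ] E p :=
  (n : ℝ)⁻¹ • ∑ j, fderiv ℝ (g (x j)) θ

/-- The sample second moments of `g(·, θ)`. -/
noncomputable def Sbar {n : ℕ} (g : 𝒳 → E p → E p) (x : Fin n → 𝒳) (θ : E p) : E p →L[ℝ] E p :=
  (n : ℝ)⁻¹ • ∑ j, outer (g (x j) θ)

variable {g : 𝒳 → E p → E p} {θ₀ : E p} {a : 𝒳 → ℝ} {δ : ℝ} {n : ℕ} {x : Fin n → 𝒳} {B : ℝ}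

theorem Envelope.norm_Sbar_sub_le (h : Envelope g θ₀ a δ) (hB : 0 ≤ B)
    (hx : ∑ j, a (x j) ^ 3 ≤ B * n) {θ : E p} (hθ : θ ∈ Metric.closedBall θ₀ δ) :
    ‖Sbar g x θ - Sbar g x θ₀‖ ≤ B * (4 * √‖θ - θ₀‖) := by
  have : Sbar g x θ - Sbar g x θ₀ =
      (n : ℝ)⁻¹ • ∑ j, (outer (g (x j) θ) - outer (g (x j) θ₀)) := by
    simp only [Sbar, Finset.sum_sub_distrib, smul_sub]
  rw [this]
  refine norm_avg_le (b := fun j => a (x j) ^ 3) hB (by positivity) (fun j => ?_) hx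
  refine (h.norm_outer_sub_le (x j) hθ).trans_eq ?_
  ring

theorem Envelope.norm_gbar_linear_le (h : Envelope g θ₀ a δ) (hB : 0 ≤ B)
    (hx : ∑ j, a (x j) ^ 3 ≤ B * n) {θ θ' : E p} {η : ℝ} (hη0 : 0 ≤ η) (hη : η ≤ δ)
    (hθ : θ ∈ Metric.closedBall θ₀ η) (hθ' : θ' ∈ Metric.closedBall θ₀ η) :
    ‖gbar g x θ - gbar g x θ' - Gbar g x θ₀ (θ - θ')‖ ≤ B * (η * ‖θ - θ'‖) := by
  have : gbar g x θ - gbar g x θ' - Gbar g x θ₀ (θ - θ') = (n : ℝ)⁻¹ •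
      ∑ j, (g (x j) θ - g (x j) θ' - fderiv ℝ (g (x j)) θ₀ (θ - θ')) := by
    simp only [gbar, Gbar, vmean, smul_apply, sum_apply, Finset.sum_sub_distrib, smul_sub]
  rw [this]
  refine norm_avg_le (b := fun j => a (x j) ^ 3) hB (by positivity) (fun j => ?_) hx
  refine (h.norm_linear_sub_le (x j) hη hθ hθ').trans_eq ?_
  ring

end Local

/-! ### The constraint surface near `θ₀`. -/

section Constraint

variable {p q : ℕ} {c : E p → E q} {θ₀ : E p} {C : E p →L[ℝ] E q}

/-- Quantitative open mapping: near `θ₀` the map `c` differs from `C` by a function with small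
Lipschitz constant, so the image of the ball of radius `m⁻¹ ‖c θ‖` about `θ` covers the ball of
radius `‖c θ‖` about `c θ`, which contains `0`. -/
theorem exists_zero_near (hc : HasStrictFDerivAt c C θ₀) (hC : Function.Surjective C)
    (h0 : c θ₀ = 0) : ∃ K, ∀ᶠ θ in 𝓝 θ₀, ∃ θ', c θ' = 0 ∧ ‖θ' - θ‖ ≤ K * ‖c θ‖ := by
  have hr : C.range = ⊤ := LinearMap.range_eq_top.2 hC
  set I := C.nonlinearRightInverseOfSurjective hr
  have hI : 0 < I.nnnorm := C.nonlinearRightInverseOfSurjective_nnnorm_pos hr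
  have hI' : (0 : ℝ) < I.nnnorm := hI
  obtain ⟨s, hs, happ⟩ := hc.approximates_deriv_on_nhds (c := I.nnnorm⁻¹ / 2)
    (Or.inr (by positivity))
  obtain ⟨r, hr0, hrs⟩ := Metric.mem_nhds_iff.1 hs
  set m : ℝ := (I.nnnorm : ℝ)⁻¹ - ((I.nnnorm⁻¹ / 2 : ℝ≥0) : ℝ) with hm
  have hm0 : 0 < m := by
    rw [hm]; push_cast
    have := inv_pos.2 hI'
    linarith
  refine ⟨m⁻¹, ?_⟩
  have hcont : Tendsto (fun θ => ‖θ - θ₀‖ + m⁻¹ * ‖c θ‖) (𝓝 θ₀) (𝓝 0) := by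
    have h1 : Tendsto (fun θ : E p => ‖θ - θ₀‖) (𝓝 θ₀) (𝓝 0) := tendsto_norm_sub_self θ₀
    have h2 := (hc.continuousAt.tendsto.norm).const_mul m⁻¹
    rw [h0, norm_zero, mul_zero] at h2
    simpa using h1.add h2
  filter_upwards [hcont.eventually_lt_const hr0] with θ hθ
  have hsub : Metric.closedBall θ (m⁻¹ * ‖c θ‖) ⊆ s := fun w hw => hrs (by
    rw [mem_ball_iff_norm]
    rw [mem_closedBall_iff_norm] at hw
    calc ‖w - θ₀‖ ≤ ‖w - θ‖ + ‖θ - θ₀‖ := norm_sub_le_norm_sub_add_norm_sub _ _ _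
      _ < r := by linarith)
  have hsurj := happ.surjOn_closedBall_of_nonlinearRightInverse I (ε := m⁻¹ * ‖c θ‖)
    (by positivity) hsub
  obtain ⟨θ', hθ', hz⟩ := hsurj (show (0 : E q) ∈ _ by
    rw [mem_closedBall_iff_norm, zero_sub, norm_neg, ← hm, ← mul_assoc, mul_inv_cancel₀ hm0.ne',
      one_mul])
  exact ⟨θ', hz, mem_closedBall_iff_norm.1 hθ'⟩

theorem tendsto_scaled_sub {ι : Type*} {l : Filter ι} {s : ι → ℝ} {θ θ' : ι → E p}
    (hc : HasStrictFDerivAt c C θ₀) (hθ : Tendsto θ l (𝓝 θ₀)) (hθ' : Tendsto θ' l (𝓝 θ₀))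
    (hb : Bdd l fun i => s i • (θ' i - θ i)) :
    Tendsto (fun i => s i • (c (θ' i) - c (θ i)) - C (s i • (θ' i - θ i))) l (𝓝 0) := by
  obtain ⟨R, hR⟩ := hb
  rw [Metric.tendsto_nhds]
  intro ε hε
  have h1 := (hc.isLittleO.def (c := ε / (2 * (|R| + 1))) (by positivity))
  have h2 := (hθ'.prodMk_nhds hθ).eventually h1
  filter_upwards [h2, hR] with i h3 h4
  rw [dist_zero_right, map_smul, ← smul_sub, norm_smul]
  calc ‖s i‖ * ‖c (θ' i) - c (θ i) - C (θ' i - θ i)‖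
      ≤ ‖s i‖ * (ε / (2 * (|R| + 1)) * ‖θ' i - θ i‖) := by gcongr
    _ = ε / (2 * (|R| + 1)) * ‖s i • (θ' i - θ i)‖ := by rw [norm_smul]; ring
    _ ≤ ε / (2 * (|R| + 1)) * (|R| + 1) := by
        gcongr; exact h4.trans ((le_abs_self R).trans (by linarith))
    _ = ε / 2 := by field_simp
    _ < ε := half_lt_self hε

end Constraint

/-! ### Deterministic asymptotics of the restricted estimator. -/

section Asymptotics

variable {𝒳 : Type*} {p q : ℕ}

/-- The limiting operators of the estimation problem: second moments `S`, derivative `G` with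
inverse `Ginv`, derivative `C` of the constraint, and a factorisation `D G = L C` in which
`D` standardises `S`. -/
structure Limits (S G Ginv : E p →L[ℝ] E p) (C D : E p →L[ℝ] E q) (L : E q →L[ℝ] E q) (κ : ℝ) :
    Prop where
  coercive : ∃ κ > 0, ∀ u, κ * ‖u‖ ^ 2 ≤ inner ℝ (S u) u
  symm : ∀ u w, inner ℝ (S u) w = inner ℝ u (S w)
  pos : 0 < κ
  lower : ∀ v, κ * ‖v‖ ≤ ‖G v‖
  inv : ∀ y, G (Ginv y) = y
  surj : Function.Surjective C
  standard : ∀ b, D (S (D.adjoint b)) = b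
  factor : ∀ v, D (G v) = L (C v)
  inj : Function.Injective L

/-- The local regularity of the estimating function and of the constraint. -/
structure LocalSetup (g : 𝒳 → E p → E p) (c : E p → E q) (θ₀ : E p) (a : 𝒳 → ℝ) (B δ κ : ℝ)
    (C : E p →L[ℝ] E q) : Prop where
  env : Envelope g θ₀ a δ
  one_le : 1 ≤ B
  radius : 4 * (B * δ) ≤ κ
  strict : HasStrictFDerivAt c C θ₀
  cont : ContinuousOn c (Metric.closedBall θ₀ δ)
  zero : c θ₀ = 0

/-- A family of samples, indexed along a filter `l`, whose empirical moments have the limits `S`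
and `G` and whose root-`n` scaled means at the parameters `θn → θ₀` are bounded. -/
structure Samples {ι : Type*} (l : Filter ι) (g : 𝒳 → E p → E p) (c : E p → E q) (θ₀ : E p)
    (a : 𝒳 → ℝ) (B : ℝ) (S G : E p →L[ℝ] E p) (N : ι → ℕ) (x : ∀ i, Fin (N i) → 𝒳)
    (θn : ι → E p) (f : E q) : Prop where
  size : Tendsto N l atTop
  cube : ∀ᶠ i in l, ∑ j, a (x i j) ^ 3 ≤ B * N i
  second : Tendsto (fun i => Sbar g (x i) θ₀) l (𝓝 S)
  jac : Tendsto (fun i => Gbar g (x i) θ₀) l (𝓝 G)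
  param : Tendsto θn l (𝓝 θ₀)
  constraint : ∀ᶠ i in l, c (θn i) = (√(N i))⁻¹ • f
  mean : Bdd l fun i => √(N i) • gbar g (x i) (θn i)

variable {g : 𝒳 → E p → E p} {c : E p → E q} {θ₀ : E p} {a : 𝒳 → ℝ} {B δ κ : ℝ}
  {S G Ginv : E p →L[ℝ] E p} {C D : E p →L[ℝ] E q} {L : E q →L[ℝ] E q}
  {ι : Type*} {l : Filter ι} {N : ι → ℕ} {x : ∀ i, Fin (N i) → 𝒳} {θn : ι → E p} {f : E q}

theorem Envelope.sum_cube_le (h : Envelope g θ₀ a δ) {n : ℕ} {x : Fin n → 𝒳}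
    (hx : ∑ j, a (x j) ^ 3 ≤ B * n) {θ : E p} (hθ : θ ∈ Metric.closedBall θ₀ δ) :
    ∑ j, ‖g (x j) θ‖ ^ 3 ≤ B * n :=
  (Finset.sum_le_sum fun _ _ => pow_le_pow_left₀ (norm_nonneg _) (h.bound _ θ hθ) 3).trans hx

theorem Envelope.sum_sq_le (h : Envelope g θ₀ a δ) {n : ℕ} {x : Fin n → 𝒳}
    (hx : ∑ j, a (x j) ^ 3 ≤ B * n) {θ : E p} (hθ : θ ∈ Metric.closedBall θ₀ δ) :
    ∑ j, ‖g (x j) θ‖ ^ 2 ≤ B * n :=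
  (Finset.sum_le_sum fun _ _ => (pow_le_pow_left₀ (norm_nonneg _) (h.bound _ θ hθ) 2).trans
    (pow_le_pow_right₀ (h.one_le _) (by norm_num))).trans hx

theorem tendsto_of_scaled (hN : Tendsto N l atTop) (hθ : Tendsto θn l (𝓝 θ₀)) {θ : ι → E p}
    (hb : Bdd l fun i => √(N i) • (θ i - θn i)) : Tendsto θ l (𝓝 θ₀) := by
  have h1 : Tendsto (fun i => (√(N i))⁻¹ • √(N i) • (θ i - θn i)) l (𝓝 0) :=
    hb.tendsto_smul (tendsto_sqrt_size hN).inv_tendsto_atTop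
  have h2 := h1.add hθ
  rw [zero_add] at h2
  refine h2.congr' ?_
  filter_upwards [hN.eventually_gt_atTop 0] with i hi
  have : 0 < √(N i : ℝ) := Real.sqrt_pos.2 (by exact_mod_cast hi)
  rw [smul_smul, inv_mul_cancel₀ this.ne', one_smul, sub_add_cancel]

namespace Samples

theorem eventually_pos (h : Samples l g c θ₀ a B S G N x θn f) : ∀ᶠ i in l, 0 < N i :=
  h.size.eventually_gt_atTop 0

/-- From the lower bound `κ` of `G`, a quarter is lost to `Gbar - G` and a quarter to the
nonlinearity of `gbar` on the ball, which is at most `B δ ≤ κ / 4` by `radius`. -/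
theorem eventually_lower (h : Samples l g c θ₀ a B S G N x θn f)
    (hl : Limits S G Ginv C D L κ) (hs : LocalSetup g c θ₀ a B δ κ C) :
    ∀ᶠ i in l, ∀ θ ∈ Metric.closedBall θ₀ δ, ∀ θ' ∈ Metric.closedBall θ₀ δ,
      κ / 2 * ‖θ - θ'‖ ≤ ‖gbar g (x i) θ - gbar g (x i) θ'‖ := by
  have hκ := hl.pos
  filter_upwards [h.cube, Metric.tendsto_nhds.1 h.jac (κ / 4) (by positivity)]
    with i h1 h2 θ hθ θ' hθ'
  rw [dist_eq_norm] at h2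
  have h3 := hs.env.norm_gbar_linear_le (zero_le_one.trans hs.one_le) h1 hs.env.pos.le le_rfl hθ hθ'
  have h4 := (Gbar g (x i) θ₀ - G).le_of_opNorm_le h2.le (θ - θ')
  have h5 := hl.lower (θ - θ')
  have h6 : G (θ - θ') = (gbar g (x i) θ - gbar g (x i) θ') -
      (gbar g (x i) θ - gbar g (x i) θ' - Gbar g (x i) θ₀ (θ - θ')) -
      (Gbar g (x i) θ₀ - G) (θ - θ') := by
    rw [sub_apply]; abel
  have h7 : ‖G (θ - θ')‖ ≤ ‖gbar g (x i) θ - gbar g (x i) θ'‖ + B * (δ * ‖θ - θ'‖) +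
      κ / 4 * ‖θ - θ'‖ := by
    rw [h6]
    exact (norm_sub_le _ _).trans (add_le_add ((norm_sub_le _ _).trans (by gcongr)) h4)
  have h8 : B * (δ * ‖θ - θ'‖) ≤ κ / 4 * ‖θ - θ'‖ := by
    rw [← mul_assoc]
    gcongr
    linarith [hs.radius]
  linarith

/-- This replaces a proof of consistency: by duality a bounded `logSum` bounds `√n ‖gbar θ‖`, and
`eventually_lower` turns this into a bound on `√n ‖θ - θn‖`, uniformly over the fixed ball. -/
theorem localize (h : Samples l g c θ₀ a B S G N x θn f)
    (hl : Limits S G Ginv C D L κ) (hs : LocalSetup g c θ₀ a B δ κ C) (M : ℝ) :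
    ∃ R, ∀ᶠ i in l, ∀ θ ∈ Metric.closedBall θ₀ δ, ∀ t, IsMult (fun j => g (x i j) θ) t →
      logSum (fun j => g (x i j) θ) t ≤ M → ‖√(N i) • (θ - θn i)‖ ≤ R := by
  have hκ := hl.pos
  obtain ⟨R, hR⟩ := h.mean
  have hB := zero_le_one.trans hs.one_le
  refine ⟨2 / κ * (M + 2 * B + R), ?_⟩
  filter_upwards [h.cube, h.eventually_lower hl hs, hR, h.eventually_pos,
    h.param (Metric.closedBall_mem_nhds θ₀ hs.env.pos),
    eventually_norm_le_mul_sqrt (G := E p) h.size hB (show (0 : ℝ) < 1 / 2 by norm_num)]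
    with i h1 h2 h3 hn h4 h5 θ hθ t ht hM
  have h6 := sqrt_mul_norm_vmean_le hn ht
    (fun j => (h5 _ (hs.env.sum_cube_le h1 hθ) j).trans_eq (by ring)) (hs.env.sum_sq_le h1 hθ)
  have h7 := h2 θ hθ (θn i) h4
  rw [norm_smul, Real.norm_of_nonneg (Real.sqrt_nonneg _)] at h3 ⊢
  have h8 : √(N i) * ‖gbar g (x i) θ‖ ≤ M + 2 * B := h6.trans (by linarith)
  have h9 : √(N i) * (κ / 2 * ‖θ - θn i‖) ≤ M + 2 * B + R := by
    calc √(N i) * (κ / 2 * ‖θ - θn i‖)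
        ≤ √(N i) * (‖gbar g (x i) θ‖ + ‖gbar g (x i) (θn i)‖) := by
          gcongr; exact h7.trans (norm_sub_le _ _)
      _ ≤ M + 2 * B + R := by rw [mul_add]; exact add_le_add h8 h3
  calc √(N i) * ‖θ - θn i‖ = 2 / κ * (√(N i) * (κ / 2 * ‖θ - θn i‖)) := by field_simp
    _ ≤ 2 / κ * (M + 2 * B + R) := by gcongr

theorem tendsto_gbar (h : Samples l g c θ₀ a B S G N x θn f)
    (hs : LocalSetup g c θ₀ a B δ κ C) {θ : ι → E p}
    (hb : Bdd l fun i => √(N i) • (θ i - θn i)) :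
    Tendsto (fun i => √(N i) • gbar g (x i) (θ i) - √(N i) • gbar g (x i) (θn i) -
      G (√(N i) • (θ i - θn i))) l (𝓝 0) := by
  have hθ := tendsto_of_scaled h.size h.param hb
  have hB := zero_le_one.trans hs.one_le
  obtain ⟨R, hR⟩ := hb
  set η : ι → ℝ := fun i => ‖θ i - θ₀‖ + ‖θn i - θ₀‖ with hη
  have hη0 : Tendsto η l (𝓝 0) := by
    simpa using (tendsto_iff_norm_sub_tendsto_zero.1 hθ).add
      (tendsto_iff_norm_sub_tendsto_zero.1 h.param)
  have hlim : Tendsto (fun i => B * (η i * |R|) + ‖Gbar g (x i) θ₀ - G‖ * |R|) l (𝓝 0) := by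
    simpa using ((hη0.mul_const |R|).const_mul B).add
      ((tendsto_iff_norm_sub_tendsto_zero.1 h.jac).mul_const |R|)
  refine squeeze_zero_norm' ?_ hlim
  filter_upwards [h.cube, hR, hη0.eventually_le_const hs.env.pos] with i h1 h2 h3
  have h2' := h2.trans (le_abs_self R)
  have hη1 : 0 ≤ η i := by positivity
  have h4 := hs.env.norm_gbar_linear_le hB h1 hη1 h3
    (θ := θ i) (θ' := θn i) (mem_closedBall_iff_norm.2 (by simp [hη]))
    (mem_closedBall_iff_norm.2 (by simp [hη]))
  have e : √(N i) • gbar g (x i) (θ i) - √(N i) • gbar g (x i) (θn i) -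
      G (√(N i) • (θ i - θn i)) =
      √(N i) • (gbar g (x i) (θ i) - gbar g (x i) (θn i) - Gbar g (x i) θ₀ (θ i - θn i)) +
      (Gbar g (x i) θ₀ - G) (√(N i) • (θ i - θn i)) := by
    simp only [sub_apply, smul_sub, map_sub, map_smul]
    abel
  rw [e]
  refine (norm_add_le _ _).trans (add_le_add ?_ ?_)
  · rw [norm_smul, Real.norm_of_nonneg (Real.sqrt_nonneg _)]
    rw [norm_smul, Real.norm_of_nonneg (Real.sqrt_nonneg _)] at h2'
    calc _ ≤ √(N i) * (B * (η i * ‖θ i - θn i‖)) := by gcongr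
      _ = B * (η i * (√(N i) * ‖θ i - θn i‖)) := by ring
      _ ≤ B * (η i * |R|) := by gcongr
  · exact (ContinuousLinearMap.le_opNorm _ _).trans (by gcongr)

theorem expandable (h : Samples l g c θ₀ a B S G N x θn f)
    (hl : Limits S G Ginv C D L κ) (hs : LocalSetup g c θ₀ a B δ κ C) {θ : ι → E p}
    (hb : Bdd l fun i => √(N i) • (θ i - θn i)) :
    Expandable l N (fun i j => g (x i j) (θ i)) S := by
  have hθ := tendsto_of_scaled h.size h.param hb
  have hB := zero_le_one.trans hs.one_le
  have hmem := hθ (Metric.closedBall_mem_nhds θ₀ hs.env.pos)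
  refine ⟨h.size, ⟨B, hs.one_le, ?_⟩, ?_, hl.coercive, ?_⟩
  · filter_upwards [h.cube, hmem] with i h1 h2 using hs.env.sum_cube_le h1 h2
  · have hlim : Tendsto (fun i => B * (4 * √‖θ i - θ₀‖)) l (𝓝 0) := by
      have := (tendsto_iff_norm_sub_tendsto_zero.1 hθ).sqrt
      simpa using (this.const_mul 4).const_mul B
    have : Tendsto (fun i => Sbar g (x i) (θ i) - Sbar g (x i) θ₀) l (𝓝 0) := by
      refine squeeze_zero_norm' ?_ hlim
      filter_upwards [h.cube, hmem] with i h1 h2 using hs.env.norm_Sbar_sub_le hB h1 h2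
    simpa [Sbar] using this.add h.second
  · have h1 := (Bdd.of_tendsto (h.tendsto_gbar hs hb)).add (h.mean.add (hb.clm G))
    obtain ⟨R, hR⟩ := h1
    refine ⟨R, ?_⟩
    filter_upwards [hR] with i hi
    have e : √(N i) • gbar g (x i) (θ i) - √(N i) • gbar g (x i) (θn i) -
        G (√(N i) • (θ i - θn i)) +
        (√(N i) • gbar g (x i) (θn i) + G (√(N i) • (θ i - θn i))) =
        √(N i) • gbar g (x i) (θ i) := by abel
    rwa [e, norm_smul, Real.norm_of_nonneg (Real.sqrt_nonneg _)] at hi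

/-- The standardised mean `D W - L f`, where `W` is the scaled mean at `θn`. -/
theorem bdd_standardised (h : Samples l g c θ₀ a B S G N x θn f) (D : E p →L[ℝ] E q) (y : E q) :
    Bdd l fun i => D (√(N i) • gbar g (x i) (θn i)) - y :=
  (h.mean.clm D).sub (Bdd.const y)

/-- The optimal displacement `v` solves `W + G v = S Dᵀ b`. It is tangent to the constraint, since
`L C v = D G v = b - D W = -L f` and `L` is injective. Hence `c (θn + v / √n) = o(n^{-1/2})`, and
moving to an exact zero of `c` costs only `o(n^{-1/2})`. -/
theorem exists_candidate (h : Samples l g c θ₀ a B S G N x θn f)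
    (hl : Limits S G Ginv C D L κ) (hs : LocalSetup g c θ₀ a B δ κ C) :
    ∃ θ : ι → E p, (∀ᶠ i in l, c (θ i) = 0) ∧ (Bdd l fun i => √(N i) • (θ i - θn i)) ∧
      Tendsto (fun i => √(N i) • gbar g (x i) (θ i) -
        S (D.adjoint (D (√(N i) • gbar g (x i) (θn i)) - L f))) l (𝓝 0) := by
  set W : ι → E p := fun i => √(N i) • gbar g (x i) (θn i) with hW
  set v : ι → E p := fun i => Ginv (S (D.adjoint (D (W i) - L f)) - W i) with hv
  have hvb : Bdd l v :=
    ((((h.bdd_standardised D (L f)).clm D.adjoint).clm S).sub h.mean).clm Ginv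
  have hCv : ∀ i, C (v i) = -f := fun i => by
    refine hl.inj ?_
    rw [← hl.factor, hv, hl.inv, map_sub, hl.standard, map_neg]
    abel
  set θ' : ι → E p := fun i => θn i + (√(N i))⁻¹ • v i with hθ'
  have hscale : ∀ᶠ i in l, √(N i) • (θ' i - θn i) = v i := by
    filter_upwards [h.eventually_pos] with i hi
    have : 0 < √(N i : ℝ) := Real.sqrt_pos.2 (by exact_mod_cast hi)
    simp [hθ', smul_smul, mul_inv_cancel₀ this.ne']
  have hb' : Bdd l fun i => √(N i) • (θ' i - θn i) := by
    obtain ⟨R, hR⟩ := hvb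
    exact ⟨R, by filter_upwards [hR, hscale] with i h1 h2 using h2 ▸ h1⟩
  have htend' := tendsto_of_scaled h.size h.param hb'
  have hc' : Tendsto (fun i => √(N i) • c (θ' i)) l (𝓝 0) := by
    refine (tendsto_scaled_sub hs.strict h.param htend' hb').congr' ?_
    filter_upwards [hscale, h.constraint, h.eventually_pos] with i h1 h2 hi
    have : 0 < √(N i : ℝ) := Real.sqrt_pos.2 (by exact_mod_cast hi)
    rw [h1, hCv, h2, smul_sub, smul_smul, mul_inv_cancel₀ this.ne', one_smul]
    abel
  obtain ⟨K, hK⟩ := exists_zero_near hs.strict hl.surj hs.zero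
  -- The default value `0` is used only where no nearby zero exists, which eventually does not
  -- happen.
  have hex : ∀ i, ∃ θ, (∃ θ, c θ = 0 ∧ ‖θ - θ' i‖ ≤ K * ‖c (θ' i)‖) →
      c θ = 0 ∧ ‖θ - θ' i‖ ≤ K * ‖c (θ' i)‖ := fun i => by
    by_cases hi : ∃ θ, c θ = 0 ∧ ‖θ - θ' i‖ ≤ K * ‖c (θ' i)‖
    · exact ⟨hi.choose, fun _ => hi.choose_spec⟩
    · exact ⟨0, fun h => absurd h hi⟩
  choose θ hθ using hex
  have hgood : ∀ᶠ i in l, c (θ i) = 0 ∧ ‖θ i - θ' i‖ ≤ K * ‖c (θ' i)‖ := by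
    filter_upwards [htend'.eventually hK] with i hi using hθ i hi
  have hdiff : Tendsto (fun i => √(N i) • (θ i - θ' i)) l (𝓝 0) := by
    have hlim : Tendsto (fun i => K * ‖√(N i) • c (θ' i)‖) l (𝓝 0) := by
      simpa using hc'.norm.const_mul K
    refine squeeze_zero_norm' ?_ hlim
    filter_upwards [hgood] with i hi
    rw [norm_smul, norm_smul, mul_left_comm]
    exact mul_le_mul_of_nonneg_left hi.2 (norm_nonneg _)
  have hdv : Tendsto (fun i => √(N i) • (θ i - θn i) - v i) l (𝓝 0) := by
    refine hdiff.congr' ?_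
    filter_upwards [hscale] with i hi
    rw [← hi, ← smul_sub]
    congr 1
    abel
  have hb : Bdd l fun i => √(N i) • (θ i - θn i) := hvb.of_sub hdv
  refine ⟨θ, hgood.mono fun i hi => hi.1, hb, ?_⟩
  have h1 := h.tendsto_gbar hs hb
  have h2 := (G.continuous.tendsto 0).comp hdv
  rw [map_zero] at h2
  have h3 := h1.add h2
  rw [zero_add] at h3
  refine h3.congr fun i => ?_
  have : G (v i) = S (D.adjoint (D (W i) - L f)) - W i := hl.inv _
  simp only [Function.comp_apply, map_sub G, this]
  simp only [map_sub, hW]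
  abel

/-- By coercivity of `S`, `τ ≈ Dᵀ b`, and `D S Dᵀ = 1` turns the quadratic form into `‖b‖²`. -/
theorem tendsto_quadratic_candidate (hl : Limits S G Ginv C D L κ) {τ y : ι → E p} {b : ι → E q}
    (hb : Bdd l b) (hτ : Bdd l τ) (h1 : Tendsto (fun i => y i - S (D.adjoint (b i))) l (𝓝 0))
    (h2 : Tendsto (fun i => y i - S (τ i)) l (𝓝 0)) :
    Tendsto (fun i => inner ℝ (S (τ i)) (τ i) - ‖b i‖ ^ 2) l (𝓝 0) := by
  obtain ⟨κ', hκ', hS⟩ := hl.coercive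
  have h3 : Tendsto (fun i => S (τ i) - S (D.adjoint (b i))) l (𝓝 0) := by
    have := h1.sub h2
    rw [sub_zero] at this
    exact this.congr fun i => by abel
  have h4 : Tendsto (fun i => τ i - D.adjoint (b i)) l (𝓝 0) := by
    have hlim := (h3.norm).const_mul κ'⁻¹
    rw [norm_zero, mul_zero] at hlim
    refine squeeze_zero_norm (fun i => ?_) hlim
    set u := τ i - D.adjoint (b i)
    rw [← map_sub, inv_mul_eq_div, le_div_iff₀ hκ']
    have := (hS u).trans (real_inner_le_norm _ _)
    rcases (norm_nonneg u).eq_or_lt with h0 | h0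
    · rw [← h0, zero_mul]; exact norm_nonneg _
    · nlinarith
  refine (tendsto_inner_sub_inner h3 h4 (hτ.clm S) (hb.clm D.adjoint)).congr fun i => ?_
  rw [ContinuousLinearMap.adjoint_inner_right, hl.standard, real_inner_self_eq_norm_sq]

/-- Pythagoras in the inner product of `S`: `w = Dᵀ D S τ` is the projection of `τ` onto the range
of `Dᵀ`, and the form at `τ - w` is nonnegative. -/
theorem _root_.EmpLik.Limits.norm_sq_le (hl : Limits S G Ginv C D L κ) (τ : E p) :
    ‖D (S τ)‖ ^ 2 ≤ inner ℝ (S τ) τ := by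
  obtain ⟨κ', hκ', hS⟩ := hl.coercive
  set w := D.adjoint (D (S τ)) with hw
  have h0 : 0 ≤ inner ℝ (S (τ - w)) (τ - w) := le_trans (by positivity) (hS _)
  have e1 : inner ℝ (S τ) w = ‖D (S τ)‖ ^ 2 := by
    rw [hw, ContinuousLinearMap.adjoint_inner_right, real_inner_self_eq_norm_sq]
  have e2 : inner ℝ (S w) τ = ‖D (S τ)‖ ^ 2 := by rw [hl.symm, real_inner_comm, e1]
  have e3 : inner ℝ (S w) w = ‖D (S τ)‖ ^ 2 := by
    nth_rewrite 2 [hw]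
    rw [ContinuousLinearMap.adjoint_inner_right, hw, hl.standard, real_inner_self_eq_norm_sq]
  rw [map_sub, inner_sub_left, inner_sub_right, inner_sub_right, e1, e2, e3] at h0
  linarith

theorem exists_candidate_logSum (h : Samples l g c θ₀ a B S G N x θn f)
    (hl : Limits S G Ginv C D L κ) (hs : LocalSetup g c θ₀ a B δ κ C) :
    ∃ θ t : ι → E p, (∀ᶠ i in l, c (θ i) = 0) ∧ (Bdd l fun i => √(N i) • (θ i - θn i)) ∧
      (∀ᶠ i in l, IsMult (fun j => g (x i j) (θ i)) (t i)) ∧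
      Tendsto (fun i => 2 * logSum (fun j => g (x i j) (θ i)) (t i) -
        ‖D (√(N i) • gbar g (x i) (θn i)) - L f‖ ^ 2) l (𝓝 0) := by
  obtain ⟨θ, hc, hb, hy⟩ := h.exists_candidate hl hs
  have hexp := h.expandable hl hs hb
  have hex : ∀ i, ∃ t, (∃ t, IsMult (fun j => g (x i j) (θ i)) t) →
      IsMult (fun j => g (x i j) (θ i)) t := fun i => by
    by_cases hi : ∃ t, IsMult (fun j => g (x i j) (θ i)) t
    · exact ⟨hi.choose, fun _ => hi.choose_spec⟩
    · exact ⟨0, fun h => absurd h hi⟩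
  choose t ht' using hex
  have ht : ∀ᶠ i in l, IsMult (fun j => g (x i j) (θ i)) (t i) :=
    hexp.eventually_exists_isMult.mono fun i hi => ht' i hi
  refine ⟨θ, t, hc, hb, ht, ?_⟩
  have h1 := hexp.tendsto_two_mul_logSum ht
  have h2 := tendsto_quadratic_candidate hl (h.bdd_standardised D (L f))
    (hexp.eventually_norm_scaled_le ht) hy (hexp.tendsto_score ht)
  have := h1.add h2
  rw [add_zero] at this
  exact this.congr fun i => by ring

theorem exists_logSum_le {θ t : ι → E p} {b : ι → E q} (hb : Bdd l b)
    (h : Tendsto (fun i => 2 * logSum (fun j => g (x i j) (θ i)) (t i) - ‖b i‖ ^ 2) l (𝓝 0)) :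
    ∃ M, ∀ᶠ i in l, logSum (fun j => g (x i j) (θ i)) (t i) ≤ M := by
  obtain ⟨R, hR⟩ := hb
  refine ⟨(R ^ 2 + 1) / 2, ?_⟩
  filter_upwards [hR, h.eventually_le_const zero_lt_one] with i h1 h2
  have : ‖b i‖ ^ 2 ≤ R ^ 2 := by gcongr
  linarith

/-- The maximizer competes with the candidate, so its `logSum` is bounded and `localize` applies.
Its quadratic form is then squeezed: from below because `D G = L C` and the constraint fix `D S τ ≈
b`, from above by the value at the candidate. -/
theorem tendsto_statistic_sub (h : Samples l g c θ₀ a B S G N x θn f)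
    (hl : Limits S G Ginv C D L κ) (hs : LocalSetup g c θ₀ a B δ κ C) {Θ : Set (E p)}
    (hΘ : Θ ∈ 𝓝 θ₀) {θ t : ι → E p} (hU : ∀ᶠ i in l, θ i ∈ Metric.closedBall θ₀ δ)
    (hm : ∀ᶠ i in l, IsRestrictedMELE g c Θ (x i) (θ i) (t i)) {φ : ℝ → ℝ} (hφ : PhiClass φ) :
    Tendsto (fun i => statistic φ g (x i) (θ i) (t i) -
      ‖D (√(N i) • gbar g (x i) (θn i)) - L f‖ ^ 2) l (𝓝 0) := by
  set b : ι → E q := fun i => D (√(N i) • gbar g (x i) (θn i)) - L f with hb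
  have hbb : Bdd l b := h.bdd_standardised D (L f)
  obtain ⟨θs, ts, hcs, hbs, hts, hlim⟩ := h.exists_candidate_logSum hl hs
  obtain ⟨M, hM⟩ := exists_logSum_le hbb hlim
  have hmult : ∀ᶠ i in l, IsMult (fun j => g (x i j) (θ i)) (t i) :=
    hm.mono fun i hi => isMultiplier_iff.1 hi.2.2.1
  have hle : ∀ᶠ i in l, logSum (fun j => g (x i j) (θ i)) (t i) ≤
      logSum (fun j => g (x i j) (θs i)) (ts i) := by
    filter_upwards [hm, hcs, hts, (tendsto_of_scaled h.size h.param hbs) hΘ] with i h1 h2 h3 h4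
    have := h1.2.2.2 (θs i) h4 h2 (ts i) (isMultiplier_iff.2 h3)
    exact neg_le_neg_iff.1 this
  obtain ⟨R, hR⟩ := h.localize hl hs M
  have hbt : Bdd l fun i => √(N i) • (θ i - θn i) := by
    refine ⟨R, ?_⟩
    filter_upwards [hR, hU, hmult, hle, hM] with i h1 h2 h3 h4 h5
    exact h1 _ h2 _ h3 (h4.trans h5)
  have hexp := h.expandable hl hs hbt
  have hlog := hexp.tendsto_two_mul_logSum hmult
  have hphi := hexp.tendsto_phi hmult hφ
  have hscore := hexp.tendsto_score hmult
  have hτ := hexp.eventually_norm_scaled_le hmult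
  -- the standardised score
  have hDS : Tendsto (fun i => D (S (√(N i) • t i)) - b i) l (𝓝 0) := by
    have h1 := (D.continuous.tendsto 0).comp (h.tendsto_gbar hs hbt)
    have h2 := (D.continuous.tendsto 0).comp hscore
    have h3 := (L.continuous.tendsto 0).comp
      (tendsto_scaled_sub hs.strict h.param (tendsto_of_scaled h.size h.param hbt) hbt)
    rw [map_zero] at h1 h2 h3
    have h4 := (h1.sub h2).sub h3
    simp only [sub_zero] at h4
    refine h4.congr' ?_
    filter_upwards [hm, h.constraint, h.eventually_pos] with i hi1 hi2 hi3
    have hs0 : 0 < √(N i : ℝ) := Real.sqrt_pos.2 (by exact_mod_cast hi3)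
    have e1 : L (√(N i) • (c (θ i) - c (θn i))) = -L f := by
      rw [hi1.2.1, hi2, zero_sub, smul_neg, smul_smul, mul_inv_cancel₀ hs0.ne', one_smul, map_neg]
    have e2 : D (√(N i) • vmean fun j => g (x i j) (θ i)) = D (√(N i) • gbar g (x i) (θ i)) := rfl
    simp only [Function.comp_apply, map_sub D, map_sub L, hl.factor, e1, e2, hb]
    abel
  have hlow : Tendsto (fun i => ‖D (S (√(N i) • t i))‖ ^ 2 - ‖b i‖ ^ 2) l (𝓝 0) := by
    have hτb : Bdd l fun i => √(N i) • t i := hτ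
    refine (tendsto_inner_sub_inner hDS hDS ((hτb.clm S).clm D) hbb).congr fun i => ?_
    rw [real_inner_self_eq_norm_sq, real_inner_self_eq_norm_sq]
  have hquad : Tendsto (fun i => inner ℝ (S (√(N i) • t i)) (√(N i) • t i) - ‖b i‖ ^ 2) l
      (𝓝 0) := by
    have hup : Tendsto (fun i => 2 * logSum (fun j => g (x i j) (θs i)) (ts i) - ‖b i‖ ^ 2 -
        (2 * logSum (fun j => g (x i j) (θ i)) (t i) -
          inner ℝ (S (√(N i) • t i)) (√(N i) • t i))) l (𝓝 0) := by
      have := hlim.sub hlog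
      rwa [sub_zero] at this
    refine tendsto_of_tendsto_of_tendsto_of_le_of_le' hlow hup ?_ ?_
    · exact Eventually.of_forall fun i => sub_le_sub_right (hl.norm_sq_le _) _
    · filter_upwards [hle] with i hi
      linarith
  have := hphi.add hquad
  rw [add_zero] at this
  refine this.congr' ?_
  filter_upwards [h.eventually_pos] with i hi
  have hn : (N i : ℝ) ≠ 0 := by positivity
  have e : statistic φ g (x i) (θ i) (t i) = 2 / deriv (deriv φ) 1 *
      ∑ j, φ (1 + inner ℝ (t i) (g (x i j) (θ i))) / (1 + inner ℝ (t i) (g (x i j) (θ i))) := by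
    have hu : ∀ u : ℝ, (N i : ℝ)⁻¹ / ((N i : ℝ)⁻¹ * u⁻¹) = u := fun u => by
      rw [div_mul_eq_div_div, div_self (inv_ne_zero hn), one_div, inv_inv]
    simp only [statistic, phiDivergence, weight, tilt, hu]
    rw [mul_div_right_comm, mul_assoc, Finset.mul_sum]
    congr 1
    refine Finset.sum_congr rfl fun j _ => ?_
    rw [← mul_assoc, ← mul_assoc, mul_inv_cancel₀ hn, one_mul, inv_mul_eq_div]
  rw [e]
  ring

end Samples

end Asymptotics

/-! ### Existence of the restricted estimator. -/

section Existence

variable {𝒳 : Type*} {p q : ℕ} {g : 𝒳 → E p → E p} {c : E p → E q} {θ₀ : E p} {a : 𝒳 → ℝ}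
  {B δ κ : ℝ} {S G Ginv : E p →L[ℝ] E p} {C D : E p →L[ℝ] E q} {L : E q →L[ℝ] E q}
  {ι : Type*} {l : Filter ι} {N : ι → ℕ} {x : ∀ i, Fin (N i) → 𝒳} {θn : ι → E p} {f : E q}

/-- Compactness on pairs `(θ, t)`. The bound on `ρ ‖g‖` keeps all `1 + ⟪t, g⟫` at least `1 / 2`, so
the strict positivity in `IsMult` is automatic and the feasible set is closed. -/
theorem exists_min_logSum {n : ℕ} {x : Fin n → 𝒳} {K : Set (E p)} {ρ : ℝ} (hK : IsCompact K)
    (hg : ∀ j, ContinuousOn (g (x j)) K) (hc : ContinuousOn c K)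
    (hsmall : ∀ θ ∈ K, ∀ j, ρ * ‖g (x j) θ‖ ≤ 1 / 2)
    (hne : ∃ θ ∈ K, c θ = 0 ∧ ∃ t, ‖t‖ ≤ ρ ∧ IsMult (fun j => g (x j) θ) t) :
    ∃ θ ∈ K, c θ = 0 ∧ ∃ t, IsMult (fun j => g (x j) θ) t ∧
      ∀ θ' ∈ K, c θ' = 0 → ∀ t', ‖t'‖ ≤ ρ → IsMult (fun j => g (x j) θ') t' →
        logSum (fun j => g (x j) θ) t ≤ logSum (fun j => g (x j) θ') t' := by
  set P : Set (E p × E p) := K ×ˢ Metric.closedBall 0 ρ with hP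
  have hPc : IsCompact P := hK.prod (isCompact_closedBall _ _)
  have hin : ∀ j, ContinuousOn (fun z : E p × E p => inner ℝ z.2 (g (x j) z.1)) P := fun j =>
    continuousOn_snd.inner ((hg j).comp continuousOn_fst fun z hz => hz.1)
  have hgP : ∀ j, ContinuousOn (fun z : E p × E p => g (x j) z.1) P := fun j =>
    (hg j).comp continuousOn_fst fun z hz => hz.1
  have hpos : ∀ z ∈ P, ∀ j, 0 < 1 + inner ℝ z.2 (g (x j) z.1) := fun z hz j => by
    have h1 : |inner ℝ z.2 (g (x j) z.1)| ≤ 1 / 2 :=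
      (abs_real_inner_le_norm _ _).trans ((mul_le_mul_of_nonneg_right
        (mem_closedBall_zero_iff.1 hz.2) (norm_nonneg _)).trans (hsmall _ hz.1 j))
    linarith [(abs_le.1 h1).1]
  have hone : ∀ j, ContinuousOn (fun z : E p × E p => 1 + inner ℝ z.2 (g (x j) z.1)) P := fun j =>
    continuousOn_const.add (hin j)
  have hscore : ContinuousOn (fun z : E p × E p =>
      ∑ j, (1 + inner ℝ z.2 (g (x j) z.1))⁻¹ • g (x j) z.1) P :=
    continuousOn_finsetSum _ fun j _ =>
      ((hone j).inv₀ fun z hz => (hpos z hz j).ne').smul (hgP j)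
  have hcP : ContinuousOn (fun z : E p × E p => c z.1) P :=
    hc.comp continuousOn_fst fun z hz => hz.1
  have hlog : ContinuousOn (fun z : E p × E p => logSum (fun j => g (x j) z.1) z.2) P :=
    continuousOn_finsetSum _ fun j _ => (hone j).log fun z hz => (hpos z hz j).ne'
  obtain ⟨Z, hZ, hZc⟩ : ∃ Z : Set (E p × E p),
      (∀ z, z ∈ Z ↔ z ∈ P ∧ c z.1 = 0 ∧ IsMult (fun j => g (x j) z.1) z.2) ∧ IsCompact Z := by
    refine ⟨{z | z ∈ P ∧ c z.1 = 0 ∧ IsMult (fun j => g (x j) z.1) z.2}, fun z => Iff.rfl, ?_⟩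
    refine hPc.of_isClosed_subset ?_ fun z hz => hz.1
    have h1 := (hcP.prodMk hscore).preimage_isClosed_of_isClosed hPc.isClosed
      (isClosed_singleton (x := ((0, 0) : E q × E p)))
    convert h1 using 1
    ext z
    simp only [Set.mem_ofPred_eq, Set.mem_inter_iff, Set.mem_preimage, Set.mem_singleton_iff,
      Prod.mk.injEq, IsMult]
    exact ⟨fun h => ⟨h.1, h.2.1, h.2.2.2⟩, fun h => ⟨h.1, h.2.1, hpos z h.1, h.2.2⟩⟩
  have hmem : ∀ θ ∈ K, c θ = 0 → ∀ t, ‖t‖ ≤ ρ → IsMult (fun j => g (x j) θ) t → (θ, t) ∈ Z :=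
    fun θ hθ h0 t ht hm => (hZ _).2 ⟨⟨hθ, mem_closedBall_zero_iff.2 ht⟩, h0, hm⟩
  obtain ⟨θ₁, h1, h2, t₁, h3, h4⟩ := hne
  obtain ⟨⟨θ, t⟩, hz, hmin⟩ := hZc.exists_isMinOn ⟨_, hmem θ₁ h1 h2 t₁ h3 h4⟩
    (hlog.mono fun z hz => ((hZ z).1 hz).1)
  obtain ⟨hz1, hz2, hz3⟩ := (hZ _).1 hz
  refine ⟨θ, hz1.1, hz2, t, hz3, fun θ' h1' h2' t' h3' h4' => ?_⟩
  exact isMinOn_iff.1 hmin (θ', t') (hmem θ' h1' h2' t' h3' h4')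

namespace Samples

/-- `Θ` need not be closed, so `logSum` is minimised over a ball of radius `R / √n` about `θn`,
which eventually lies in `Θ`. Outside it `logSum` exceeds `M`, hence the value at the candidate. -/
theorem eventually_exists_restrictedMELE (h : Samples l g c θ₀ a B S G N x θn f)
    (hl : Limits S G Ginv C D L κ) (hs : LocalSetup g c θ₀ a B δ κ C) {Θ : Set (E p)}
    (hΘ : Θ ∈ 𝓝 θ₀) (hsub : Θ ⊆ Metric.closedBall θ₀ δ) :
    ∀ᶠ i in l, ∃ θ t, IsRestrictedMELE g c Θ (x i) θ t := by
  have hB := zero_le_one.trans hs.one_le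
  obtain ⟨θs, ts, hcs, hbs, hts, hlim⟩ := h.exists_candidate_logSum hl hs
  obtain ⟨M, hM⟩ := exists_logSum_le (h.bdd_standardised D (L f)) hlim
  obtain ⟨R, hR⟩ := h.localize hl hs M
  obtain ⟨r, hr, hrΘ⟩ := Metric.mem_nhds_iff.1 hΘ
  -- Half the reciprocal of the bound on `max ‖g‖` from `norm_le_of_sum_cube_le`. It is of larger
  -- order than `n^{-1/2}`, so it eventually exceeds the multipliers in the small ball.
  set ρ : ι → ℝ := fun i => (2 * (√(N i) * (B / √(N i)) ^ (1 / 3 : ℝ)))⁻¹ with hρ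
  -- multipliers at points of the localised ball are small
  have hsmall : ∀ᶠ i in l, ∀ z : E p × E p, ‖√(N i) • (z.1 - θn i)‖ ≤ R ∧
      IsMult (fun j => g (x i j) z.1) z.2 → ‖z.2‖ ≤ ρ i := by
    have hstart : ∀ᶠ i in l, ‖√(N i) • (θs i - θn i)‖ ≤ R ∧
        IsMult (fun j => g (x i j) (θs i)) (ts i) := by
      filter_upwards [hR, hM, hts, (tendsto_of_scaled h.size h.param hbs)
        (Metric.closedBall_mem_nhds θ₀ hs.env.pos)] with i h1 h2 h3 h4 using
          ⟨h1 _ h4 _ h3 h2, h3⟩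
    refine eventually_forall_of_seq (fun i => (θs i, ts i)) hstart fun z hz => ?_
    have hexp := h.expandable hl hs (θ := fun i => (z i).1) ⟨R, hz.mono fun i hi => hi.1⟩
    obtain ⟨R', hR'⟩ := hexp.eventually_norm_scaled_le (hz.mono fun i hi => hi.2)
    have hlim0 : Tendsto (fun i => 2 * (B / √(N i)) ^ (1 / 3 : ℝ) * |R'|) l (𝓝 0) := by
      simpa using ((tendsto_rpow_div_sqrt h.size B).const_mul 2).mul_const |R'|
    filter_upwards [hR', h.eventually_pos, hlim0.eventually_le_const zero_lt_one]
      with i h1 hn h2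
    have hs0 : 0 < √(N i : ℝ) := Real.sqrt_pos.2 (by exact_mod_cast hn)
    have hB0 : 0 < (B / √(N i)) ^ (1 / 3 : ℝ) :=
      Real.rpow_pos_of_pos (div_pos (zero_lt_one.trans_le hs.one_le) hs0) _
    rw [norm_smul, Real.norm_of_nonneg hs0.le] at h1
    have hρi : ρ i = (2 * (√(N i) * (B / √(N i)) ^ (1 / 3 : ℝ)))⁻¹ := rfl
    rw [hρi, ← one_div, le_div_iff₀ (by positivity)]
    calc ‖(z i).2‖ * (2 * (√(N i) * (B / √(N i)) ^ (1 / 3 : ℝ))) =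
          2 * (B / √(N i)) ^ (1 / 3 : ℝ) * (√(N i) * ‖(z i).2‖) := by ring
      _ ≤ 2 * (B / √(N i)) ^ (1 / 3 : ℝ) * |R'| := by gcongr; exact h1.trans (le_abs_self _)
      _ ≤ 1 := h2
  have hrad : Tendsto (fun i => ‖θn i - θ₀‖ + (√(N i))⁻¹ * R) l (𝓝 0) := by
    simpa using (tendsto_iff_norm_sub_tendsto_zero.1 h.param).add
      ((tendsto_sqrt_size h.size).inv_tendsto_atTop.mul_const R)
  filter_upwards [hR, hM, hts, hcs, hsmall, h.eventually_pos, h.cube,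
    hrad.eventually_lt_const (lt_min hr hs.env.pos),
    (tendsto_of_scaled h.size h.param hbs) hΘ] with i h1 h2 h3 h4 h5 hn h6 h7 h8
  have hs0 : 0 < √(N i : ℝ) := Real.sqrt_pos.2 (by exact_mod_cast hn)
  have hB0 : 0 < (B / √(N i)) ^ (1 / 3 : ℝ) :=
    Real.rpow_pos_of_pos (div_pos (zero_lt_one.trans_le hs.one_le) hs0) _
  set K := Metric.closedBall (θn i) ((√(N i))⁻¹ * R) with hK
  have hKmem : ∀ θ, θ ∈ K ↔ ‖√(N i) • (θ - θn i)‖ ≤ R := fun θ => by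
    rw [hK, mem_closedBall_iff_norm, norm_smul, Real.norm_of_nonneg hs0.le, inv_mul_eq_div,
      le_div_iff₀' hs0]
  have hKball : ∀ θ ∈ K, ‖θ - θ₀‖ < min r δ := fun θ hθ =>
    (norm_sub_le_norm_sub_add_norm_sub θ (θn i) θ₀).trans_lt (by
      rw [add_comm]
      exact (add_le_add_right (mem_closedBall_iff_norm.1 hθ) _).trans_lt h7)
  have hKδ : K ⊆ Metric.closedBall θ₀ δ := fun θ hθ =>
    mem_closedBall_iff_norm.2 ((hKball θ hθ).trans_le (min_le_right _ _)).le
  have hKΘ : K ⊆ Θ := fun θ hθ => hrΘ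
    (mem_ball_iff_norm.2 ((hKball θ hθ).trans_le (min_le_left _ _)))
  have hsK : θs i ∈ K := (hKmem _).2 (h1 _ (hsub h8) _ h3 h2)
  obtain ⟨θ, hθ, hcθ, t, ht, hmin⟩ := exists_min_logSum (g := g) (c := c) (x := x i) (ρ := ρ i)
    (isCompact_closedBall (θn i) ((√(N i))⁻¹ * R))
    (fun j θ hθ => (hs.env.diff (x i j) θ (hKδ hθ)).continuousAt.continuousWithinAt)
    (hs.cont.mono hKδ)
    (fun θ hθ j => by
      have := norm_le_of_sum_cube_le hB (hs.env.sum_cube_le h6 (hKδ hθ)) j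
      have hρi : ρ i = (2 * (√(N i) * (B / √(N i)) ^ (1 / 3 : ℝ)))⁻¹ := rfl
      rw [hρi, inv_mul_eq_div, div_le_iff₀ (by positivity)]
      linarith)
    ⟨θs i, hsK, h4, ts i, h5 (θs i, ts i) ⟨(hKmem _).1 hsK, h3⟩, h3⟩
  have hbest := hmin (θs i) hsK h4 (ts i) (h5 (θs i, ts i) ⟨(hKmem _).1 hsK, h3⟩) h3
  refine ⟨θ, t, hKΘ hθ, hcθ, isMultiplier_iff.2 ht, fun θ' hθ' hc' t' ht' => ?_⟩
  have ht'' := isMultiplier_iff.1 ht'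
  refine neg_le_neg (a := logSum (fun j => g (x i j) θ) t)
    (b := logSum (fun j => g (x i j) θ') t') ?_
  rcases le_or_gt (logSum (fun j => g (x i j) θ') t') M with hle | hgt
  · have hK' := h1 θ' (hsub hθ') t' ht'' hle
    exact hmin θ' ((hKmem _).2 hK') hc' t' (h5 (θ', t') ⟨hK', ht''⟩) ht''
  · exact hbest.trans (h2.trans hgt.le)

end Samples

end Existence

/-! ### The limiting operators from matrices. -/

section LinearAlgebra

variable {m n k : ℕ}

/-- The operator of a matrix on Euclidean spaces. -/
noncomputable def op (A : Matrix (Fin m) (Fin n) ℝ) : E n →L[ℝ] E m :=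
  (Matrix.toEuclideanLin A).toContinuousLinearMap

theorem ofLp_op (A : Matrix (Fin m) (Fin n) ℝ) (v : E n) : (op A v).ofLp = A *ᵥ v.ofLp := by
  simp [op]

theorem op_mul_apply (A : Matrix (Fin m) (Fin n) ℝ) (B : Matrix (Fin n) (Fin k) ℝ) (v : E k) :
    op (A * B) v = op A (op B v) :=
  WithLp.ofLp_injective _ (by simp only [ofLp_op, Matrix.mulVec_mulVec])

theorem op_one_apply (v : E n) : op (1 : Matrix (Fin n) (Fin n) ℝ) v = v :=
  WithLp.ofLp_injective _ (by simp only [ofLp_op, Matrix.one_mulVec])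

theorem inner_op (A : Matrix (Fin m) (Fin n) ℝ) (v : E n) (w : E m) :
    inner ℝ (op A v) w = inner ℝ v (op Aᵀ w) := by
  simp only [EuclideanSpace.inner_eq_star_dotProduct, ofLp_op, star_trivial]
  rw [Matrix.dotProduct_mulVec, ← Matrix.mulVec_transpose, dotProduct_comm]

theorem adjoint_op (A : Matrix (Fin m) (Fin n) ℝ) (w : E m) : (op A).adjoint w = op Aᵀ w := by
  refine ext_inner_left ℝ fun v => ?_
  rw [ContinuousLinearMap.adjoint_inner_right, inner_op]

/-- The matrix of an operator on Euclidean spaces. -/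
noncomputable def mat (T : E n →L[ℝ] E m) : Matrix (Fin m) (Fin n) ℝ :=
  Matrix.of fun j l => T (EuclideanSpace.single l 1) j

theorem op_mat (T : E n →L[ℝ] E m) : op (mat T) = T := by
  refine ContinuousLinearMap.coe_injective
    ((EuclideanSpace.basisFun (Fin n) ℝ).toBasis.ext fun l => ?_)
  refine WithLp.ofLp_injective _ ?_
  ext j
  simp [ofLp_op, mat]

theorem exists_lower_bound {A : Matrix (Fin n) (Fin n) ℝ} (hA : IsUnit A.det) :
    ∃ κ > 0, ∀ v, κ * ‖v‖ ≤ ‖op A v‖ := by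
  refine ⟨(‖op A⁻¹‖ + 1)⁻¹, by positivity, fun v => ?_⟩
  rw [inv_mul_le_iff₀ (by positivity)]
  have : v = op A⁻¹ (op A v) := by rw [← op_mul_apply, Matrix.nonsing_inv_mul _ hA, op_one_apply]
  calc ‖v‖ = ‖op A⁻¹ (op A v)‖ := by rw [← this]
    _ ≤ ‖op A⁻¹‖ * ‖op A v‖ := ContinuousLinearMap.le_opNorm _ _
    _ ≤ (‖op A⁻¹‖ + 1) * ‖op A v‖ := by gcongr; linarith

open scoped MatrixOrder Matrix.Norms.L2Operator in
theorem _root_.Matrix.PosDef.exists_eq_transpose_mul_self {A : Matrix (Fin n) (Fin n) ℝ}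
    (hA : A.PosDef) : ∃ M : Matrix (Fin n) (Fin n) ℝ, A = Mᵀ * M ∧ IsUnit M.det := by
  obtain ⟨M, hM⟩ := CStarAlgebra.nonneg_iff_eq_star_mul_self.mp hA.posSemidef.nonneg
  have hM' : A = Mᵀ * M := by
    rw [hM, Matrix.star_eq_conjTranspose, Matrix.conjTranspose_eq_transpose_of_trivial]
  refine ⟨M, hM', ?_⟩
  have hd := hA.det_pos
  rw [hM', Matrix.det_mul, Matrix.det_transpose] at hd
  exact isUnit_iff_ne_zero.2 fun h => by simp [h] at hd

theorem mulVec_surjective_of_rank {A : Matrix (Fin m) (Fin n) ℝ} (hA : A.rank = m) :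
    Function.Surjective A.mulVec := by
  have : A.mulVecLin.range = ⊤ :=
    Submodule.eq_top_of_finrank_eq (by rw [Module.finrank_fin_fun]; exact hA)
  exact LinearMap.range_eq_top.1 this

theorem isUnit_det_of_rank {A : Matrix (Fin n) (Fin n) ℝ} (hA : A.rank = n) : IsUnit A.det := by
  rw [← Matrix.isUnit_iff_isUnit_det]
  exact Matrix.mulVec_surjective_iff_isUnit.1 (mulVec_surjective_of_rank hA)

theorem vecMul_injective_of_rank {A : Matrix (Fin m) (Fin n) ℝ} (hA : A.rank = m) :
    Function.Injective A.vecMul := by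
  intro v w hvw
  refine dotProduct_eq v w fun u => ?_
  obtain ⟨u, rfl⟩ := mulVec_surjective_of_rank hA u
  simp only at hvw
  rw [Matrix.dotProduct_mulVec, Matrix.dotProduct_mulVec, hvw]

/-- Since `G` is invertible, `V = G⁻¹ S G⁻ᵀ` and `P = C V Cᵀ = A S Aᵀ` with `A = C G⁻¹` of full row
rank, so `P` is positive definite. Factoring `P⁻¹ = MᵀM` gives `D = M A` and `L = M`: then `D S Dᵀ =
M P Mᵀ = 1`, `D G = M C`, and `‖M f‖² = fᵀ P⁻¹ f`. -/
theorem exists_limits {p q : ℕ} {S G : Matrix (Fin p) (Fin p) ℝ} {C : Matrix (Fin q) (Fin p) ℝ}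
    (hS : S.PosDef) (hG : G.rank = p) (hC : C.rank = q) :
    ∃ (Ginv : E p →L[ℝ] E p) (D : E p →L[ℝ] E q) (L : E q →L[ℝ] E q) (κ : ℝ),
      Limits (op S) (op G) Ginv (op C) D L κ ∧
      ∀ f, ‖L f‖ ^ 2 = f.ofLp ⬝ᵥ ((C * (Gᵀ * S⁻¹ * G)⁻¹ * Cᵀ)⁻¹ *ᵥ f.ofLp) := by
  have hGu := isUnit_det_of_rank hG
  obtain ⟨R, hR, hRu⟩ := hS.exists_eq_transpose_mul_self
  obtain ⟨κ₁, hκ₁, hlow₁⟩ := exists_lower_bound hRu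
  obtain ⟨κ₂, hκ₂, hlow₂⟩ := exists_lower_bound hGu
  have hSu : IsUnit S.det := hS.det_pos.ne'.isUnit
  have hST : Sᵀ = S := by rw [hR]; simp
  have hV : (Gᵀ * S⁻¹ * G)⁻¹ = G⁻¹ * S * (G⁻¹)ᵀ := by
    rw [Matrix.mul_inv_rev, Matrix.mul_inv_rev, Matrix.nonsing_inv_nonsing_inv _ hSu,
      Matrix.transpose_nonsing_inv, Matrix.mul_assoc]
  set P := C * (Gᵀ * S⁻¹ * G)⁻¹ * Cᵀ with hP
  have hPeq : P = (C * G⁻¹) * S * (C * G⁻¹)ᵀ := by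
    rw [hP, hV, Matrix.transpose_mul]
    simp only [Matrix.mul_assoc]
  have hAinj : Function.Injective (C * G⁻¹).vecMul := by
    refine vecMul_injective_of_rank ?_
    rw [Matrix.rank_mul_eq_left_of_isUnit_det _ _ (by
      rw [Matrix.det_nonsing_inv]; exact hGu.ringInverse), hC]
  have hPpos : P.PosDef := by
    rw [hPeq, ← Matrix.conjTranspose_eq_transpose_of_trivial]
    exact hS.mul_mul_conjTranspose_same hAinj
  obtain ⟨M, hM, hMu⟩ := hPpos.inv.exists_eq_transpose_mul_self
  have hMPM : M * P * Mᵀ = 1 := by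
    rw [mul_eq_one_comm, ← Matrix.mul_assoc, ← hM,
      Matrix.nonsing_inv_mul _ hPpos.det_pos.ne'.isUnit]
  refine ⟨op G⁻¹, op (M * C * G⁻¹), op M, κ₂, ⟨⟨κ₁ ^ 2, by positivity, fun u => ?_⟩, fun u w => ?_,
    hκ₂, hlow₂, fun y => ?_, fun y => ?_, fun b => ?_, fun v => ?_, fun v w hvw => ?_⟩,
    fun f => ?_⟩
  · have : inner ℝ (op S u) u = ‖op R u‖ ^ 2 := by
      rw [hR, op_mul_apply, inner_op, Matrix.transpose_transpose, real_inner_self_eq_norm_sq]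
    rw [this, ← mul_pow]
    exact pow_le_pow_left₀ (by positivity) (hlow₁ u) 2
  · rw [inner_op, hST]
  · rw [← op_mul_apply, Matrix.mul_nonsing_inv _ hGu, op_one_apply]
  · obtain ⟨v, hv⟩ := mulVec_surjective_of_rank hC y.ofLp
    exact ⟨WithLp.toLp 2 v, WithLp.ofLp_injective _ (by rw [ofLp_op]; exact hv)⟩
  · rw [adjoint_op, ← op_mul_apply, ← op_mul_apply]
    have : M * C * G⁻¹ * S * (M * C * G⁻¹)ᵀ = 1 := by
      rw [← hMPM, hPeq]
      simp only [Matrix.transpose_mul, Matrix.mul_assoc]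
    rw [this, op_one_apply]
  · rw [← op_mul_apply, ← op_mul_apply, Matrix.mul_assoc, Matrix.nonsing_inv_mul _ hGu,
      Matrix.mul_one]
  · have := congrArg (op M⁻¹) hvw
    rwa [← op_mul_apply, ← op_mul_apply, Matrix.nonsing_inv_mul _ hMu, op_one_apply,
      op_one_apply] at this
  · rw [hM, ← ofLp_op, op_mul_apply, ← real_inner_self_eq_norm_sq, inner_op,
      EuclideanSpace.inner_eq_star_dotProduct, star_trivial, dotProduct_comm]

end LinearAlgebra

/-! ### Events of probability tending to one as a filter. -/

section Whp

variable {Ω : ℕ → Type*} [∀ n, MeasurableSpace (Ω n)]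

/-- The filter of the events whose probability tends to one under the laws `P n`. -/
def whp (P : ∀ n, Measure (Ω n)) : Filter (Σ n, Ω n) where
  sets := {A | Tendsto (fun n => P n {x | (⟨n, x⟩ : Σ n, Ω n) ∉ A}) atTop (𝓝 0)}
  univ_sets := by simp
  sets_of_superset {A A'} hA hsub := by
    refine tendsto_of_tendsto_of_tendsto_of_le_of_le tendsto_const_nhds hA
      (fun _ => zero_le) fun n => measure_mono fun x hx => ?_
    exact fun h => hx (hsub h)
  inter_sets {A A'} hA hA' := by
    have hsum := Tendsto.add hA hA'
    rw [add_zero] at hsum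
    refine tendsto_of_tendsto_of_tendsto_of_le_of_le tendsto_const_nhds hsum
      (fun _ => zero_le) fun n => (measure_mono fun x hx => ?_).trans (measure_union_le _ _)
    simp only [Set.mem_ofPred_eq, Set.mem_inter_iff, not_and_or] at hx
    exact hx

variable {P R : ∀ n, Measure (Ω n)}

theorem eventually_whp {Q : (Σ n, Ω n) → Prop} :
    (∀ᶠ i in whp P, Q i) ↔ Tendsto (fun n => P n {x | ¬ Q ⟨n, x⟩}) atTop (𝓝 0) :=
  Iff.rfl

theorem tendsto_fst_whp : Tendsto Sigma.fst (whp P) atTop := by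
  refine tendsto_atTop.2 fun m => eventually_whp.2 ?_
  refine tendsto_const_nhds.congr' ?_
  filter_upwards [eventually_ge_atTop m] with n hn
  simp [hn]

/-- `whp` also contains nonmeasurable events, whereas contiguity speaks of measurable ones;
measurable hulls bridge the two. -/
theorem Contiguous.whp_le (h : Contiguous P R) : whp P ≤ whp R := by
  intro A hA
  have h1 := h (fun n => toMeasurable (R n) {x | (⟨n, x⟩ : Σ n, Ω n) ∉ A})
    (fun n => measurableSet_toMeasurable _ _)
    (by simp only [measure_toMeasurable]; exact hA)
  exact tendsto_of_tendsto_of_tendsto_of_le_of_le tendsto_const_nhds h1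
    (fun _ => zero_le) fun n => measure_mono (subset_toMeasurable _ _)

/-- Convergence with probability tending to one may be checked on the events on which a tight
sequence of random vectors is bounded. -/
theorem tendsto_whp_of_tight {H : Type*} [NormedAddCommGroup H] {W : (Σ n, Ω n) → H}
    (hW : ∀ ε > 0, ∃ M : ℝ, ∀ n, P n {x | M < ‖W ⟨n, x⟩‖} ≤ ε) {F : Filter (Σ n, Ω n)}
    (h : ∀ M : ℝ, whp P ⊓ 𝓟 {i | ‖W i‖ ≤ M} ≤ F) : whp P ≤ F := by
  intro A hA
  refine ENNReal.tendsto_nhds_zero.2 fun ε hε => ?_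
  obtain ⟨M, hM⟩ := hW (ε / 2) (ENNReal.half_pos hε.ne')
  have h1 := h M hA
  rw [mem_inf_principal] at h1
  have h2 := ENNReal.tendsto_nhds_zero.1 h1 (ε / 2) (ENNReal.half_pos hε.ne')
  filter_upwards [h2] with n hn
  calc P n {x | (⟨n, x⟩ : Σ n, Ω n) ∉ A}
      ≤ P n ({x | ¬ (‖W ⟨n, x⟩‖ ≤ M → (⟨n, x⟩ : Σ n, Ω n) ∈ A)} ∪ {x | M < ‖W ⟨n, x⟩‖}) := by
        refine measure_mono fun x hx => ?_
        by_cases hle : ‖W ⟨n, x⟩‖ ≤ M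
        · exact Or.inl fun himp => hx (himp hle)
        · exact Or.inr (not_le.1 hle)
    _ ≤ ε / 2 + ε / 2 := (measure_union_le _ _).trans (add_le_add hn (hM n))
    _ = ε := ENNReal.add_halves ε

/-- Bounded convergence in probability on varying spaces, used for Laplace transforms and
characteristic functions. -/
theorem tendsto_integral_whp [∀ n, IsProbabilityMeasure (P n)] {K : Type*} [NormedAddCommGroup K]
    [NormedSpace ℝ K] [CompleteSpace K] {f : (Σ n, Ω n) → K} {y : K} {b : ℝ}
    (hm : ∀ n, AEStronglyMeasurable (fun x => f ⟨n, x⟩) (P n)) (hb : ∀ i, ‖f i‖ ≤ b)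
    (h : Tendsto f (whp P) (𝓝 y)) :
    Tendsto (fun n => ∫ x, f ⟨n, x⟩ ∂(P n)) atTop (𝓝 y) := by
  rw [Metric.tendsto_atTop']
  intro ε hε
  have h1 : ∀ᶠ i in whp P, ‖f i - y‖ < ε / 2 := by
    simpa [dist_eq_norm] using Metric.tendsto_nhds.1 h (ε / 2) (half_pos hε)
  set c := |b| + ‖y‖ + 1 with hc
  have hc0 : 0 < c := by positivity
  have h2 := (ENNReal.tendsto_toReal ENNReal.zero_ne_top).comp (eventually_whp.1 h1)
  have h3 : ∀ᶠ n in atTop, (P n).real {x | ¬ ‖f ⟨n, x⟩ - y‖ < ε / 2} < ε / (2 * c) :=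
    h2.eventually_lt_const (by simp; positivity)
  obtain ⟨n₀, hn₀⟩ := eventually_atTop.1 h3
  refine ⟨n₀, fun n hn => ?_⟩
  have hint : Integrable (fun x => f ⟨n, x⟩) (P n) :=
    Integrable.of_bound (hm n) b (ae_of_all _ fun x => hb _)
  have hd : Integrable (fun x => ‖f ⟨n, x⟩ - y‖) (P n) := (hint.sub (integrable_const y)).norm
  have hmeas : NullMeasurableSet {x | ¬ ‖f ⟨n, x⟩ - y‖ < ε / 2} (P n) :=
    (nullMeasurableSet_lt hd.1.aemeasurable aemeasurable_const).compl
  have hind : Integrable ({x | ¬ ‖f ⟨n, x⟩ - y‖ < ε / 2}.indicator fun _ => c) (P n) :=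
    (integrable_const c).indicator₀ hmeas
  rw [dist_eq_norm]
  have e : ∫ x, f ⟨n, x⟩ ∂(P n) - y = ∫ x, (f ⟨n, x⟩ - y) ∂(P n) := by
    rw [integral_sub hint (integrable_const y)]; simp
  rw [e]
  calc ‖∫ x, (f ⟨n, x⟩ - y) ∂(P n)‖ ≤ ∫ x, ‖f ⟨n, x⟩ - y‖ ∂(P n) := norm_integral_le_integral_norm _
    _ ≤ ∫ x, (ε / 2 + {x | ¬ ‖f ⟨n, x⟩ - y‖ < ε / 2}.indicator (fun _ => c) x) ∂(P n) := by
        refine integral_mono hd ((integrable_const _).add hind) fun x => ?_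
        by_cases hx : ‖f ⟨n, x⟩ - y‖ < ε / 2
        · have : x ∉ {x | ¬ ‖f ⟨n, x⟩ - y‖ < ε / 2} := fun h => h hx
          simp only [Set.indicator_of_notMem this, add_zero]
          exact hx.le
        · have : x ∈ {x | ¬ ‖f ⟨n, x⟩ - y‖ < ε / 2} := hx
          simp only [Set.indicator_of_mem this]
          have := (norm_sub_le (f ⟨n, x⟩) y).trans (add_le_add_left (hb ⟨n, x⟩) _)
          linarith [le_abs_self b]
    _ = ε / 2 + (P n).real {x | ¬ ‖f ⟨n, x⟩ - y‖ < ε / 2} * c := by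
        rw [integral_add (integrable_const _) hind, integral_indicator₀ hmeas]
        simp
    _ < ε / 2 + ε / (2 * c) * c := by
        have := hn₀ n (le_of_lt hn)
        gcongr
    _ = ε := by field_simp; ring

end Whp

/-! ### The law of large numbers along `whp`. -/

section LawOfLargeNumbers

variable {𝒳 : Type*} [MeasurableSpace 𝒳]

theorem map_infinitePi_fin (F : Measure 𝒳) [IsProbabilityMeasure F] (n : ℕ) :
    (Measure.infinitePi fun _ : ℕ => F).map (fun ω (j : Fin n) => ω j) = sampleLaw F n := by
  have h : iIndepFun (fun (j : Fin n) (ω : ℕ → 𝒳) => ω j) (Measure.infinitePi fun _ : ℕ => F) :=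
    (iIndepFun_infinitePi (P := fun _ : ℕ => F) (X := fun _ => id)
    fun _ => measurable_id).precomp (g := fun j : Fin n => (j : ℕ)) Fin.val_injective
  rw [iIndepFun_iff_map_fun_eq_pi_map fun j => (measurable_pi_apply _).aemeasurable] at h
  refine h.trans ?_
  congr 1
  ext1 j
  exact Measure.infinitePi_map_eval (fun _ : ℕ => F) (j : ℕ)

/-- All samples are realised as initial segments of one infinite product; the strong law there gives
convergence in measure, which depends only on the laws of the segments. -/
theorem tendsto_avg_whp (F : Measure 𝒳) [IsProbabilityMeasure F] {K : Type*}
    [NormedAddCommGroup K] [NormedSpace ℝ K] [CompleteSpace K] [MeasurableSpace K] [BorelSpace K]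
    {f : 𝒳 → K} (hf : Integrable f F) :
    Tendsto (fun i : Σ n, Fin n → 𝒳 => (i.1 : ℝ)⁻¹ • ∑ j, f (i.2 j)) (whp (sampleLaw F))
      (𝓝 (∫ x, f x ∂F)) := by
  set μ := Measure.infinitePi fun _ : ℕ => F with hμ
  have heval : ∀ k, MeasurePreserving (fun ω : ℕ → 𝒳 => ω k) μ F := fun k =>
    measurePreserving_eval_infinitePi (fun _ : ℕ => F) k
  set X : ℕ → (ℕ → 𝒳) → K := fun k ω => f (ω k) with hX
  have hXm : ∀ k, AEStronglyMeasurable (X k) μ := fun k => hf.1.comp_measurePreserving (heval k)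
  have hint : Integrable (X 0) μ := (heval 0).integrable_comp_of_integrable hf
  have hmean : ∫ ω, X 0 ω ∂μ = ∫ x, f x ∂F := by
    rw [← (heval 0).map_eq, integral_map (heval 0).measurable.aemeasurable
      ((heval 0).map_eq.symm ▸ hf.1)]
  have hident : ∀ k, IdentDistrib (X k) (X 0) μ μ := fun k => by
    refine ⟨(hXm k).aemeasurable, (hXm 0).aemeasurable, ?_⟩
    have hmap : ∀ k, μ.map (X k) = F.map f := fun k => by
      have h := AEMeasurable.map_map_of_aemeasurable (μ := μ) (f := fun ω : ℕ → 𝒳 => ω k) (g := f)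
        ((heval k).map_eq.symm ▸ hf.1.aemeasurable) (heval k).measurable.aemeasurable
      rw [(heval k).map_eq] at h
      exact h.symm
    rw [hmap, hmap]
  have hind0 : iIndepFun (fun k (ω : ℕ → 𝒳) => ω k) μ :=
    iIndepFun_infinitePi (P := fun _ : ℕ => F) (X := fun _ => id) fun _ => measurable_id
  have hindep : Pairwise (Function.onFun (fun Y Z => IndepFun Y Z μ) X) := fun k k' hk => by
    refine (hind0.indepFun hk).comp₀ (heval k).measurable.aemeasurable
      (heval k').measurable.aemeasurable ?_ ?_
    · rw [(heval k).map_eq]; exact hf.1.aemeasurable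
    · rw [(heval k').map_eq]; exact hf.1.aemeasurable
  have havg : ∀ n : ℕ, AEStronglyMeasurable
      (fun ω => (n : ℝ)⁻¹ • (∑ k ∈ Finset.range n, X k ω)) μ := fun n =>
    AEStronglyMeasurable.const_smul (Finset.aestronglyMeasurable_fun_sum _ fun k _ => hXm k) _
  have hlim := tendstoInMeasure_of_tendsto_ae havg (strong_law_ae X hint hindep hident)
  rw [tendstoInMeasure_iff_norm, hmean] at hlim
  rw [Metric.tendsto_nhds]
  intro ε hε
  refine eventually_whp.2 ((hlim ε hε).congr fun n => ?_)
  have hpre : MeasurePreserving (fun (ω : ℕ → 𝒳) (j : Fin n) => ω j) μ (sampleLaw F n) :=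
    ⟨by fun_prop, map_infinitePi_fin F n⟩
  have hev : ∀ j : Fin n, MeasurePreserving (fun x : Fin n → 𝒳 => x j) (sampleLaw F n) F :=
    fun j => measurePreserving_eval (fun _ : Fin n => F) j
  have hm : AEStronglyMeasurable (fun x : Fin n → 𝒳 => (n : ℝ)⁻¹ • ∑ j, f (x j))
      (sampleLaw F n) := AEStronglyMeasurable.const_smul
    (Finset.aestronglyMeasurable_fun_sum _ fun j _ => hf.1.comp_measurePreserving (hev j)) _
  have hnull : NullMeasurableSet
      {x : Fin n → 𝒳 | ¬ dist ((n : ℝ)⁻¹ • ∑ j, f (x j)) (∫ x, f x ∂F) < ε} (sampleLaw F n) :=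
    (nullMeasurableSet_lt (hm.dist aestronglyMeasurable_const).aemeasurable
      aemeasurable_const).compl
  rw [← hpre.measure_preimage hnull]
  congr 1
  ext ω
  simp only [Set.mem_ofPred_eq, Set.mem_preimage, not_lt, dist_eq_norm, hX,
    Finset.sum_range (fun k => f (ω k))]

end LawOfLargeNumbers

/-! ### A central limit theorem for triangular arrays with bounded third moments. -/

section CentralLimit

theorem norm_pow_sub_pow_le {w z : ℂ} (hw : ‖w‖ ≤ 1) (hz : ‖z‖ ≤ 1) (n : ℕ) :
    ‖w ^ n - z ^ n‖ ≤ n * ‖w - z‖ := by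
  induction n with
  | zero => simp
  | succ n ih =>
    have e : w ^ (n + 1) - z ^ (n + 1) = w ^ n * (w - z) + (w ^ n - z ^ n) * z := by ring
    rw [e]
    refine (norm_add_le _ _).trans ?_
    rw [norm_mul, norm_mul, norm_pow]
    have h1 : ‖w‖ ^ n * ‖w - z‖ ≤ 1 * ‖w - z‖ := by
      gcongr; exact pow_le_one₀ (norm_nonneg _) hw
    have h2 : ‖w ^ n - z ^ n‖ * ‖z‖ ≤ n * ‖w - z‖ * 1 := by gcongr
    push_cast
    linarith

theorem abs_exp_neg_sq_sub_le (u : ℝ) : |Real.exp (-u ^ 2) - (1 - u ^ 2)| ≤ |u| ^ 3 := by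
  have h1 := Real.add_one_le_exp (-u ^ 2)
  rw [abs_of_nonneg (by linarith)]
  rcases le_or_gt |u| 1 with hu | hu
  · have hu2 : |-u ^ 2| ≤ 1 := by
      rw [abs_neg, abs_of_nonneg (sq_nonneg u), ← sq_abs]; exact pow_le_one₀ (abs_nonneg _) hu
    have h2 := Real.exp_bound hu2 (n := 2) (by norm_num)
    have h3 := (abs_le.1 h2).2
    simp only [Finset.sum_range_succ, Finset.range_zero, Finset.sum_empty, pow_zero,
      Nat.factorial, abs_neg, abs_of_nonneg (sq_nonneg u)] at h3
    norm_num at h3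
    have h4 : (u ^ 2) ^ 2 ≤ |u| ^ 3 := by
      have : (u ^ 2) ^ 2 = |u| ^ 4 := by rw [← sq_abs u]; ring
      rw [this]
      exact pow_le_pow_of_le_one (abs_nonneg _) hu (by norm_num)
    have h5 : 0 ≤ (u ^ 2) ^ 2 := by positivity
    linarith
  · have h2 : Real.exp (-u ^ 2) ≤ 1 := Real.exp_le_one_iff.2 (by nlinarith [sq_nonneg u])
    have h3 : u ^ 2 ≤ |u| ^ 3 := by
      rw [← sq_abs]; exact pow_le_pow_right₀ hu.le (by norm_num)
    linarith

theorem norm_exp_mul_I_sub_le (u : ℝ) :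
    ‖Complex.exp (u * Complex.I) - (1 + u * Complex.I - (u ^ 2 / 2 : ℝ))‖ ≤ 4 * |u| ^ 3 := by
  have hn : ‖(u : ℂ) * Complex.I‖ = |u| := by simp
  rcases le_or_gt |u| 1 with hu | hu
  · have h := Complex.exp_bound (x := u * Complex.I) (by rw [hn]; exact hu) (n := 3) (by norm_num)
    have e : ∑ m ∈ Finset.range 3, ((u : ℂ) * Complex.I) ^ m / (m.factorial : ℂ) =
        1 + u * Complex.I - (u ^ 2 / 2 : ℝ) := by
      simp [Finset.sum_range_succ, Nat.factorial, mul_pow, Complex.I_sq]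
      ring
    rw [e, hn] at h
    refine h.trans ?_
    rw [mul_comm]
    gcongr
    norm_num [Nat.factorial]
  · have h1 : ‖Complex.exp (u * Complex.I)‖ = 1 := Complex.norm_exp_ofReal_mul_I u
    have h2 : ‖((u ^ 2 / 2 : ℝ) : ℂ)‖ = u ^ 2 / 2 := by
      rw [Complex.norm_real, Real.norm_of_nonneg (by positivity)]
    have h3 : ‖Complex.exp (u * Complex.I) - (1 + u * Complex.I - (u ^ 2 / 2 : ℝ))‖ ≤
        1 + (1 + |u| + u ^ 2 / 2) := by
      refine (norm_sub_le _ _).trans (add_le_add h1.le ((norm_sub_le _ _).trans ?_))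
      rw [h2]
      gcongr
      refine (norm_add_le _ _).trans ?_
      rw [hn, norm_one]
    have h4 : u ^ 2 ≤ |u| ^ 3 := by
      rw [← sq_abs]; exact pow_le_pow_right₀ hu.le (by norm_num)
    have h5 : |u| ≤ |u| ^ 3 := le_self_pow₀ hu.le (by norm_num)
    linarith

variable {𝒳 : Type*} [MeasurableSpace 𝒳] {F : ℕ → Measure 𝒳} [∀ n, IsProbabilityMeasure (F n)]
  {y : ℕ → 𝒳 → ℝ} {b : ℝ}

/-- Triangular arrays with bounded third absolute moments. -/
structure CubeBounded (F : ℕ → Measure 𝒳) (y : ℕ → 𝒳 → ℝ) (b : ℝ) : Prop where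
  meas : ∀ n, Measurable (y n)
  integrable : ∀ᶠ n in atTop, Integrable (fun x => |y n x| ^ 3) (F n)
  bound : ∀ᶠ n in atTop, ∫ x, |y n x| ^ 3 ∂(F n) ≤ b

theorem sq_le_one_add_cube (u : ℝ) : u ^ 2 ≤ 1 + |u| ^ 3 := by
  rw [← sq_abs]
  nlinarith [abs_nonneg u, sq_nonneg (|u| - 1), mul_nonneg (abs_nonneg u) (sq_nonneg (|u| - 1))]

theorem abs_le_one_add_cube (u : ℝ) : |u| ≤ 1 + |u| ^ 3 := by
  nlinarith [abs_nonneg u, sq_nonneg (|u| - 1), mul_nonneg (abs_nonneg u) (sq_nonneg (|u| - 1))]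

theorem integrable_sq_of_cube {ν : Measure 𝒳} [IsProbabilityMeasure ν] {f : 𝒳 → ℝ}
    (hf : Measurable f) (h : Integrable (fun x => |f x| ^ 3) ν) :
    Integrable (fun x => f x ^ 2) ν :=
  ((integrable_const 1).add h).mono' (hf.pow_const 2).aestronglyMeasurable
    (ae_of_all _ fun x => by
      rw [Real.norm_of_nonneg (sq_nonneg _)]; exact sq_le_one_add_cube _)

theorem integrable_of_cube {ν : Measure 𝒳} [IsProbabilityMeasure ν] {f : 𝒳 → ℝ}
    (hf : Measurable f) (h : Integrable (fun x => |f x| ^ 3) ν) : Integrable f ν :=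
  ((integrable_const 1).add h).mono' hf.aestronglyMeasurable
    (ae_of_all _ fun _ => abs_le_one_add_cube _)

/-- The `n`-th powers of two sequences in the unit disc are asymptotically equal if both sequences
have the same expansion up to terms of order `n^{-3/2}`. -/
theorem tendsto_pow_sub_pow {w z m : ℕ → ℂ} {K K' : ℝ} (hw : ∀ᶠ n in atTop, ‖w n‖ ≤ 1)
    (hz : ∀ᶠ n in atTop, ‖z n‖ ≤ 1)
    (hwm : ∀ᶠ n : ℕ in atTop, ‖w n - m n‖ ≤ K * (√n)⁻¹ ^ 3)
    (hzm : ∀ᶠ n : ℕ in atTop, ‖z n - m n‖ ≤ K' * (√n)⁻¹ ^ 3) :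
    Tendsto (fun n => w n ^ n - z n ^ n) atTop (𝓝 0) := by
  have hlim : Tendsto (fun n : ℕ => (K + K') * (√(n : ℝ))⁻¹) atTop (𝓝 0) := by
    simpa using (tendsto_sqrt_size (tendsto_id (α := ℕ))).inv_tendsto_atTop.const_mul (K + K')
  refine squeeze_zero_norm' ?_ hlim
  filter_upwards [hw, hz, hwm, hzm, eventually_gt_atTop 0] with n h1 h2 h3 h4 hn
  have hs : 0 < √(n : ℝ) := Real.sqrt_pos.2 (by exact_mod_cast hn)
  have hsq := Real.sq_sqrt (Nat.cast_nonneg (α := ℝ) n)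
  have h5 : ‖w n - z n‖ ≤ (K + K') * (√n)⁻¹ ^ 3 := by
    have : w n - z n = (w n - m n) - (z n - m n) := by ring
    rw [this, add_mul]
    exact (norm_sub_le _ _).trans (add_le_add h3 h4)
  calc ‖w n ^ n - z n ^ n‖ ≤ n * ‖w n - z n‖ := norm_pow_sub_pow_le h1 h2 n
    _ ≤ n * ((K + K') * (√n)⁻¹ ^ 3) := by gcongr
    _ = (K + K') * (√(n : ℝ))⁻¹ := by
        nth_rewrite 1 [← hsq]
        field_simp

theorem abs_exp_neg_sub_le {s : ℝ} (hs : 0 ≤ s) {b : ℝ} (hsb : s ≤ b) (n : ℕ) :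
    |Real.exp (-(s / n)) - (1 - s / n)| ≤ √b ^ 3 * (√n)⁻¹ ^ 3 := by
  have h := abs_exp_neg_sq_sub_le (√s * (√n)⁻¹)
  have e : (√s * (√(n : ℝ))⁻¹) ^ 2 = s / n := by
    rw [mul_pow, inv_pow, Real.sq_sqrt hs, Real.sq_sqrt (Nat.cast_nonneg n), div_eq_mul_inv]
  rw [e] at h
  refine h.trans ?_
  rw [abs_of_nonneg (by positivity), mul_pow]
  gcongr

namespace CubeBounded

theorem sq_nonneg_le (h : CubeBounded F y b) :
    ∀ᶠ n in atTop, ∫ x, y n x ^ 2 ∂(F n) ≤ 1 + b := by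
  filter_upwards [h.integrable, h.bound] with n h1 h2
  calc ∫ x, y n x ^ 2 ∂(F n) ≤ ∫ x, (1 + |y n x| ^ 3) ∂(F n) :=
        integral_mono (integrable_sq_of_cube (h.meas n) h1) ((integrable_const 1).add h1)
          fun x => sq_le_one_add_cube _
    _ ≤ 1 + b := by
        rw [integral_add (integrable_const 1) h1]
        simpa using h2

/-- Contiguity controls sample averages, not expectations under `F n`. The Laplace transform links
them: the expectation of `exp(-n⁻¹ ∑ y²)` is the `n`-th power of that of `exp(-y² / n)`, which is `1
- S / n + O(n^{-3/2})`. So `exp(-S n)` converges to `exp(-s)`, and logarithms finish. -/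
theorem tendsto_second_moment (h : CubeBounded F y b) {s : ℝ}
    (hs : Tendsto (fun i : Σ n, Fin n → 𝒳 => (i.1 : ℝ)⁻¹ * ∑ j, y i.1 (i.2 j) ^ 2)
      (whp fun n => sampleLaw (F n) n) (𝓝 s)) :
    Tendsto (fun n => ∫ x, y n x ^ 2 ∂(F n)) atTop (𝓝 s) := by
  set S : ℕ → ℝ := fun n => ∫ x, y n x ^ 2 ∂(F n) with hS
  have hS0 : ∀ n, 0 ≤ S n := fun n => integral_nonneg fun x => sq_nonneg _
  set w : ℕ → ℝ := fun n => ∫ x, Real.exp (-(y n x * (√n)⁻¹) ^ 2) ∂(F n) with hw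
  have hmeas : ∀ n, Measurable fun x => Real.exp (-(y n x * (√n)⁻¹) ^ 2) := fun n =>
    (((h.meas n).mul_const _).pow_const 2).neg.exp
  have hle1 : ∀ u : ℝ, Real.exp (-u ^ 2) ≤ 1 := fun u =>
    Real.exp_le_one_iff.2 (by nlinarith [sq_nonneg u])
  have hint : ∀ n, Integrable (fun x => Real.exp (-(y n x * (√n)⁻¹) ^ 2)) (F n) := fun n =>
    Integrable.of_bound (hmeas n).aestronglyMeasurable 1 (ae_of_all _ fun x => by
      rw [Real.norm_of_nonneg (Real.exp_nonneg _)]; exact hle1 _)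
  have hw0 : ∀ n, 0 ≤ w n := fun n => integral_nonneg fun x => Real.exp_nonneg _
  have hw1 : ∀ n, w n ≤ 1 := fun n => by
    calc w n ≤ ∫ _, (1 : ℝ) ∂(F n) := integral_mono (hint n) (integrable_const 1) fun x => hle1 _
      _ = 1 := by simp
  -- the Laplace transform of the sample second moment
  have hpow : Tendsto (fun n => w n ^ n) atTop (𝓝 (Real.exp (-s))) := by
    have h1 : Tendsto (fun i : Σ n, Fin n → 𝒳 =>
        Real.exp (-((i.1 : ℝ)⁻¹ * ∑ j, y i.1 (i.2 j) ^ 2)))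
        (whp fun n => sampleLaw (F n) n) (𝓝 (Real.exp (-s))) :=
      (Real.continuous_exp.tendsto _).comp hs.neg
    have hmeas2 : ∀ n : ℕ, Measurable fun x : Fin n → 𝒳 =>
        Real.exp (-((n : ℝ)⁻¹ * ∑ j, y n (x j) ^ 2)) := fun n =>
      Real.measurable_exp.comp (((Finset.measurable_fun_sum _ fun j _ =>
        ((h.meas n).comp (measurable_pi_apply j)).pow_const 2).const_mul _).neg)
    have h2 := tendsto_integral_whp (b := 1) (fun n => (hmeas2 n).aestronglyMeasurable) (fun i => by
      rw [Real.norm_of_nonneg (Real.exp_nonneg _), Real.exp_le_one_iff, neg_nonpos]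
      positivity) h1
    refine h2.congr fun n => ?_
    have := integral_fintype_prod_eq_pow (ι := Fin n) (μ := F n)
      fun x => Real.exp (-(y n x * (√n)⁻¹) ^ 2)
    rw [Fintype.card_fin] at this
    rw [← this]
    refine integral_congr_ae (ae_of_all _ fun x => ?_)
    simp only
    rw [← Real.exp_sum, Finset.sum_neg_distrib, Finset.mul_sum]
    congr 2
    refine Finset.sum_congr rfl fun j _ => ?_
    rw [mul_pow, inv_pow, Real.sq_sqrt (Nat.cast_nonneg n), mul_comm]
  have hdiff : Tendsto (fun n => (w n : ℂ) ^ n - ((Real.exp (-(S n / n)) : ℝ) : ℂ) ^ n) atTop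
      (𝓝 0) := by
    refine tendsto_pow_sub_pow (m := fun n => ((1 - S n / n : ℝ) : ℂ)) (K := b)
      (K' := √(1 + b) ^ 3) (Eventually.of_forall fun n => ?_) (Eventually.of_forall fun n => ?_)
      ?_ ?_
    · rw [Complex.norm_real, Real.norm_of_nonneg (hw0 n)]; exact hw1 n
    · rw [Complex.norm_real, Real.norm_of_nonneg (Real.exp_nonneg _), Real.exp_le_one_iff,
        neg_nonpos]
      exact div_nonneg (hS0 n) (Nat.cast_nonneg n)
    · filter_upwards [h.integrable, h.bound] with n h1 h2
      have hsqi := integrable_sq_of_cube (h.meas n) h1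
      rw [← Complex.ofReal_sub, Complex.norm_real]
      have e1 : w n - (1 - S n / n) =
          ∫ x, (Real.exp (-(y n x * (√n)⁻¹) ^ 2) - (1 - (y n x * (√n)⁻¹) ^ 2)) ∂(F n) := by
        have e2 : ∀ x, (y n x * (√n)⁻¹) ^ 2 = (n : ℝ)⁻¹ * y n x ^ 2 := fun x => by
          rw [mul_pow, inv_pow, Real.sq_sqrt (Nat.cast_nonneg n), mul_comm]
        have hi2 : Integrable (fun x => (y n x * (√n)⁻¹) ^ 2) (F n) := by
          simp only [e2]; exact hsqi.const_mul _
        have hi3 : Integrable (fun x => 1 - (y n x * (√n)⁻¹) ^ 2) (F n) :=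
          (integrable_const 1).sub hi2
        rw [integral_sub (hint n) hi3, integral_sub (integrable_const 1) hi2]
        simp only [e2, integral_const_mul]
        simp [hw, hS, e2, div_eq_inv_mul]
      rw [e1]
      calc _ ≤ ∫ x, |y n x| ^ 3 * (√n)⁻¹ ^ 3 ∂(F n) := by
            refine norm_integral_le_of_norm_le (h1.mul_const _) (ae_of_all _ fun x => ?_)
            refine (abs_exp_neg_sq_sub_le _).trans_eq ?_
            rw [abs_mul, abs_of_nonneg (a := (√(n : ℝ))⁻¹) (by positivity), mul_pow]
        _ ≤ b * (√n)⁻¹ ^ 3 := by rw [integral_mul_const]; gcongr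
    · filter_upwards [h.sq_nonneg_le] with n h1
      rw [← Complex.ofReal_sub, Complex.norm_real]
      exact abs_exp_neg_sub_le (hS0 n) h1 n
  have hexp : Tendsto (fun n => Real.exp (-S n)) atTop (𝓝 (Real.exp (-s))) := by
    have h1 : Tendsto (fun n => w n ^ n - Real.exp (-(S n / n)) ^ n) atTop (𝓝 0) := by
      have := (Complex.continuous_re.tendsto 0).comp hdiff
      refine this.congr fun n => ?_
      simp only [Function.comp_apply, Complex.sub_re, ← Complex.ofReal_pow, Complex.ofReal_re]
    have h2 := hpow.sub h1
    rw [sub_zero] at h2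
    refine h2.congr' ?_
    filter_upwards [eventually_gt_atTop 0] with n hn
    have hn' : (n : ℝ) ≠ 0 := by positivity
    rw [← Real.exp_nat_mul]
    have : (n : ℝ) * -(S n / n) = -S n := by field_simp
    rw [this]; ring
  have := (hexp.log (Real.exp_ne_zero _)).neg
  simpa using this

/-- The same comparison of powers, now of the characteristic function at scale `n^{-1/2}` with
`exp(-S n / (2 n))`; the mean-zero hypothesis removes the linear term. -/
theorem tendsto_charFun (h : CubeBounded F y b) (hmean : ∀ᶠ n in atTop, ∫ x, y n x ∂(F n) = 0)
    {s : ℝ} (hs : Tendsto (fun i : Σ n, Fin n → 𝒳 => (i.1 : ℝ)⁻¹ * ∑ j, y i.1 (i.2 j) ^ 2)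
      (whp fun n => sampleLaw (F n) n) (𝓝 s)) :
    Tendsto (fun n : ℕ => ∫ x : Fin n → 𝒳,
      Complex.exp (((√n)⁻¹ * ∑ j, y n (x j) : ℝ) * Complex.I) ∂(sampleLaw (F n) n)) atTop
      (𝓝 (Complex.exp (-(s / 2 : ℝ)))) := by
  have hlim := h.tendsto_second_moment hs
  set S : ℕ → ℝ := fun n => ∫ x, y n x ^ 2 ∂(F n) with hS
  have hS0 : ∀ n, 0 ≤ S n := fun n => integral_nonneg fun x => sq_nonneg _
  set w : ℕ → ℂ := fun n => ∫ x, Complex.exp ((y n x * (√n)⁻¹ : ℝ) * Complex.I) ∂(F n) with hw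
  have hint : ∀ n, Integrable (fun x => Complex.exp ((y n x * (√n)⁻¹ : ℝ) * Complex.I)) (F n) :=
    fun n => Integrable.of_bound (Measurable.aestronglyMeasurable
      (((Complex.measurable_ofReal.comp ((h.meas n).mul_const _)).mul_const _).cexp)) 1
      (ae_of_all _ fun x => (Complex.norm_exp_ofReal_mul_I _).le)
  have hw1 : ∀ n, ‖w n‖ ≤ 1 := fun n => by
    refine (norm_integral_le_of_norm_le_const (C := 1)
      (ae_of_all _ fun x => (Complex.norm_exp_ofReal_mul_I _).le)).trans ?_
    simp
  have hpow : ∀ n : ℕ, ∫ x : Fin n → 𝒳,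
      Complex.exp (((√n)⁻¹ * ∑ j, y n (x j) : ℝ) * Complex.I) ∂(sampleLaw (F n) n) = w n ^ n := by
    intro n
    have := integral_fintype_prod_eq_pow (ι := Fin n) (μ := F n)
      fun x => Complex.exp ((y n x * (√n)⁻¹ : ℝ) * Complex.I)
    rw [Fintype.card_fin] at this
    rw [← this]
    refine integral_congr_ae (ae_of_all _ fun x => ?_)
    simp only
    rw [← Complex.exp_sum, ← Finset.sum_mul, ← Complex.ofReal_sum, ← Finset.sum_mul, mul_comm (√n)⁻¹]
  have hdiff : Tendsto (fun n => w n ^ n - ((Real.exp (-(S n / 2 / n)) : ℝ) : ℂ) ^ n) atTop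
      (𝓝 0) := by
    refine tendsto_pow_sub_pow (m := fun n => ((1 - S n / 2 / n : ℝ) : ℂ)) (K := 4 * b)
      (K' := √((1 + b) / 2) ^ 3) (Eventually.of_forall hw1) (Eventually.of_forall fun n => ?_)
      ?_ ?_
    · rw [Complex.norm_real, Real.norm_of_nonneg (Real.exp_nonneg _), Real.exp_le_one_iff,
        neg_nonpos]
      exact div_nonneg (div_nonneg (hS0 n) zero_le_two) (Nat.cast_nonneg n)
    · filter_upwards [h.integrable, h.bound, hmean] with n h1 h2 h3
      have hsqi := integrable_sq_of_cube (h.meas n) h1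
      have hyi := integrable_of_cube (h.meas n) h1
      have e1 : w n - ((1 - S n / 2 / n : ℝ) : ℂ) =
          ∫ x, (Complex.exp ((y n x * (√n)⁻¹ : ℝ) * Complex.I) -
            (1 + (y n x * (√n)⁻¹ : ℝ) * Complex.I - ((y n x * (√n)⁻¹) ^ 2 / 2 : ℝ))) ∂(F n) := by
        have e2 : ∀ x, (y n x * (√n)⁻¹) ^ 2 / 2 = (n : ℝ)⁻¹ / 2 * y n x ^ 2 := fun x => by
          rw [mul_pow, inv_pow, Real.sq_sqrt (Nat.cast_nonneg n)]; ring
        have hi1 : Integrable (fun x => ((y n x * (√n)⁻¹ : ℝ) : ℂ) * Complex.I) (F n) :=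
          ((hyi.mul_const _).ofReal).mul_const _
        have hi2 : Integrable (fun x => (((y n x * (√n)⁻¹) ^ 2 / 2 : ℝ) : ℂ)) (F n) := by
          simp only [e2]; exact (hsqi.const_mul _).ofReal
        have hi3 : Integrable (fun x => 1 + ((y n x * (√n)⁻¹ : ℝ) : ℂ) * Complex.I) (F n) :=
          (integrable_const 1).add hi1
        have hi4 : Integrable (fun x => 1 + ((y n x * (√n)⁻¹ : ℝ) : ℂ) * Complex.I -
            (((y n x * (√n)⁻¹) ^ 2 / 2 : ℝ) : ℂ)) (F n) := hi3.sub hi2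
        have hm : ∫ x, ((y n x * (√n)⁻¹ : ℝ) : ℂ) * Complex.I ∂(F n) = 0 := by
          rw [integral_mul_const, integral_complex_ofReal, integral_mul_const, h3]
          simp
        have hq : ∫ x, (((y n x * (√n)⁻¹) ^ 2 / 2 : ℝ) : ℂ) ∂(F n) = ((S n / 2 / n : ℝ) : ℂ) := by
          rw [integral_complex_ofReal]
          simp only [e2, integral_const_mul]
          congr 1
          rw [hS]
          ring
        rw [integral_sub (hint n) hi4, integral_sub hi3 hi2,
          integral_add (integrable_const 1) hi1, hm, hq]
        simp [hw]
      rw [e1]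
      calc _ ≤ ∫ x, 4 * (|y n x| ^ 3 * (√n)⁻¹ ^ 3) ∂(F n) := by
            refine norm_integral_le_of_norm_le ((h1.mul_const _).const_mul 4)
              (ae_of_all _ fun x => ?_)
            refine (norm_exp_mul_I_sub_le _).trans_eq ?_
            rw [abs_mul, abs_of_nonneg (a := (√(n : ℝ))⁻¹) (by positivity), mul_pow]
        _ ≤ 4 * b * (√n)⁻¹ ^ 3 := by
            rw [integral_const_mul, integral_mul_const, ← mul_assoc]; gcongr
    · filter_upwards [h.sq_nonneg_le] with n h1
      rw [← Complex.ofReal_sub, Complex.norm_real]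
      exact abs_exp_neg_sub_le (div_nonneg (hS0 n) zero_le_two) (by linarith) n
  have hexp : Tendsto (fun n => ((Real.exp (-(S n / 2)) : ℝ) : ℂ)) atTop
      (𝓝 (Complex.exp (-(s / 2 : ℝ)))) := by
    rw [← Complex.ofReal_neg, ← Complex.ofReal_exp]
    exact (Complex.continuous_ofReal.tendsto _).comp
      ((Real.continuous_exp.tendsto _).comp (hlim.div_const 2).neg)
  have h2 := hdiff.add hexp
  rw [zero_add] at h2
  refine h2.congr' ?_
  filter_upwards [eventually_gt_atTop 0] with n hn
  have hn' : (n : ℝ) ≠ 0 := by positivity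
  rw [hpow, ← Complex.ofReal_pow, ← Real.exp_nat_mul]
  have : (n : ℝ) * -(S n / 2 / n) = -(S n / 2) := by field_simp
  rw [this]; ring

end CubeBounded

end CentralLimit

/-! ### From the regularity conditions to the local setup, and transfer of moments to the
alternatives. -/

section Moments

variable {𝒳 : Type*} [MeasurableSpace 𝒳] {p q : ℕ} {F₀ : Measure 𝒳} {g : 𝒳 → E p → E p}
  {c : E p → E q} {θ₀ : E p}

/-- The cube root of `1` plus the sum of the absolute dominating functions: its cube is integrable
and dominates `‖g‖³` and both derivatives. -/
theorem Regular.exists_envelope (h : Regular F₀ g θ₀) [IsFiniteMeasure F₀] :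
    ∃ (a : 𝒳 → ℝ) (δ : ℝ), Envelope g θ₀ a δ ∧ Integrable (fun x => a x ^ 3) F₀ := by
  obtain ⟨N₁, hN₁, K₁, hK₁, h₁⟩ := h.bound_cube
  obtain ⟨N₂, hN₂, K₂, hK₂, h₂⟩ := h.bound_deriv
  obtain ⟨N₃, hN₃, K₃, hK₃, h₃⟩ := h.bound_deriv2
  obtain ⟨δ, hδ, hball⟩ := Metric.nhds_basis_closedBall.mem_iff.1
    (inter_mem hN₁ (inter_mem hN₂ hN₃))
  set A : 𝒳 → ℝ := fun x => |K₁ x| + |K₂ x| + |K₃ x| + 1 with hA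
  have hA1 : ∀ x, 1 ≤ A x := fun x => by
    simp only [hA]
    linarith [abs_nonneg (K₁ x), abs_nonneg (K₂ x), abs_nonneg (K₃ x)]
  have hcube : ∀ x, (A x ^ (1 / 3 : ℝ)) ^ 3 = A x := fun x => by
    rw [← Real.rpow_natCast, ← Real.rpow_mul (zero_le_one.trans (hA1 x))]
    norm_num
  refine ⟨fun x => A x ^ (1 / 3 : ℝ), δ, ⟨hδ, fun x => Real.one_le_rpow (hA1 x) (by norm_num),
    fun x θ hθ => ?_, fun x θ hθ => (h₂ x).1 θ (hball hθ).2.1,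
    fun x θ hθ => (h₃ x).1 θ (hball hθ).2.2, fun x θ hθ => ?_, fun x θ hθ => ?_⟩, ?_⟩
  · refine le_of_pow_le_pow_left₀ (n := 3) (by norm_num)
      (Real.rpow_nonneg (zero_le_one.trans (hA1 x)) _) ?_
    rw [hcube]
    refine (h₁ x θ (hball hθ).1).trans ?_
    simp only [hA]
    linarith [le_abs_self (K₁ x), abs_nonneg (K₂ x), abs_nonneg (K₃ x)]
  · rw [hcube]
    refine ((h₂ x).2.2 θ (hball hθ).2.1).trans ?_
    simp only [hA]
    linarith [le_abs_self (K₂ x), abs_nonneg (K₁ x), abs_nonneg (K₃ x)]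
  · rw [hcube]
    refine ((h₃ x).2.2 θ (hball hθ).2.2).trans ?_
    simp only [hA]
    linarith [le_abs_self (K₃ x), abs_nonneg (K₂ x), abs_nonneg (K₁ x)]
  · simp only [hcube]
    exact ((hK₁.abs.add hK₂.abs).add hK₃.abs).add (integrable_const 1)

theorem sum_smulRight_single {m n : ℕ} (T : E n →L[ℝ] E m) :
    ∑ l, ContinuousLinearMap.smulRightL ℝ (E n) (E m) (EuclideanSpace.proj l)
      (T (EuclideanSpace.single l 1)) = T := by
  refine ContinuousLinearMap.coe_injective
    ((EuclideanSpace.basisFun (Fin n) ℝ).toBasis.ext fun l => ?_)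
  simp [Finset.sum_apply]

/-- Directional derivatives are limits of difference quotients, hence measurable; finitely many of
them determine the derivative. -/
theorem measurable_fderiv_param {m n : ℕ} {f : 𝒳 → E n → E m} {θ : E n}
    (hf : ∀ θ, Measurable fun x => f x θ) (hd : ∀ x, DifferentiableAt ℝ (f x) θ) :
    Measurable fun x => fderiv ℝ (f x) θ := by
  have h : ∀ v, Measurable fun x => fderiv ℝ (f x) θ v := fun v => by
    refine measurable_of_tendsto_metrizable
      (f := fun k x => (k : ℝ) • (f x (θ + (k : ℝ)⁻¹ • v) - f x θ)) (fun k => ?_) ?_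
    · exact ((hf _).sub (hf _)).const_smul (k : ℝ)
    · exact tendsto_pi_nhds.2 fun x =>
        ((hd x).hasFDerivAt.lim_real v).comp tendsto_natCast_atTop_atTop
  have e : (fun x => fderiv ℝ (f x) θ) = fun x =>
      ∑ l, ContinuousLinearMap.smulRightL ℝ (E n) (E m) (EuclideanSpace.proj l)
        (fderiv ℝ (f x) θ (EuclideanSpace.single l 1)) :=
    funext fun x => (sum_smulRight_single _).symm
  rw [e]
  exact Finset.measurable_fun_sum _ fun l _ =>
    (ContinuousLinearMap.continuous _).measurable.comp (h _)

theorem mat_integral {m n : ℕ} {T : 𝒳 → E n →L[ℝ] E m} (hT : Integrable T F₀) :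
    mat (∫ x, T x ∂F₀) = Matrix.of fun j l => ∫ x, T x (EuclideanSpace.single l 1) j ∂F₀ := by
  ext j l
  exact (((EuclideanSpace.proj (𝕜 := ℝ) j).comp (ContinuousLinearMap.apply ℝ (E m)
    (EuclideanSpace.single l (1 : ℝ)))).integral_comp_comm hT).symm

theorem Envelope.integrable_outer {a : 𝒳 → ℝ} {δ : ℝ} (h : Envelope g θ₀ a δ)
    (ha : Integrable (fun x => a x ^ 3) F₀) (hg : ∀ θ, Measurable fun x => g x θ) :
    Integrable (fun x => outer (g x θ₀)) F₀ := by
  refine ha.mono' (continuous_outer.comp_stronglyMeasurable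
    (hg θ₀).stronglyMeasurable).aestronglyMeasurable (ae_of_all _ fun x => ?_)
  rw [norm_outer]
  exact (pow_le_pow_left₀ (norm_nonneg _) (h.bound x θ₀ h.center_mem) 2).trans
    (pow_le_pow_right₀ (h.one_le x) (by norm_num))

theorem Envelope.integrable_fderiv {a : 𝒳 → ℝ} {δ : ℝ} (h : Envelope g θ₀ a δ)
    (ha : Integrable (fun x => a x ^ 3) F₀) (hg : ∀ θ, Measurable fun x => g x θ) :
    Integrable (fun x => fderiv ℝ (g x) θ₀) F₀ :=
  ha.mono' (measurable_fderiv_param hg fun x => h.diff x θ₀ h.center_mem).aestronglyMeasurable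
    (ae_of_all _ fun x => h.deriv_le x θ₀ h.center_mem)

theorem mat_integral_outer (h : Integrable (fun x => outer (g x θ₀)) F₀) :
    mat (∫ x, outer (g x θ₀) ∂F₀) = S11 F₀ g θ₀ := by
  rw [mat_integral h]
  ext j l
  simp [S11, EuclideanSpace.inner_single_right, mul_comm]

theorem mat_integral_fderiv (h : Integrable (fun x => fderiv ℝ (g x) θ₀) F₀) :
    mat (∫ x, fderiv ℝ (g x) θ₀ ∂F₀) = S12 F₀ g θ₀ :=
  mat_integral h

/-- `C` is differentiable, hence continuous, at `θ₀`, which makes the differentiability of `c`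
strict there. -/
theorem RegularConstraint.exists_strict (h : RegularConstraint c θ₀) :
    HasStrictFDerivAt c (fderiv ℝ c θ₀) θ₀ ∧
      ∃ δ > 0, ContinuousOn c (Metric.closedBall θ₀ δ) := by
  obtain ⟨N, hN, B, hB⟩ := h.bound_deriv
  obtain ⟨δ, hδ, hball⟩ := Metric.nhds_basis_closedBall.mem_iff.1 hN
  refine ⟨hasStrictFDerivAt_of_hasFDerivAt_of_continuousAt (f' := fderiv ℝ c) ?_
    (hB θ₀ (mem_of_mem_nhds hN)).2.1.continuousAt, δ, hδ,
    fun θ hθ => (hB θ (hball hθ)).1.continuousAt.continuousWithinAt⟩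
  filter_upwards [hN] with θ hθ using (hB θ hθ).1.hasFDerivAt

variable [IsProbabilityMeasure F₀]

theorem exists_localSetup (hg : ∀ θ, Measurable fun x => g x θ) (hreg : Regular F₀ g θ₀)
    (hnull : c θ₀ = 0) (hc : RegularConstraint c θ₀) :
    ∃ (a : 𝒳 → ℝ) (B δ κ : ℝ) (Ginv : E p →L[ℝ] E p) (D : E p →L[ℝ] E q) (L : E q →L[ℝ] E q),
      Integrable (fun x => a x ^ 3) F₀ ∧ ∫ x, a x ^ 3 ∂F₀ < B ∧
      LocalSetup g c θ₀ a B δ κ (fderiv ℝ c θ₀) ∧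
      Limits (∫ x, outer (g x θ₀) ∂F₀) (∫ x, fderiv ℝ (g x) θ₀ ∂F₀) Ginv (fderiv ℝ c θ₀) D L κ ∧
      ∀ f, ‖L f‖ ^ 2 = f.ofLp ⬝ᵥ (Q F₀ g c θ₀ *ᵥ f.ofLp) := by
  obtain ⟨a, δ₁, henv, ha⟩ := hreg.exists_envelope
  obtain ⟨hstrict, δ₂, hδ₂, hcont⟩ := hc.exists_strict
  obtain ⟨Ginv, D, L, κ, hl, hL⟩ := exists_limits hreg.posDef hreg.rank hc.rank
  have hS : op (S11 F₀ g θ₀) = ∫ x, outer (g x θ₀) ∂F₀ := by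
    rw [← mat_integral_outer (henv.integrable_outer ha hg), op_mat]
  have hG : op (S12 F₀ g θ₀) = ∫ x, fderiv ℝ (g x) θ₀ ∂F₀ := by
    rw [← mat_integral_fderiv (henv.integrable_fderiv ha hg), op_mat]
  have hC : op (jacobian c θ₀) = fderiv ℝ c θ₀ := op_mat _
  rw [hS, hG, hC] at hl
  -- Strictly above the mean, so that the law of large numbers bounds the sample average of `a³` by
  -- `B`.
  set B := ∫ x, a x ^ 3 ∂F₀ + 1 with hB
  have ha0 : 0 ≤ ∫ x, a x ^ 3 ∂F₀ :=
    integral_nonneg fun x => pow_nonneg (zero_le_one.trans (henv.one_le x)) 3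
  have hB1 : 1 ≤ B := by linarith
  have hκ := hl.pos
  have hδ₁ := henv.pos
  set δ := min (min δ₁ δ₂) (κ / (4 * B)) with hδ
  have hδ0 : 0 < δ := lt_min (lt_min hδ₁ hδ₂) (by positivity)
  refine ⟨a, B, δ, κ, Ginv, D, L, ha, by linarith, ⟨henv.mono hδ0
    ((min_le_left _ _).trans (min_le_left _ _)), hB1, ?_, hstrict,
    hcont.mono (Metric.closedBall_subset_closedBall ((min_le_left _ _).trans (min_le_right _ _))),
    hnull⟩, hl, hL⟩
  calc 4 * (B * δ) ≤ 4 * (B * (κ / (4 * B))) := by gcongr; exact min_le_right _ _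
    _ = κ := by field_simp

variable {F : ℕ → Measure 𝒳} [∀ n, IsProbabilityMeasure (F n)] {θ : ℕ → E p} {f : E q}
  {a : 𝒳 → ℝ} {B δ : ℝ}

theorem eventually_cube_le (ha : Integrable (fun x => a x ^ 3) F₀) (hB : ∫ x, a x ^ 3 ∂F₀ < B) :
    ∀ᶠ i : Σ n, Fin n → 𝒳 in whp (sampleLaw F₀), ∑ j, a (i.2 j) ^ 3 ≤ B * i.1 := by
  filter_upwards [(tendsto_avg_whp F₀ ha).eventually_lt_const hB,
    tendsto_fst_whp.eventually (eventually_gt_atTop 0)] with i h1 h2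
  have h2' : (0 : ℝ) < i.1 := by exact_mod_cast h2
  rw [smul_eq_mul, inv_mul_lt_iff₀ h2'] at h1
  linarith

/-- All laws of large numbers are taken at the fixed `θ₀` under `F₀` and carried over by contiguity;
only the boundedness of the scaled mean at `θn` is imposed, by restricting the filter. -/
theorem IsContiguousAlternative.samples (h : IsContiguousAlternative F₀ F g c θ₀ θ f)
    (hg : ∀ θ, Measurable fun x => g x θ) (henv : Envelope g θ₀ a δ)
    (ha : Integrable (fun x => a x ^ 3) F₀) (hB : ∫ x, a x ^ 3 ∂F₀ < B) (M : ℝ) :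
    Samples (whp (fun n => sampleLaw (F n) n) ⊓
        𝓟 {i : Σ n, Fin n → 𝒳 | ‖√i.1 • gbar g i.2 (θ i.1)‖ ≤ M}) g c θ₀ a B
      (∫ x, outer (g x θ₀) ∂F₀) (∫ x, fderiv ℝ (g x) θ₀ ∂F₀) Sigma.fst Sigma.snd
      (fun i => θ i.1) f where
  size := tendsto_fst_whp.mono_left inf_le_left
  cube := (inf_le_left.trans h.contiguous.whp_le) (eventually_cube_le ha hB)
  second := (tendsto_avg_whp F₀ (henv.integrable_outer ha hg)).mono_left
    (inf_le_left.trans h.contiguous.whp_le)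
  jac := (tendsto_avg_whp F₀ (henv.integrable_fderiv ha hg)).mono_left
    (inf_le_left.trans h.contiguous.whp_le)
  param := (h.tendsto.comp tendsto_fst_whp).mono_left inf_le_left
  constraint := (tendsto_fst_whp.mono_left inf_le_left).eventually h.constraint
  mean := ⟨M, eventually_inf_principal.2 (Eventually.of_forall fun _ => id)⟩

theorem IsContiguousAlternative.tendsto_Sbar (h : IsContiguousAlternative F₀ F g c θ₀ θ f)
    (hg : ∀ θ, Measurable fun x => g x θ) (henv : Envelope g θ₀ a δ)
    (ha : Integrable (fun x => a x ^ 3) F₀) :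
    Tendsto (fun i : Σ n, Fin n → 𝒳 => Sbar g i.2 (θ i.1)) (whp fun n => sampleLaw (F n) n)
      (𝓝 (∫ x, outer (g x θ₀) ∂F₀)) := by
  set B := ∫ x, a x ^ 3 ∂F₀ + 1
  have hB : 0 ≤ B := add_nonneg (integral_nonneg fun x =>
    pow_nonneg (zero_le_one.trans (henv.one_le x)) 3) zero_le_one
  have h0 := (tendsto_avg_whp F₀ (henv.integrable_outer ha hg)).mono_left h.contiguous.whp_le
  have hθ : Tendsto (fun i : Σ n, Fin n → 𝒳 => θ i.1) (whp fun n => sampleLaw (F n) n) (𝓝 θ₀) :=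
    h.tendsto.comp tendsto_fst_whp
  have h1 : Tendsto (fun i : Σ n, Fin n → 𝒳 => Sbar g i.2 (θ i.1) - Sbar g i.2 θ₀)
      (whp fun n => sampleLaw (F n) n) (𝓝 0) := by
    have hlim : Tendsto (fun i : Σ n, Fin n → 𝒳 => B * (4 * √‖θ i.1 - θ₀‖))
        (whp fun n => sampleLaw (F n) n) (𝓝 0) := by
      have hc : Continuous fun u : E p => B * (4 * √‖u - θ₀‖) := by fun_prop
      exact (hc.tendsto' θ₀ 0 (by simp)).comp hθ
    refine squeeze_zero_norm' ?_ hlim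
    filter_upwards [h.contiguous.whp_le (eventually_cube_le ha (lt_add_one _)),
      hθ.eventually (Metric.closedBall_mem_nhds θ₀ henv.pos)] with i h2 h3
    exact henv.norm_Sbar_sub_le hB h2 h3
  simpa [Sbar] using h1.add h0

end Moments

/-! ### Convergence in distribution via characteristic functions. -/

section LimitLaw

variable {Ω : ℕ → Type*} [∀ n, MeasurableSpace (Ω n)] {P : ∀ n, Measure (Ω n)}
  [∀ n, IsProbabilityMeasure (P n)] {H : Type*} [NormedAddCommGroup H] [InnerProductSpace ℝ H]
  [MeasurableSpace H] [BorelSpace H]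

theorem charFun_map {α : Type*} [MeasurableSpace α] {μ : Measure α} {X : α → H}
    (hX : AEMeasurable X μ) (ξ : H) :
    charFun (μ.map X) ξ = ∫ x, Complex.exp ((inner ℝ (X x) ξ : ℝ) * Complex.I) ∂μ := by
  rw [charFun_apply, integral_map hX]
  exact Continuous.aestronglyMeasurable (by fun_prop)

variable [FiniteDimensional ℝ H]

theorem tendstoInDistribution_of_charFun {α : Type*} [MeasurableSpace α] {μ : Measure α}
    [IsProbabilityMeasure μ] {X : ∀ n, Ω n → H} {Z : α → H} (hX : ∀ n, AEMeasurable (X n) (P n))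
    (hZ : AEMeasurable Z μ)
    (h : ∀ ξ, Tendsto (fun n => charFun ((P n).map (X n)) ξ) atTop (𝓝 (charFun (μ.map Z) ξ))) :
    TendstoInDistribution X atTop Z P μ :=
  ⟨hX, hZ, ProbabilityMeasure.tendsto_iff_tendsto_charFun.2 h⟩

theorem _root_.MeasureTheory.TendstoInDistribution.tendsto_charFun {α : Type*} [MeasurableSpace α]
    {μ : Measure α} [IsProbabilityMeasure μ] {X : ∀ n, Ω n → H} {Z : α → H}
    (h : TendstoInDistribution X atTop Z P μ) (ξ : H) :
    Tendsto (fun n => charFun ((P n).map (X n)) ξ) atTop (𝓝 (charFun (μ.map Z) ξ)) :=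
  ProbabilityMeasure.tendsto_iff_tendsto_charFun.1 h.tendsto ξ

/-- Slutsky's theorem, for random variables on varying probability spaces. -/
theorem _root_.MeasureTheory.TendstoInDistribution.of_tendsto_sub {α : Type*} [MeasurableSpace α]
    {μ : Measure α} [IsProbabilityMeasure μ] {X Y : ∀ n, Ω n → ℝ} {Z : α → ℝ}
    (h : TendstoInDistribution X atTop Z P μ) (hY : ∀ n, AEMeasurable (Y n) (P n))
    (hsub : Tendsto (fun i : Σ n, Ω n => Y i.1 i.2 - X i.1 i.2) (whp P) (𝓝 0)) :
    TendstoInDistribution Y atTop Z P μ := by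
  refine tendstoInDistribution_of_charFun hY h.aemeasurable_limit fun ξ => ?_
  have hexp : ∀ {V : ∀ n, Ω n → ℝ} (_ : ∀ n, AEMeasurable (V n) (P n)) (n : ℕ),
      AEStronglyMeasurable (fun x => Complex.exp ((inner ℝ (V n x) ξ : ℝ) * Complex.I)) (P n) :=
    fun hV n => Continuous.comp_aestronglyMeasurable (g := fun v : ℝ =>
      Complex.exp ((inner ℝ v ξ : ℝ) * Complex.I)) (by fun_prop) (hV n).aestronglyMeasurable
  have hint : ∀ {V : ∀ n, Ω n → ℝ} (_ : ∀ n, AEMeasurable (V n) (P n)) (n : ℕ),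
      Integrable (fun x => Complex.exp ((inner ℝ (V n x) ξ : ℝ) * Complex.I)) (P n) :=
    fun hV n => Integrable.of_bound (hexp hV n) 1
      (ae_of_all _ fun x => (Complex.norm_exp_ofReal_mul_I _).le)
  have h0 : Tendsto (fun i : Σ n, Ω n =>
      Complex.exp ((inner ℝ (Y i.1 i.2) ξ : ℝ) * Complex.I) -
        Complex.exp ((inner ℝ (X i.1 i.2) ξ : ℝ) * Complex.I)) (whp P) (𝓝 0) := by
    have hc : Continuous fun u : ℝ => ‖Complex.exp ((inner ℝ u ξ : ℝ) * Complex.I) - 1‖ := by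
      fun_prop
    have hlim := (hc.tendsto' 0 0 (by simp)).comp hsub
    refine squeeze_zero_norm (fun i => le_of_eq ?_) hlim
    have e : (inner ℝ (Y i.1 i.2) ξ : ℝ) * Complex.I =
        (inner ℝ (X i.1 i.2) ξ : ℝ) * Complex.I +
          (inner ℝ (Y i.1 i.2 - X i.1 i.2) ξ : ℝ) * Complex.I := by
      rw [inner_sub_left]; push_cast; ring
    rw [e, Complex.exp_add, ← mul_sub_one, norm_mul, Complex.norm_exp_ofReal_mul_I, one_mul]
    rfl
  have h1 := tendsto_integral_whp (b := 2)
    (fun n => (hexp hY n).sub (hexp h.forall_aemeasurable n))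
    (fun i => (norm_sub_le _ _).trans (by
      rw [Complex.norm_exp_ofReal_mul_I, Complex.norm_exp_ofReal_mul_I]; norm_num)) h0
  have h2 := h1.add (h.tendsto_charFun ξ)
  rw [zero_add] at h2
  refine h2.congr fun n => ?_
  rw [charFun_map (hY n), charFun_map (h.forall_aemeasurable n)]
  simp only
  rw [integral_sub (hint hY n) (hint h.forall_aemeasurable n), sub_add_cancel]

theorem exists_tail_bound {W : ∀ n, Ω n → H} (hW : ∀ n, AEMeasurable (W n) (P n)) {ψ : H → ℂ}
    (hψ : ContinuousAt ψ 0)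
    (h : ∀ ξ, Tendsto (fun n => charFun ((P n).map (W n)) ξ) atTop (𝓝 (ψ ξ))) {ε : ℝ≥0∞}
    (hε : 0 < ε) : ∃ M : ℝ, ∀ n, P n {x | M < ‖W n x‖} ≤ ε := by
  have : ∀ n, IsProbabilityMeasure ((P n).map (W n)) := fun n =>
    Measure.isProbabilityMeasure_map (hW n)
  have ht := isTightMeasureSet_iff_tendsto_measure_norm_gt.1
    (isTightMeasureSet_of_tendsto_charFun hψ h)
  obtain ⟨M, hM⟩ := (ENNReal.tendsto_nhds_zero.1 ht ε hε).exists
  refine ⟨M, fun n => ?_⟩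
  have hms : MeasurableSet {v : H | M < ‖v‖} := measurableSet_lt measurable_const measurable_norm
  have := (le_iSup₂ (f := fun (μ : Measure H) (_ : μ ∈ Set.range fun n => (P n).map (W n)) =>
    μ {v | M < ‖v‖}) _ ⟨n, rfl⟩).trans hM
  rwa [Measure.map_apply_of_aemeasurable (hW n) hms] at this

end LimitLaw

/-! ### Noncentral chi-squared limits of quadratic forms. -/

section QuadraticForm

variable {Ω : ℕ → Type*} [∀ n, MeasurableSpace (Ω n)] {P : ∀ n, Measure (Ω n)}
  [∀ n, IsProbabilityMeasure (P n)] {p q : ℕ}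

/-- The vector `(s, 0, …, 0)`. -/
noncomputable def firstAxis (q : ℕ) (s : ℝ) : E q :=
  WithLp.toLp 2 fun i => if i.val = 0 then s else 0

/-- `noncentralChiSquared` puts the whole mean on the first coordinate, so the mean vector has to be
rotated there. A reflection exchanging two vectors of equal length does this. -/
theorem exists_isometry_map_eq_firstAxis (v : E q) :
    ∃ O : E q ≃ₗᵢ[ℝ] E q, O v = firstAxis q √(‖v‖ ^ 2) := by
  refine ⟨_, Submodule.reflection_sub ?_⟩
  rw [Real.sqrt_sq (norm_nonneg v)]
  cases q with
  | zero => simp [Subsingleton.elim v 0, Subsingleton.elim (firstAxis 0 _) 0]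
  | succ q =>
    rw [← Real.sqrt_sq (norm_nonneg (firstAxis (q + 1) ‖v‖)), EuclideanSpace.real_norm_sq_eq]
    simp [firstAxis, Real.sqrt_sq]

theorem charFun_gaussian_firstAxis (s : ℝ) (ξ : E q) :
    charFun ((Measure.pi fun i : Fin q => gaussianReal (if i.val = 0 then s else 0) 1).map
      (WithLp.toLp 2)) ξ =
      Complex.exp ((inner ℝ (firstAxis q s) ξ : ℝ) * Complex.I) *
        Complex.exp (-(‖ξ‖ ^ 2 / 2 : ℝ)) := by
  rw [charFun_pi]
  simp only [charFun_gaussianReal]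
  rw [← Complex.exp_sum, ← Complex.exp_add]
  congr 1
  rw [Finset.sum_sub_distrib, ← Finset.sum_mul, EuclideanSpace.real_norm_sq_eq, sub_eq_add_neg]
  congr 1
  · rw [PiLp.inner_apply]
    push_cast
    congr 1
    refine Finset.sum_congr rfl fun i _ => ?_
    simp only [firstAxis, RCLike.inner_apply, conj_trivial, Complex.ofReal_mul]
  · push_cast
    rw [Finset.sum_div]
    simp

/-- Quadratic forms in asymptotically normal vectors are asymptotically noncentral chi-squared if
they standardise the covariance operator. -/
theorem tendstoInDistribution_norm_sub_sq {W : ∀ n, Ω n → E p}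
    (hW : ∀ n, AEMeasurable (W n) (P n)) {S : E p →L[ℝ] E p}
    (h : ∀ ξ, Tendsto (fun n => charFun ((P n).map (W n)) ξ) atTop
      (𝓝 (Complex.exp (-(inner ℝ (S ξ) ξ / 2 : ℝ))))) {D : E p →L[ℝ] E q}
    (hD : ∀ b, D (S (D.adjoint b)) = b) (v : E q) :
    TendstoInDistribution (fun n x => ‖D (W n x) - v‖ ^ 2) atTop (id : ℝ → ℝ) P
      (noncentralChiSquared q (‖v‖ ^ 2)) := by
  obtain ⟨O, hO⟩ := exists_isometry_map_eq_firstAxis (-v)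
  rw [norm_neg] at hO
  set m := firstAxis q √(‖v‖ ^ 2) with hm
  have hT : Continuous fun w : E p => O (D w - v) := by fun_prop
  have hZ : TendstoInDistribution (fun n x => O (D (W n x) - v)) atTop
      (WithLp.toLp 2 : (Fin q → ℝ) → E q) P
      (Measure.pi fun i : Fin q => gaussianReal (if i.val = 0 then √(‖v‖ ^ 2) else 0) 1) := by
    refine tendstoInDistribution_of_charFun
      (fun n => hT.measurable.comp_aemeasurable (hW n))
      (WithLp.measurable_toLp 2 _).aemeasurable fun ξ => ?_
    rw [charFun_gaussian_firstAxis]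
    have h1 := (h (D.adjoint (O.symm ξ))).const_mul
      (Complex.exp ((inner ℝ m ξ : ℝ) * Complex.I))
    -- The variance in direction `ξ`: standardisation by `D` and rotation by `O` leave the identity
    -- covariance.
    have e : inner ℝ (S (D.adjoint (O.symm ξ))) (D.adjoint (O.symm ξ)) = ‖ξ‖ ^ 2 := by
      rw [ContinuousLinearMap.adjoint_inner_right, hD, real_inner_self_eq_norm_sq,
        LinearIsometryEquiv.norm_map]
    rw [e] at h1
    refine h1.congr fun n => ?_
    rw [charFun_map (hW n), charFun_map (X := fun x => O (D (W n x) - v))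
      (hT.measurable.comp_aemeasurable (hW n)), ← integral_const_mul]
    refine integral_congr_ae (ae_of_all _ fun x => ?_)
    simp only
    rw [← Complex.exp_add, ← add_mul, ← Complex.ofReal_add]
    congr 3
    rw [ContinuousLinearMap.adjoint_inner_right, ← LinearIsometryEquiv.inner_map_eq_flip, ← hO,
      ← inner_add_left, ← map_add]
    congr 2
    abel
  have hsq := hZ.continuous_comp (g := fun z : E q => ‖z‖ ^ 2) (by fun_prop)
  refine tendstoInDistribution_of_charFun (fun n => ?_) aemeasurable_id fun ξ => ?_
  · have hc : Continuous fun w : E p => ‖D w - v‖ ^ 2 := by fun_prop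
    exact hc.measurable.comp_aemeasurable (hW n)
  · have e : (noncentralChiSquared q (‖v‖ ^ 2)).map id =
        (Measure.pi fun i : Fin q => gaussianReal (if i.val = 0 then √(‖v‖ ^ 2) else 0) 1).map
          ((fun z : E q => ‖z‖ ^ 2) ∘ WithLp.toLp 2) := by
      rw [Measure.map_id, noncentralChiSquared]
      congr 1
      ext z
      simp [EuclideanSpace.real_norm_sq_eq]
    rw [e]
    refine (hsq.tendsto_charFun ξ).congr fun n => ?_
    congr 2
    ext x
    simp only [Function.comp_apply, LinearIsometryEquiv.norm_map]

end QuadraticForm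

/-! ### The scaled mean under contiguous alternatives. -/

section ScaledMean

variable {𝒳 : Type*} [MeasurableSpace 𝒳] {p q : ℕ} {F₀ : Measure 𝒳} [IsProbabilityMeasure F₀]
  {F : ℕ → Measure 𝒳} [∀ n, IsProbabilityMeasure (F n)] {g : 𝒳 → E p → E p} {c : E p → E q}
  {θ₀ : E p} {θ : ℕ → E p} {f : E q} {a : 𝒳 → ℝ} {B δ : ℝ}

theorem measurable_sqrt_smul_gbar (hg : ∀ θ, Measurable fun x => g x θ) (n : ℕ) (θ : E p) :
    Measurable fun x : Fin n → 𝒳 => √(n : ℝ) • gbar g x θ :=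
  ((Finset.measurable_fun_sum _ fun j _ => (hg θ).comp (measurable_pi_apply j)).const_smul
    (n : ℝ)⁻¹).const_smul √(n : ℝ)

theorem integrable_cube_of_lintegral_le {ν : Measure 𝒳} {h : 𝒳 → E p} (hh : Measurable h) {K : ℝ≥0}
    (hK : ∫⁻ x, ‖h x‖ₑ ^ 3 ∂ν ≤ K) :
    Integrable (fun x => ‖h x‖ ^ 3) ν ∧ ∫ x, ‖h x‖ ^ 3 ∂ν ≤ K := by
  have e : ∀ x, ‖h x‖ₑ ^ 3 = ENNReal.ofReal (‖h x‖ ^ 3) := fun x => by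
    rw [ENNReal.ofReal_pow (norm_nonneg _), ofReal_norm]
  have hm : AEStronglyMeasurable (fun x => ‖h x‖ ^ 3) ν :=
    (hh.norm.pow_const 3).aestronglyMeasurable
  simp only [e] at hK
  refine ⟨⟨hm, ?_⟩, ?_⟩
  · rw [hasFiniteIntegral_iff_ofReal (ae_of_all _ fun x => pow_nonneg (norm_nonneg _) 3)]
    exact hK.trans_lt ENNReal.coe_lt_top
  · rw [integral_eq_lintegral_of_nonneg_ae (ae_of_all _ fun x => pow_nonneg (norm_nonneg _) 3) hm]
    exact ENNReal.toReal_le_of_le_ofReal K.2 (by simpa using hK)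

theorem abs_inner_cube_le (ξ v : E p) : |inner ℝ ξ v| ^ 3 ≤ ‖ξ‖ ^ 3 * ‖v‖ ^ 3 := by
  rw [← mul_pow]
  exact pow_le_pow_left₀ (abs_nonneg _) (abs_real_inner_le_norm _ _) 3

/-- The central limit theorem for the scaled means under contiguous alternatives. -/
theorem IsContiguousAlternative.tendsto_charFun (h : IsContiguousAlternative F₀ F g c θ₀ θ f)
    (hg : ∀ θ, Measurable fun x => g x θ) (henv : Envelope g θ₀ a δ)
    (ha : Integrable (fun x => a x ^ 3) F₀) (ξ : E p) :
    Tendsto (fun n : ℕ => charFun ((sampleLaw (F n) n).map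
      fun x => √(n : ℝ) • gbar g x (θ n)) ξ) atTop
      (𝓝 (Complex.exp (-(inner ℝ ((∫ x, outer (g x θ₀) ∂F₀) ξ) ξ / 2 : ℝ)))) := by
  obtain ⟨K, hK⟩ := h.third_moment
  have hmeas : ∀ n, Measurable fun x => inner ℝ ξ (g x (θ n)) := fun n =>
    (hg (θ n)).const_inner
  have hcube : ∀ᶠ n in atTop, Integrable (fun x => |inner ℝ ξ (g x (θ n))| ^ 3) (F n) ∧
      ∫ x, |inner ℝ ξ (g x (θ n))| ^ 3 ∂(F n) ≤ ‖ξ‖ ^ 3 * K := by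
    filter_upwards [hK] with n hn
    obtain ⟨h1, h2⟩ := integrable_cube_of_lintegral_le (hg (θ n)) hn
    have h3 : Integrable (fun x => |inner ℝ ξ (g x (θ n))| ^ 3) (F n) :=
      (h1.const_mul (‖ξ‖ ^ 3)).mono' ((hmeas n).abs.pow_const 3).aestronglyMeasurable
        (ae_of_all _ fun x => by
          rw [Real.norm_of_nonneg (by positivity)]; exact abs_inner_cube_le _ _)
    refine ⟨h3, (integral_mono h3 (h1.const_mul (‖ξ‖ ^ 3)) fun x =>
      abs_inner_cube_le ξ (g x (θ n))).trans ?_⟩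
    rw [integral_const_mul]
    gcongr
  -- Projection on a fixed `ξ` reduces the vector statement to the scalar array `⟪ξ, g⟫`.
  have hb : CubeBounded F (fun n x => inner ℝ ξ (g x (θ n))) (‖ξ‖ ^ 3 * K) :=
    ⟨hmeas, hcube.mono fun _ => And.left, hcube.mono fun _ => And.right⟩
  have hmean : ∀ᶠ n in atTop, ∫ x, inner ℝ ξ (g x (θ n)) ∂(F n) = 0 := by
    filter_upwards [hK, h.unbiased] with n hn h0
    have h1 := (integrable_cube_of_lintegral_le (hg (θ n)) hn).1
    have hi : Integrable (fun x => g x (θ n)) (F n) :=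
      (integrable_norm_iff (hg (θ n)).aestronglyMeasurable).1
        (integrable_of_cube (hg (θ n)).norm (by simpa only [abs_norm] using h1))
    rw [integral_inner hi, h0, inner_zero_right]
  have hsec : Tendsto (fun i : Σ n, Fin n → 𝒳 =>
      (i.1 : ℝ)⁻¹ * ∑ j, inner ℝ ξ (g (i.2 j) (θ i.1)) ^ 2) (whp fun n => sampleLaw (F n) n)
      (𝓝 (inner ℝ ((∫ x, outer (g x θ₀) ∂F₀) ξ) ξ)) := by
    have hc : Continuous fun T : E p →L[ℝ] E p => inner ℝ (T ξ) ξ := by fun_prop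
    refine ((hc.tendsto _).comp (h.tendsto_Sbar hg henv ha)).congr fun i => ?_
    exact inner_sum_outer (fun j => g (i.2 j) (θ i.1)) ξ
  refine (hb.tendsto_charFun hmean hsec).congr fun n => ?_
  rw [charFun_map (measurable_sqrt_smul_gbar hg n (θ n)).aemeasurable]
  refine integral_congr_ae (ae_of_all _ fun x => ?_)
  simp only
  congr 3
  rw [real_inner_comm, gbar, vmean, smul_smul, real_inner_smul_right, inner_sum, ← div_eq_mul_inv,
    Real.sqrt_div_self]

/-- Along contiguous alternatives, a property holds with probability tending to one if it holds
eventually along all families of samples with bounded scaled means. -/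
theorem IsContiguousAlternative.whp_le (h : IsContiguousAlternative F₀ F g c θ₀ θ f)
    (hg : ∀ θ, Measurable fun x => g x θ) (henv : Envelope g θ₀ a δ)
    (ha : Integrable (fun x => a x ^ 3) F₀) (hB : ∫ x, a x ^ 3 ∂F₀ < B)
    {l : Filter (Σ n, Fin n → 𝒳)}
    (hl : ∀ l' ≤ whp (fun n => sampleLaw (F n) n), Samples l' g c θ₀ a B
      (∫ x, outer (g x θ₀) ∂F₀) (∫ x, fderiv ℝ (g x) θ₀ ∂F₀) Sigma.fst Sigma.snd
      (fun i => θ i.1) f → l' ≤ l) :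
    whp (fun n => sampleLaw (F n) n) ≤ l := by
  have hψ : Continuous fun ξ : E p =>
      Complex.exp (-(inner ℝ ((∫ x, outer (g x θ₀) ∂F₀) ξ) ξ / 2 : ℝ)) := by fun_prop
  have htail : ∀ ε > 0, ∃ M : ℝ, ∀ n : ℕ,
      sampleLaw (F n) n {x | M < ‖√(n : ℝ) • gbar g x (θ n)‖} ≤ ε := fun _ hε =>
    exists_tail_bound (fun n => (measurable_sqrt_smul_gbar hg n (θ n)).aemeasurable)
      hψ.continuousAt (h.tendsto_charFun hg henv ha) hε
  exact tendsto_whp_of_tight (W := fun i : Σ n, Fin n → 𝒳 => √(i.1 : ℝ) • gbar g i.2 (θ i.1)) htail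
    fun M => hl _ inf_le_left (h.samples hg henv ha hB M)

end ScaledMean

end EmpLik

/-! ### The main theorem. -/

theorem mainTheorem8 {𝒳 : Type*} [MeasurableSpace 𝒳] {p q : ℕ}
    (F₀ : MeasureTheory.Measure 𝒳) [MeasureTheory.IsProbabilityMeasure F₀]
    (g : 𝒳 → EmpLik.E p → EmpLik.E p) (hg : ∀ θ, Measurable fun x => g x θ)
    (c : EmpLik.E p → EmpLik.E q) (θ₀ : EmpLik.E p)
    (hmean : ∫ x, g x θ₀ ∂F₀ = 0) (hreg : EmpLik.Regular F₀ g θ₀)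
    (hnull : c θ₀ = 0) (hc : EmpLik.RegularConstraint c θ₀) :
    ∃ U ∈ 𝓝 θ₀,
      ∀ (F : ℕ → MeasureTheory.Measure 𝒳) [∀ n, MeasureTheory.IsProbabilityMeasure (F n)]
        (θ : ℕ → EmpLik.E p) (fbar : EmpLik.E q),
        EmpLik.IsContiguousAlternative F₀ F g c θ₀ θ fbar →
      ∀ Θ ∈ 𝓝 θ₀,
        -- a restricted maximizer exists with probability tending to one if `Θ ⊆ U`
        (Θ ⊆ U → Tendsto (fun n => EmpLik.sampleLaw (F n) n
            {x | ¬ ∃ θ' t', EmpLik.IsRestrictedMELE g c Θ x θ' t'}) atTop (𝓝 0)) ∧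
        -- the limit law of the statistic at a restricted maximizer over `Θ` that lies in `U`
        (∀ (φ : ℝ → ℝ), EmpLik.PhiClass φ →
          ∀ θtilde ttilde : ∀ n : ℕ, (Fin n → 𝒳) → EmpLik.E p,
          Tendsto (fun n => EmpLik.sampleLaw (F n) n
            {x | ¬ (θtilde n x ∈ U ∧
              EmpLik.IsRestrictedMELE g c Θ x (θtilde n x) (ttilde n x))}) atTop (𝓝 0) →
          (∀ n, AEMeasurable (fun x => EmpLik.statistic φ g x (θtilde n x) (ttilde n x))
            (EmpLik.sampleLaw (F n) n)) →
          MeasureTheory.TendstoInDistribution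
            (fun n x => EmpLik.statistic φ g x (θtilde n x) (ttilde n x)) atTop
            (id : ℝ → ℝ) (fun n => EmpLik.sampleLaw (F n) n)
            (EmpLik.noncentralChiSquared q
              (fbar.ofLp ⬝ᵥ (EmpLik.Q F₀ g c θ₀ *ᵥ fbar.ofLp)))) := by
  obtain ⟨a, B, δ, κ, Ginv, D, L, ha, hB, hs, hl, hL⟩ := EmpLik.exists_localSetup hg hreg hnull hc
  refine ⟨Metric.closedBall θ₀ δ, Metric.closedBall_mem_nhds θ₀ hs.env.pos,
    fun F _ θ fbar h Θ hΘ => ⟨fun hsub => ?_, fun φ hφ θtilde ttilde hmax hmeas => ?_⟩⟩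
  -- An event of probability tending to one is a principal filter above `whp`, and a limit is a
  -- `comap` filter above it, so `whp_le` serves both claims.
  · exact le_principal_iff.1 <| h.whp_le hg hs.env ha hB fun _ _ hsam =>
      le_principal_iff.2 <| hsam.eventually_exists_restrictedMELE hl hs hΘ hsub
  · have hW := EmpLik.tendstoInDistribution_norm_sub_sq
      (W := fun n (x : Fin n → 𝒳) => √(n : ℝ) • EmpLik.gbar g x (θ n))
      (fun n => (EmpLik.measurable_sqrt_smul_gbar hg n (θ n)).aemeasurable)
      (h.tendsto_charFun hg hs.env ha) hl.standard (L fbar)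
    have hev : ∀ᶠ i in EmpLik.whp fun n => EmpLik.sampleLaw (F n) n,
        θtilde i.1 i.2 ∈ Metric.closedBall θ₀ δ ∧
          EmpLik.IsRestrictedMELE g c Θ i.2 (θtilde i.1 i.2) (ttilde i.1 i.2) := hmax
    -- Since `l' ≤ whp`, the hypotheses on the estimator pass to each restricted filter.
    have hsub := tendsto_iff_comap.2 <| h.whp_le hg hs.env ha hB fun l' hl' hsam =>
      tendsto_iff_comap.1 <| hsam.tendsto_statistic_sub hl hs hΘ
        (θ := fun i => θtilde i.1 i.2) (t := fun i => ttilde i.1 i.2)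
        ((hev.filter_mono hl').mono fun _ => And.left)
        ((hev.filter_mono hl').mono fun _ => And.right) hφ
    rw [← hL fbar]
    exact hW.of_tendsto_sub hmeas hsub
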